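/- Conventions. Let $X$ be a simplicial complex (possibly infinite, and not assumed to be locally finite or finite dimensional). $X$ is \emph{simply connected} if its geometric realization (with the weak topology) is nonempty, path connected and has trivial fundamental group. Write $v\sim v'$ if $v\ne v'$ are vertices joined by an edge of $X$. $X$ is \emph{flag} if every nonempty finite set of vertices that are pairwise joined by edges spans a simplex. The \emph{link} of a simplex $\sigma$ is the complex of all simplices $\tau$ of $X$ with $\tau\cap\sigma=\emptyset$ such that $\tau\cup\sigma$ spans a simplex of $X$. For $k\ge 4$, a \emph{full $k$-cycle} $(v_1,\ldots,v_k)$ in $X$ consists of pairwise distinct vertices such that two of them are joined by an edge of $X$ if and only if they are cyclically consecutive. A complex is \emph{$k$-large} if it is flag and has no full $j$-cycle with $4\le j<k$; it is \emph{locally $k$-large} if the links of all its simplices are $k$-large. For $k\geq 4$, a \emph{$k$-wheel} $(v_0;v_1,\ldots,v_k)$ is a full $k$-cycle $(v_1,\ldots,v_k)$ together with a vertex $v_0\sim v_1,\ldots,v_k$. For $k,l\ge 4$, a \emph{$(k,l)$-dwheel} is the union of a $k$-wheel $(v_0;v_1,\ldots,v_{k-2},w,v_0')$ and an $l$-wheel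 $(v_0';v_1',\ldots,v_{l-2}',w,v_0)$ with $v_1=v_1'$ or $v_1\sim v_1'$; its \emph{boundary length} is $k+l-4$ if $v_1=v_1'$, and $k+l-3$ otherwise. A flag complex $X$ is \emph{$m$-located} if for every dwheel of boundary length at most $m$ there is a vertex $y$ of $X$ such that every vertex of the dwheel is equal or adjacent to $y$. \textbf{Theorem A.} There is a universal constant $\delta\ge 0$ with the following property. Let $X$ be a simply connected simplicial complex that is $8$-located and locally $5$-large. Then the $1$-skeleton of $X$, with the path metric $d$ in which every edge has length $1$, is Gromov $\delta$-hyperbolic: for all points $o,x,y,z$ of the $1$-skeleton (vertices or points on edges), $$(x|z)_o\;\ge\;\min\{(x|y)_o,\,(y|z)_o\}-\delta,\qquad\text{where } (a|b)_o=\tfrac12\bigl(d(a,o)+d(b,o)-d(a,b)\bigr).$$ -/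

import Mathlib

universe u

namespace PreAbstractSimplicialComplex

variable {V : Type u}

open Classical in
/-- Two distinct vertices are adjacent if they span an edge: the graph underlying the
`1`-skeleton of `X`. -/
def skeletonGraph (X : PreAbstractSimplicialComplex V) : SimpleGraph V where
  Adj v w := v ≠ w ∧ {v, w} ∈ X.faces
  symm := ⟨fun v w h => ⟨h.1.symm, by rw [Finset.pair_comm]; exact h.2⟩⟩
  loopless := ⟨fun _ h => h.1 rfl⟩

/-- `X` is flag: every nonempty finite set of vertices of `X` that are pairwise joined by edges
is a simplex of `X`. -/
def IsFlag (X : PreAbstractSimplicialComplex V) : Prop :=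
  ∀ A : Finset V, A.Nonempty → (∀ v ∈ A, {v} ∈ X.faces) →
    (∀ v ∈ A, ∀ w ∈ A, v ≠ w → X.skeletonGraph.Adj v w) → A ∈ X.faces

open Classical in
/-- The link of `σ`: all simplices `τ` of `X` that are disjoint from `σ` and span a simplex of `X`
together with `σ`. -/
def link (X : PreAbstractSimplicialComplex V) (σ : Finset V) : PreAbstractSimplicialComplex V where
  faces := {τ | τ ∈ X.faces ∧ Disjoint τ σ ∧ τ ∪ σ ∈ X.faces}
  isRelLowerSet_faces := by
    rintro τ ⟨hτ, hd, hu⟩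
    refine ⟨(X.isRelLowerSet_faces hτ).1, fun ρ hρ hne => ?_⟩
    exact ⟨(X.isRelLowerSet_faces hτ).2 hρ hne, hd.mono_left hρ,
      (X.isRelLowerSet_faces hu).2 (Finset.union_subset_union_left hρ)
        (hne.mono Finset.subset_union_left)⟩

/-- `(c 0, …, c (k - 1))` is a full `k`-cycle of `X`, `k ≥ 4`: its vertices are pairwise distinct,
and two of them are joined by an edge of `X` exactly if they are consecutive in the cyclic order.
(As `k ≥ 4`, no three of the vertices are then pairwise adjacent, so that the cycle is a full
subcomplex.) -/
structure IsFullCycle (X : PreAbstractSimplicialComplex V) (k : ℕ) (c : ZMod k → V) : Prop where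
  four_le : 4 ≤ k
  injective : Function.Injective c
  adj_iff : ∀ i j, X.skeletonGraph.Adj (c i) (c j) ↔ j = i + 1 ∨ i = j + 1

/-- `X` is `k`-large: it is flag and has no full `j`-cycles with `j < k`. -/
def IsLarge (X : PreAbstractSimplicialComplex V) (k : ℕ) : Prop :=
  X.IsFlag ∧ ∀ j < k, ∀ c : ZMod j → V, ¬ X.IsFullCycle j c

/-- `X` is locally `k`-large: the links of all its simplices are `k`-large. -/
def IsLocallyLarge (X : PreAbstractSimplicialComplex V) (k : ℕ) : Prop :=
  ∀ σ ∈ X.faces, (X.link σ).IsLarge k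

/-- `(v₀; c 0, …, c (k - 1))` is a `k`-wheel in `X`. -/
structure IsWheel (X : PreAbstractSimplicialComplex V) (k : ℕ) (v₀ : V) (c : ZMod k → V) :
    Prop where
  fullCycle : X.IsFullCycle k c
  adj_center : ∀ i, X.skeletonGraph.Adj v₀ (c i)

/-- A `(k, l)`-dwheel `(v₀, v₀', w; v₁, …, v_{k-2}; v₁', …, v_{l-2}')`: the `k`-wheel
`(v₀; v₁, …, v_{k-2}, w, v₀')` is `(v₀; c 0, …, c (k - 1))`, the `l`-wheel
`(v₀'; v₁', …, v_{l-2}', w, v₀)` is `(v₀'; c' 0, …, c' (l - 1))`, and `v₁ = v₁'` or `v₁ ∼ v₁'`. -/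
structure IsDWheel (X : PreAbstractSimplicialComplex V) (k l : ℕ) (v₀ v₀' w : V)
    (c : ZMod k → V) (c' : ZMod l → V) : Prop where
  wheel : X.IsWheel k v₀ c
  wheel' : X.IsWheel l v₀' c'
  last : c (-1) = v₀'
  last' : c' (-1) = v₀
  penultimate : c (-2) = w
  penultimate' : c' (-2) = w
  first : c 0 = c' 0 ∨ X.skeletonGraph.Adj (c 0) (c' 0)

open Classical in
/-- The length of the boundary cycle `(v₁, …, v_{k-2}, w, v_{l-2}', …, v₁')` of a `(k, l)`-dwheel
(with `v₁` and `v₁'` identified if they are equal). -/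
noncomputable def dwheelBoundaryLength (k l : ℕ) (c : ZMod k → V) (c' : ZMod l → V) : ℕ :=
  if c 0 = c' 0 then k + l - 4 else k + l - 3

/-- The vertices of the combinatorial ball of radius `1` around `y`. -/
def oneBall (X : PreAbstractSimplicialComplex V) (y : V) : Set V :=
  {v | v = y ∨ X.skeletonGraph.Adj y v}

/-- `X` is `m`-located: it is flag, and every dwheel with boundary length at most `m` is contained
in a `1`-ball (a full subcomplex, so that only vertices matter). -/
def IsLocated (X : PreAbstractSimplicialComplex V) (m : ℕ) : Prop :=
  X.IsFlag ∧ ∀ (k l : ℕ) (v₀ v₀' w : V) (c : ZMod k → V) (c' : ZMod l → V),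
    X.IsDWheel k l v₀ v₀' w c c' → dwheelBoundaryLength k l c c' ≤ m →
      ∃ y, {y} ∈ X.faces ∧ Set.range c ⊆ X.oneBall y ∧ Set.range c' ⊆ X.oneBall y

/-- The geometric realization of `X`, in barycentric coordinates. -/
def Realization (X : PreAbstractSimplicialComplex V) : Type u :=
  {x : V →₀ ℝ // (∀ v, 0 ≤ x v) ∧ (x.sum fun _ a => a) = 1 ∧ x.support ∈ X.faces}

namespace Realization

variable {X : PreAbstractSimplicialComplex V}

/-- The closed simplex of the realization with vertex set `s`. -/
def closedFace (X : PreAbstractSimplicialComplex V) (s : Finset V) : Set X.Realization :=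
  {x | x.1.support ⊆ s}

/-- The weak topology: a set is open exactly if its trace on each closed simplex is open, where
closed simplices carry the Euclidean topology given by the barycentric coordinates. -/
instance : TopologicalSpace X.Realization :=
  ⨆ s : X.faces,
    TopologicalSpace.coinduced (fun x : closedFace X s => (x : X.Realization))
      (TopologicalSpace.induced (fun x v => x.1.1 v : closedFace X s → V → ℝ)
        Pi.topologicalSpace)

end Realization

/-- The geometric `1`-skeleton of `X`: the union of the vertices and the closed edges. -/
def OneSkeleton (X : PreAbstractSimplicialComplex V) : Type u :=
  {x : X.Realization // x.1.support.card ≤ 2}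

namespace OneSkeleton

variable {X : PreAbstractSimplicialComplex V}

/-- The two points lie on a common closed edge of `X` (or are the same vertex). -/
def OnCommonEdge (x y : X.OneSkeleton) : Prop :=
  ∃ s ∈ X.faces, s.card ≤ 2 ∧ x.1.1.support ⊆ s ∧ y.1.1.support ⊆ s

/-- For two points of a common edge `{u, v}`, this is their distance `|x u - y u| = |x v - y v|`
on this edge, regarded as a segment of length `1`. -/
noncomputable def edgeDist (x y : X.OneSkeleton) : ℝ :=
  ((x.1.1 - y.1.1).sum fun _ a => |a|) / 2

/-- The path metric of the `1`-skeleton with edges of length `1`: the infimum of the lengths of the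
piecewise linear paths `p 0, …, p n` from `x` to `y`. (If `X` is disconnected, points of different
components get the value `0`.) -/
noncomputable def pathDist (x y : X.OneSkeleton) : ℝ :=
  sInf {L : ℝ | ∃ (n : ℕ) (p : ℕ → X.OneSkeleton), p 0 = x ∧ p n = y ∧
    (∀ i < n, OnCommonEdge (p i) (p (i + 1))) ∧
    L = ∑ i ∈ Finset.range n, edgeDist (p i) (p (i + 1))}

end OneSkeleton

end PreAbstractSimplicialComplex

/-- The Gromov product `(x | y)_o` with respect to a distance function `d`. -/
noncomputable def gromovProduct {P : Type u} (d : P → P → ℝ) (o x y : P) : ℝ :=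
  (d x o + d y o - d x y) / 2

/-- Gromov's `δ`-hyperbolicity of a set with a distance function. -/
def IsGromovHyperbolic {P : Type u} (d : P → P → ℝ) (δ : ℝ) : Prop :=
  ∀ o x y z : P,
    min (gromovProduct d o x y) (gromovProduct d o y z) - δ ≤ gromovProduct d o x z

/-! The proof shows that geodesics issuing from a vertex `o` diverge exponentially. It works in the
`1`-skeleton as a graph, with the spheres around `o` as layers, and uses only two local facts: there
are no 4-wheels without diagonals (`NoFourWheel`), and dwheels of boundary length at most 8 lie in
1-balls (`HasSmallDwheels`).

Suppose first that the layers have the descent property `HasDescent`. Then wheels can be completed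
downwards through consecutive layers. A 1-ball meets at most three consecutive layers, so a short
dwheel reaching over four is impossible; over three layers, the centre of its ball is a new vertex
of the middle layer. Hence the lower neighbours of two nonadjacent lower neighbours of a vertex are
adjacent (`adj_of_cap`), lower neighbours of the two ends of an edge of a layer can be joined
cheaply (`exists_adj_adj_below_edge`), and paths of three edges can be shortened or acquire a common
lower neighbour (`shorten_three`). For suitably weighted chains in a layer it follows that passing
to lower neighbours multiplies the weight by at most 14/15, up to an additive constant
(`reach_below`). Iterating this along a geodesic gives the four-point inequality (`four_point`).

The descent property comes from simple connectivity. A cover of the graph is built ball by ball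
around `o`: a point of the outer sphere receives a new neighbour for every edge that does not lift
yet, and new neighbours with the same image are identified when the points below them are equal,
adjacent or have a suitable common neighbour. Location makes this relation transitive
(`glued_trans`) and lets triangles lift (`exists_common`), so the construction continues forever,
and its layers have the descent property by design. The cover defines a covering space of the
realization; simple connectivity makes it injective on vertices
(`injective_of_simplyConnectedSpace`), so the layers of the cover are the distance spheres of the
graph. Finally, the path metric differs from the graph distance by a bounded amount. -/

/-! ### Wheels and dwheels in graphs. -/

/-- `a, b, c, d, e` is a full `5`-cycle in the neighbourhood of `x`. -/
structure Wheel5 {V : Type u} (G : SimpleGraph V) (x a b c d e : V) : Prop where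
  center : G.Adj x a ∧ G.Adj x b ∧ G.Adj x c ∧ G.Adj x d ∧ G.Adj x e
  edges : G.Adj a b ∧ G.Adj b c ∧ G.Adj c d ∧ G.Adj d e ∧ G.Adj e a
  chords : ¬ G.Adj a c ∧ ¬ G.Adj a d ∧ ¬ G.Adj b d ∧ ¬ G.Adj b e ∧ ¬ G.Adj c e

/-- `a, b, c, d, e, f` is a full `6`-cycle in the neighbourhood of `x`. -/
structure Wheel6 {V : Type u} (G : SimpleGraph V) (x a b c d e f : V) : Prop where
  center : G.Adj x a ∧ G.Adj x b ∧ G.Adj x c ∧ G.Adj x d ∧ G.Adj x e ∧ G.Adj x f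
  edges : G.Adj a b ∧ G.Adj b c ∧ G.Adj c d ∧ G.Adj d e ∧ G.Adj e f ∧ G.Adj f a
  chords : (¬ G.Adj a c ∧ ¬ G.Adj a d ∧ ¬ G.Adj a e) ∧ (¬ G.Adj b d ∧ ¬ G.Adj b e ∧ ¬ G.Adj b f) ∧
    (¬ G.Adj c e ∧ ¬ G.Adj c f) ∧ ¬ G.Adj d f

/-- `a, b, c, d, e, f, g` is a full `7`-cycle in the neighbourhood of `x`. -/
structure Wheel7 {V : Type u} (G : SimpleGraph V) (x a b c d e f g : V) : Prop where
  center : G.Adj x a ∧ G.Adj x b ∧ G.Adj x c ∧ G.Adj x d ∧ G.Adj x e ∧ G.Adj x f ∧ G.Adj x g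
  edges : G.Adj a b ∧ G.Adj b c ∧ G.Adj c d ∧ G.Adj d e ∧ G.Adj e f ∧ G.Adj f g ∧ G.Adj g a
  chords : (¬ G.Adj a c ∧ ¬ G.Adj a d ∧ ¬ G.Adj a e ∧ ¬ G.Adj a f) ∧
    (¬ G.Adj b d ∧ ¬ G.Adj b e ∧ ¬ G.Adj b f ∧ ¬ G.Adj b g) ∧
    (¬ G.Adj c e ∧ ¬ G.Adj c f ∧ ¬ G.Adj c g) ∧ (¬ G.Adj d f ∧ ¬ G.Adj d g) ∧ ¬ G.Adj e g

namespace SimpleGraph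

variable {V : Type u} (G : SimpleGraph V)

/-- `y` is equal or adjacent to `a`. -/
def Near (y a : V) : Prop := y = a ∨ G.Adj y a

/-- The cyclic sequence `c` is a full cycle of length at least `5` around `x`. -/
structure IsWheelAt (k : ℕ) (x : V) (c : ZMod k → V) : Prop where
  five_le : 5 ≤ k
  adj_iff : ∀ i j, G.Adj (c i) (c j) ↔ j = i + 1 ∨ i = j + 1
  center : ∀ i, G.Adj x (c i)

variable {G}

theorem _root_.Wheel5.isWheelAt {x a b c d e : V} (h : Wheel5 G x a b c d e) :
    G.IsWheelAt 5 x (![a, b, c, d, e] : Fin 5 → V) where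
  five_le := by norm_num
  adj_iff := by
    obtain ⟨-, ⟨h1, h2, h3, h4, h5⟩, h6, h7, h8, h9, h10⟩ := h
    have h0 := h5.symm
    change ∀ i j : Fin 5, G.Adj (![a, b, c, d, e] i) (![a, b, c, d, e] j) ↔ j = i + 1 ∨ i = j + 1
    intro i j
    fin_cases i <;> fin_cases j <;> simp [*, G.adj_comm]
  center := by
    obtain ⟨⟨h1, h2, h3, h4, h5⟩, -, -⟩ := h
    change ∀ i : Fin 5, G.Adj x (![a, b, c, d, e] i)
    intro i
    fin_cases i <;> simp [*]

theorem _root_.Wheel6.isWheelAt {x a b c d e f : V} (h : Wheel6 G x a b c d e f) :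
    G.IsWheelAt 6 x (![a, b, c, d, e, f] : Fin 6 → V) where
  five_le := by norm_num
  adj_iff := by
    obtain ⟨-, ⟨h1, h2, h3, h4, h5, h6⟩, ⟨h7, h8, h9⟩, ⟨h10, h11, h12⟩, ⟨h13, h14⟩, h15⟩ := h
    have h0 := h6.symm
    change ∀ i j : Fin 6, G.Adj (![a, b, c, d, e, f] i) (![a, b, c, d, e, f] j) ↔ j = i + 1 ∨ i = j + 1
    intro i j
    fin_cases i <;> fin_cases j <;> simp [*, G.adj_comm]
  center := by
    obtain ⟨⟨h1, h2, h3, h4, h5, h6⟩, -, -⟩ := h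
    change ∀ i : Fin 6, G.Adj x (![a, b, c, d, e, f] i)
    intro i
    fin_cases i <;> simp [*]

theorem _root_.Wheel7.isWheelAt {x a b c d e f g : V} (h : Wheel7 G x a b c d e f g) :
    G.IsWheelAt 7 x (![a, b, c, d, e, f, g] : Fin 7 → V) where
  five_le := by norm_num
  adj_iff := by
    obtain ⟨-, ⟨h1, h2, h3, h4, h5, h6, h7⟩, ⟨h8, h9, h10, h11⟩, ⟨h12, h13, h14, h15⟩, ⟨h16, h17, h18⟩, ⟨h19, h20⟩, h21⟩ := h
    have h0 := h7.symm
    change ∀ i j : Fin 7, G.Adj (![a, b, c, d, e, f, g] i) (![a, b, c, d, e, f, g] j) ↔ j = i + 1 ∨ i = j + 1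
    intro i j
    fin_cases i <;> fin_cases j <;> simp [*, G.adj_comm]
  center := by
    obtain ⟨⟨h1, h2, h3, h4, h5, h6, h7⟩, -, -⟩ := h
    change ∀ i : Fin 7, G.Adj x (![a, b, c, d, e, f, g] i)
    intro i
    fin_cases i <;> simp [*]

variable (G) in
/-- Every dwheel of boundary length at most `8` lies in a `1`-ball. -/
def HasSmallDwheels : Prop :=
  ∀ (k l : ℕ) (x x' : V) (c : ZMod k → V) (c' : ZMod l → V), G.IsWheelAt k x c →
    G.IsWheelAt l x' c' → c (-1) = x' → c' (-1) = x → c (-2) = c' (-2) →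
    (c 0 = c' 0 ∧ k + l ≤ 12 ∨ G.Adj (c 0) (c' 0) ∧ k + l ≤ 11) →
    ∃ y, (∀ i, G.Near y (c i)) ∧ ∀ i, G.Near y (c' i)

variable (G) in
/-- There are no `4`-wheels. -/
def NoFourWheel : Prop :=
  ∀ ⦃x a b c d : V⦄, G.Adj x a → G.Adj x b → G.Adj x c → G.Adj x d → G.Adj a b → G.Adj b c →
    G.Adj c d → G.Adj d a → a ≠ c → b ≠ d → ¬ G.Adj a c → G.Adj b d

theorem HasSmallDwheels.exists_near55 (hG : G.HasSmallDwheels) {x x' w p p' a b a' b' : V}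
    (h : Wheel5 G x p a b w x') (h' : Wheel5 G x' p' a' b' w x)
    (hp : p = p' ∨ G.Adj p p') :
    ∃ y, (G.Near y p ∧ G.Near y a ∧ G.Near y b ∧ G.Near y w ∧ G.Near y x') ∧
      (G.Near y p' ∧ G.Near y a' ∧ G.Near y b' ∧ G.Near y w ∧ G.Near y x) := by
  obtain ⟨y, h1, h2⟩ := hG _ _ _ _ _ _ h.isWheelAt h'.isWheelAt rfl rfl rfl
    (hp.imp (⟨·, by norm_num⟩) (⟨·, by norm_num⟩))
  exact ⟨y, ⟨h1 (0 : Fin 5), h1 (1 : Fin 5), h1 (2 : Fin 5), h1 (3 : Fin 5), h1 (4 : Fin 5)⟩,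
    ⟨h2 (0 : Fin 5), h2 (1 : Fin 5), h2 (2 : Fin 5), h2 (3 : Fin 5), h2 (4 : Fin 5)⟩⟩

theorem HasSmallDwheels.exists_near56 (hG : G.HasSmallDwheels) {x x' w p p' a b a' b' c' : V}
    (h : Wheel5 G x p a b w x') (h' : Wheel6 G x' p' a' b' c' w x)
    (hp : p = p' ∨ G.Adj p p') :
    ∃ y, (G.Near y p ∧ G.Near y a ∧ G.Near y b ∧ G.Near y w ∧ G.Near y x') ∧
      (G.Near y p' ∧ G.Near y a' ∧ G.Near y b' ∧ G.Near y c' ∧ G.Near y w ∧ G.Near y x) := by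
  obtain ⟨y, h1, h2⟩ := hG _ _ _ _ _ _ h.isWheelAt h'.isWheelAt rfl rfl rfl
    (hp.imp (⟨·, by norm_num⟩) (⟨·, by norm_num⟩))
  exact ⟨y, ⟨h1 (0 : Fin 5), h1 (1 : Fin 5), h1 (2 : Fin 5), h1 (3 : Fin 5), h1 (4 : Fin 5)⟩,
    ⟨h2 (0 : Fin 6), h2 (1 : Fin 6), h2 (2 : Fin 6), h2 (3 : Fin 6), h2 (4 : Fin 6), h2 (5 : Fin 6)⟩⟩

theorem HasSmallDwheels.exists_near57 (hG : G.HasSmallDwheels) {x x' w p a b a' b' c' d' : V}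
    (h : Wheel5 G x p a b w x') (h' : Wheel7 G x' p a' b' c' d' w x) :
    ∃ y, (G.Near y p ∧ G.Near y a ∧ G.Near y b ∧ G.Near y w ∧ G.Near y x') ∧
      (G.Near y p ∧ G.Near y a' ∧ G.Near y b' ∧ G.Near y c' ∧ G.Near y d' ∧ G.Near y w ∧ G.Near y x) := by
  obtain ⟨y, h1, h2⟩ := hG _ _ _ _ _ _ h.isWheelAt h'.isWheelAt rfl rfl rfl
    (.inl ⟨rfl, by norm_num⟩)
  exact ⟨y, ⟨h1 (0 : Fin 5), h1 (1 : Fin 5), h1 (2 : Fin 5), h1 (3 : Fin 5), h1 (4 : Fin 5)⟩,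
    ⟨h2 (0 : Fin 7), h2 (1 : Fin 7), h2 (2 : Fin 7), h2 (3 : Fin 7), h2 (4 : Fin 7), h2 (5 : Fin 7), h2 (6 : Fin 7)⟩⟩

theorem HasSmallDwheels.exists_near66 (hG : G.HasSmallDwheels) {x x' w p a b c a' b' c' : V}
    (h : Wheel6 G x p a b c w x') (h' : Wheel6 G x' p a' b' c' w x) :
    ∃ y, (G.Near y p ∧ G.Near y a ∧ G.Near y b ∧ G.Near y c ∧ G.Near y w ∧ G.Near y x') ∧
      (G.Near y p ∧ G.Near y a' ∧ G.Near y b' ∧ G.Near y c' ∧ G.Near y w ∧ G.Near y x) := by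
  obtain ⟨y, h1, h2⟩ := hG _ _ _ _ _ _ h.isWheelAt h'.isWheelAt rfl rfl rfl
    (.inl ⟨rfl, by norm_num⟩)
  exact ⟨y, ⟨h1 (0 : Fin 6), h1 (1 : Fin 6), h1 (2 : Fin 6), h1 (3 : Fin 6), h1 (4 : Fin 6), h1 (5 : Fin 6)⟩,
    ⟨h2 (0 : Fin 6), h2 (1 : Fin 6), h2 (2 : Fin 6), h2 (3 : Fin 6), h2 (4 : Fin 6), h2 (5 : Fin 6)⟩⟩

end SimpleGraph

/-! ### The local hypotheses in terms of the graph. -/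

namespace AbstractSimplicialComplex

variable {V : Type u} {X : AbstractSimplicialComplex V}

theorem hasSmallDwheels (h : X.IsLocated 8) :
    X.toPreAbstractSimplicialComplex.skeletonGraph.HasSmallDwheels := by
  intro k l x x' c c' hc hc' e1 e2 e3 hd
  have key : ∀ {m : ℕ} {z : V} {f : ZMod m → V},
      X.toPreAbstractSimplicialComplex.skeletonGraph.IsWheelAt m z f → X.IsWheel m z f := by
    intro m z f hf
    refine ⟨⟨by have := hf.five_le; omega, fun i j hij => ?_, hf.adj_iff⟩, hf.center⟩
    have h5 := hf.five_le
    have hne : ∀ t : ℕ, 0 < t → t < 5 → (t : ZMod m) ≠ 0 := fun t h0 ht h => by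
      rw [ZMod.natCast_eq_zero_iff] at h
      exact absurd (Nat.le_of_dvd h0 h) (by omega)
    have h1 := hne 1 (by norm_num) (by norm_num)
    have h2 := hne 2 (by norm_num) (by norm_num)
    have h3 := hne 3 (by norm_num) (by norm_num)
    have h4 := hne 4 (by norm_num) (by norm_num)
    push_cast at h1 h2 h3 h4
    -- In a cycle of length at least 5 a vertex is determined by its two neighbours, so the
    -- adjacency pattern alone forces injectivity: the alternatives to `i = j` give `4 = 0` or `2 =
    -- 0` in `ZMod m`.
    have a1 := (hf.adj_iff j (i + 1)).1 (hij ▸ (hf.adj_iff i (i + 1)).2 (.inl rfl))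
    have a2 := (hf.adj_iff j (i - 1)).1 (hij ▸ (hf.adj_iff i (i - 1)).2 (.inr (by ring)))
    rcases a1 with a1 | a1
    · exact add_right_cancel a1
    · rcases a2 with a2 | a2
      · exact absurd (by linear_combination -a1 - a2) h4
      · exact absurd (by linear_combination a2 - a1) h2
  obtain ⟨y, -, hy, hy'⟩ := h.2 k l x x' (c (-2)) c c'
    ⟨key hc, key hc', e1, e2, rfl, e3.symm, hd.imp (·.1) (·.1)⟩ (by
      unfold PreAbstractSimplicialComplex.dwheelBoundaryLength
      have := hc.five_le
      have := hc'.five_le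
      split_ifs with h0
      · omega
      · have := hd.resolve_left (fun h => h0 h.1)
        omega)
  refine ⟨y, fun i => ?_, fun i => ?_⟩
  · exact (hy ⟨i, rfl⟩).imp Eq.symm id
  · exact (hy' ⟨i, rfl⟩).imp Eq.symm id

theorem mem_faces_of_pairwise (hX : X.IsFlag) {s : Finset V} (hs : s.Nonempty)
    (h : ∀ v ∈ s, ∀ w ∈ s, v ≠ w → X.toPreAbstractSimplicialComplex.skeletonGraph.Adj v w) :
    s ∈ X.faces :=
  hX s hs (fun v _ => X.singleton_mem v) h

/-- The rim would be a full 4-cycle in the link of the centre, because flagness identifies adjacency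
in the link with adjacency in `X`. -/
theorem noFourWheel (hX : X.IsFlag) (h : X.IsLocallyLarge 5) :
    X.toPreAbstractSimplicialComplex.skeletonGraph.NoFourWheel := by
  classical
  intro x a b c d xa xb xc xd ab bc cd da hac hbd hac'
  by_contra hbd'
  set G := X.toPreAbstractSimplicialComplex.skeletonGraph
  have key : ∀ v w, G.Adj x v → G.Adj x w →
      ((X.link {x}).skeletonGraph.Adj v w ↔ G.Adj v w) := by
    intro v w hv hw
    constructor
    · rintro ⟨hne, h1, -, -⟩
      exact ⟨hne, by convert h1⟩
    · rintro ⟨hne, h1⟩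
      have hvw : G.Adj v w := ⟨hne, h1⟩
      refine ⟨hne, by convert h1, ?_, ?_⟩
      · simp only [Finset.disjoint_singleton_right, Finset.mem_insert, Finset.mem_singleton, not_or]
        exact ⟨hv.ne, hw.ne⟩
      · apply mem_faces_of_pairwise hX ⟨x, by simp⟩
        intro p hp q hq hpq
        simp only [Finset.mem_union, Finset.mem_insert, Finset.mem_singleton] at hp hq
        rcases hp with (rfl | rfl) | rfl <;> rcases hq with (rfl | rfl) | rfl <;>
          first | exact absurd rfl hpq | assumption | (apply SimpleGraph.Adj.symm; assumption)
  refine (h {x} (X.singleton_mem x)).2 4 (by norm_num) (![a, b, c, d] : Fin 4 → V) ⟨le_rfl, ?_, ?_⟩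
  · change Function.Injective (![a, b, c, d] : Fin 4 → V)
    have := ab.ne; have := bc.ne; have := cd.ne; have := da.ne
    intro i j
    fin_cases i <;> fin_cases j <;> simp [*, eq_comm] <;> grind
  · change ∀ i j : Fin 4, (X.link {x}).skeletonGraph.Adj ((![a, b, c, d] : Fin 4 → V) i)
      ((![a, b, c, d] : Fin 4 → V) j) ↔ j = i + 1 ∨ i = j + 1
    have hx : ∀ i : Fin 4, G.Adj x ((![a, b, c, d] : Fin 4 → V) i) := by
      intro i; fin_cases i <;> assumption
    intro i j
    rw [key _ _ (hx i) (hx j)]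
    have := da.symm
    fin_cases i <;> fin_cases j <;> simp [ab, bc, cd, da, hac', hbd', this, G.adj_comm]

end AbstractSimplicialComplex

/-! ### Layers with the descent property. -/

namespace SimpleGraph

variable {V : Type u}

/-- Edges and pairs of lower neighbours of a vertex in the layers of the function `lev` behave as in
the spheres of a nonpositively curved complex. -/
structure HasDescent (G : SimpleGraph V) (lev : V → ℕ) : Prop where
  lev_le : ∀ ⦃x y⦄, G.Adj x y → lev x ≤ lev y + 1
  exists_below_edge : ∀ ⦃n x y⦄, G.Adj x y → lev x = n + 1 → lev y = n + 1 →
    ∃ u, lev u = n ∧ G.Adj x u ∧ G.Adj y u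
  below_vertex : ∀ ⦃n x u w⦄, lev x = n + 1 → G.Adj x u → G.Adj x w → lev u = n → lev w = n →
    u ≠ w → ¬ G.Adj u w → ∃ t, lev t = n ∧ G.Adj x t ∧ G.Adj u t ∧ G.Adj w t

/-- The layers of `lev` have the descent property and a bottom, and `G` satisfies the local
conditions on wheels. -/
structure IsLayered (G : SimpleGraph V) (lev : V → ℕ) : Prop extends HasDescent G lev where
  noFourWheel : G.NoFourWheel
  dwheels : G.HasSmallDwheels
  eq_of_lev_eq_zero : ∀ ⦃x y⦄, lev x = 0 → lev y = 0 → x = y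
  exists_below : ∀ ⦃n x⦄, lev x = n + 1 → ∃ u, lev u = n ∧ G.Adj x u

variable {G : SimpleGraph V} {lev : V → ℕ}

/-- A path with one inner vertex from `a` to `b` in the link of `x`, without chords,
with inner vertices in the layer `n`. -/
structure Fan1 (G : SimpleGraph V) (lev : V → ℕ) (n : ℕ) (x a b q : V) : Prop where
  lev_eq : lev q = n
  adj : G.Adj x q
  left : G.Adj a q
  right : G.Adj q b

/-- Such a path with `2` inner vertices, see `Fan1`. -/
structure Fan2 (G : SimpleGraph V) (lev : V → ℕ) (n : ℕ) (x a b q q' : V) : Prop where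
  lev_eq : lev q = n ∧ lev q' = n
  adj : G.Adj x q ∧ G.Adj x q'
  path : G.Adj a q ∧ G.Adj q q' ∧ G.Adj q' b
  chords : ¬ G.Adj a q' ∧ ¬ G.Adj q b

/-- Such a path with `3` inner vertices, see `Fan1`. -/
structure Fan3 (G : SimpleGraph V) (lev : V → ℕ) (n : ℕ) (x a b q r q' : V) : Prop where
  lev_eq : lev q = n ∧ lev r = n ∧ lev q' = n
  adj : G.Adj x q ∧ G.Adj x r ∧ G.Adj x q'
  path : G.Adj a q ∧ G.Adj q r ∧ G.Adj r q' ∧ G.Adj q' b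
  chords : ¬ G.Adj a r ∧ ¬ G.Adj a q' ∧ ¬ G.Adj q q' ∧ ¬ G.Adj q b ∧ ¬ G.Adj r b
  ne : q ≠ q'

/-- Common lower neighbours of `x, a` and of `x, b` coincide, are adjacent, or are linked by one
more vertex by `below_vertex`. A shortest such path has no chords. -/
theorem HasDescent.exists_fan (h : G.HasDescent lev) {n : ℕ} {x a b : V} (hx : lev x = n + 1)
    (ha : lev a = n + 1) (hb : lev b = n + 1) (xa : G.Adj x a) (xb : G.Adj x b) :
    (∃ q, Fan1 G lev n x a b q) ∨ (∃ q q', Fan2 G lev n x a b q q') ∨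
      ∃ q r q', Fan3 G lev n x a b q r q' := by
  obtain ⟨q, hq, xq, aq⟩ := h.exists_below_edge xa hx ha
  obtain ⟨q', hq', xq', bq'⟩ := h.exists_below_edge xb hx hb
  by_contra! hcon
  obtain ⟨h1, h2, h3⟩ := hcon
  have f1 : ∀ k, lev k = n → G.Adj x k → G.Adj a k → ¬ G.Adj k b :=
    fun k e1 e2 e3 e4 => h1 k ⟨e1, e2, e3, e4⟩
  have f2 : ∀ k k', lev k = n → lev k' = n → G.Adj x k → G.Adj x k' → G.Adj a k → G.Adj k k' →
      ¬ G.Adj k' b := fun k k' e1 e2 e3 e4 e5 e6 e7 => by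
    exact h2 k k' ⟨⟨e1, e2⟩, ⟨e3, e4⟩, ⟨e5, e6, e7⟩, fun e8 => f1 k' e2 e4 e8 e7, f1 k e1 e3 e5⟩
  have n1 : q ≠ q' := by rintro rfl; exact f1 q hq xq aq bq'.symm
  have n2 : ¬ G.Adj q q' := fun e => f2 q q' hq hq' xq xq' aq e bq'.symm
  obtain ⟨r, hr, xr, qr, qr'⟩ := h.below_vertex hx xq xq' hq hq' n1 n2
  exact h3 q r q' ⟨⟨hq, hr, hq'⟩, ⟨xq, xr, xq'⟩, ⟨aq, qr, qr'.symm, bq'.symm⟩,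
    ⟨fun e => f2 r q' hr hq' xr xq' e qr'.symm bq'.symm, fun e => f1 q' hq' xq' e bq'.symm, n2,
      f1 q hq xq aq, fun e => f2 q r hq hr xq xr aq qr e⟩, n1⟩

namespace IsLayered

variable (h : G.IsLayered lev)
include h

theorem near_lev {y a : V} (hy : G.Near y a) : lev y ≤ lev a + 1 ∧ lev a ≤ lev y + 1 := by
  rcases hy with rfl | hy
  · omega
  · exact ⟨h.lev_le hy, h.lev_le hy.symm⟩

/-- This is the contradiction that most applications of location end in: the dwheel contains
vertices three levels apart. -/
theorem not_near {y a b : V} (ha : G.Near y a) (hb : G.Near y b) : ¬ lev a + 2 < lev b := by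
  have := h.near_lev ha
  have := h.near_lev hb
  omega

theorem not_adj {a b : V} (hab : lev a + 1 < lev b) : ¬ G.Adj a b := fun hb => by
  have := h.lev_le hb.symm
  omega

end IsLayered
end SimpleGraph

/-! ### Caps: nonadjacent lower neighbours of a vertex. -/

namespace SimpleGraph

variable {V : Type u} {G : SimpleGraph V} {lev : V → ℕ}

/-- `w, t, w'` is a chordless path in the layer `n + 1`, all of whose vertices are adjacent to the
vertex `v` of the layer `n + 2`. -/
structure IsCap (G : SimpleGraph V) (lev : V → ℕ) (n : ℕ) (v w t w' : V) : Prop where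
  lev_eq : lev v = n + 2 ∧ lev w = n + 1 ∧ lev t = n + 1 ∧ lev w' = n + 1
  top : G.Adj v w ∧ G.Adj v t ∧ G.Adj v w'
  path : G.Adj w t ∧ G.Adj t w'
  chord : w ≠ w' ∧ ¬ G.Adj w w'

theorem IsCap.symm {n : ℕ} {v w t w' : V} (c : IsCap G lev n v w t w') :
    IsCap G lev n v w' t w :=
  ⟨⟨c.lev_eq.1, c.lev_eq.2.2.2, c.lev_eq.2.2.1, c.lev_eq.2.1⟩, ⟨c.top.2.2, c.top.2.1, c.top.1⟩,
    ⟨c.path.2.symm, c.path.1.symm⟩, ⟨c.chord.1.symm, fun e => c.chord.2 e.symm⟩⟩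

namespace IsLayered

variable (h : G.IsLayered lev)
include h

/-- The cycle `v, w, q, w'` around `t` would have no diagonals, since `v` and `q` are two levels
apart. -/
theorem not_fan1 {n : ℕ} {v w t w' : V} (c : IsCap G lev n v w t w') (q : V) :
    ¬ Fan1 G lev n t w w' q := by
  intro hq
  obtain ⟨⟨hv, hw, ht, hw'⟩, ⟨vw, vt, vw'⟩, ⟨wt, tw'⟩, hne, hww⟩ := c
  have := h.noFourWheel wt.symm vt.symm tw' hq.adj vw.symm vw' hq.right.symm hq.left.symm hne
    (by rintro rfl; have := hq.lev_eq; omega) hww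
  exact h.not_adj (by have := hq.lev_eq; omega) this.symm

/-- Through `v` the fan closes up to a 6-wheel around `t`. As `q, r, q'` is itself a cap below `t`,
there is a 5- or 6-wheel around `r` reaching one layer lower. Together they form a dwheel of
boundary length 7 or 8 that meets four layers. -/
theorem not_fan3 {n : ℕ} {v w t w' : V} (c : IsCap G lev n v w t w') (q r q' : V) :
    ¬ Fan3 G lev n t w w' q r q' := by
  intro h3
  obtain ⟨⟨hv, hw, ht, hw'⟩, ⟨vw, vt, vw'⟩, ⟨wt, tw'⟩, hne, hww⟩ := c
  obtain ⟨⟨lq, lr, lq'⟩, ⟨tq, tr, tq'⟩, ⟨wq, qr, rq', qw'⟩, ⟨c1, c2, c3, c4, c5⟩, ne⟩ := h3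
  obtain _ | m := n
  · exact ne (h.eq_of_lev_eq_zero lq lq')
  have A : Wheel6 G t q w v w' q' r := by
    have e1 := h.not_adj (a := q) (b := v) (by omega)
    have e2 := h.not_adj (a := r) (b := v) (by omega)
    have e3 := h.not_adj (a := q') (b := v) (by omega)
    refine ⟨?_, ?_, ?_⟩ <;> grind [G.adj_comm]
  rcases h.toHasDescent.exists_fan lr lq lq' qr.symm rq' with ⟨k, hk⟩ | ⟨k, k', hk⟩ | ⟨k, s, k', hk⟩
  · exact h.not_fan1 ⟨⟨ht, lq, lr, lq'⟩, ⟨tq, tr, tq'⟩, ⟨qr, rq'⟩, ne, c3⟩ k hk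
  · obtain ⟨⟨lk, lk'⟩, ⟨rk, rk'⟩, ⟨qk, kk, kq⟩, ⟨d1, d2⟩⟩ := hk
    have B : Wheel5 G r q k k' q' t := by
      have e1 := h.not_adj (a := k) (b := t) (by omega)
      have e2 := h.not_adj (a := k') (b := t) (by omega)
      refine ⟨?_, ?_, ?_⟩ <;> grind [G.adj_comm]
    obtain ⟨y, y1, y2⟩ := h.dwheels.exists_near56 B A (.inl rfl)
    exact h.not_near y1.2.1 y2.2.2.1 (by omega)
  · obtain ⟨⟨lk, ls, lk'⟩, ⟨rk, rs, rk'⟩, ⟨qk, ks, sk, kq⟩, ⟨d1, d2, d3, d4, d5⟩, -⟩ := hk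
    have B : Wheel6 G r q k s k' q' t := by
      have e1 := h.not_adj (a := k) (b := t) (by omega)
      have e2 := h.not_adj (a := k') (b := t) (by omega)
      have e3 := h.not_adj (a := s) (b := t) (by omega)
      refine ⟨?_, ?_, ?_⟩ <;> grind [G.adj_comm]
    obtain ⟨y, y1, y2⟩ := h.dwheels.exists_near66 B A
    exact h.not_near y1.2.1 y2.2.2.1 (by omega)

/-- Below the middle vertex `t` of a cap there are exactly two vertices of a wheel around `t`. -/
theorem fan2_of_cap {n : ℕ} {v w t w' : V} (c : IsCap G lev n v w t w') :
    ∃ p p', Fan2 G lev n t w w' p p' := by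
  rcases h.toHasDescent.exists_fan c.lev_eq.2.2.1 c.lev_eq.2.1 c.lev_eq.2.2.2 c.path.1.symm c.path.2 with
    ⟨q, hq⟩ | h2 | ⟨q, r, q', h3⟩
  · exact absurd hq (h.not_fan1 c q)
  · exact h2
  · exact absurd h3 (h.not_fan3 c q r q')

theorem wheel5_of_cap {n : ℕ} {v w t w' p p' : V} (c : IsCap G lev n v w t w')
    (f : Fan2 G lev n t w w' p p') : Wheel5 G t w v w' p' p := by
  obtain ⟨⟨hv, hw, ht, hw'⟩, ⟨vw, vt, vw'⟩, ⟨wt, tw'⟩, hne, hww⟩ := c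
  obtain ⟨⟨lp, lp'⟩, ⟨tp, tp'⟩, ⟨wp, pp, pw⟩, ⟨d1, d2⟩⟩ := f
  have e1 := h.not_adj (a := p) (b := v) (by omega)
  have e2 := h.not_adj (a := p') (b := v) (by omega)
  refine ⟨?_, ?_, ?_⟩ <;> grind [G.adj_comm]

/-- Otherwise `g, p, p'` is a cap below `t`. The wheel around `p` below it and the 5-wheel around
`t` form a dwheel over four layers whose first vertices `w` and `g` are adjacent rather than equal.
-/
theorem lower_nbr_adj {n : ℕ} {v w t w' p p' g : V} (c : IsCap G lev n v w t w')
    (f : Fan2 G lev n t w w' p p') (lg : lev g = n) (tg : G.Adj t g) (wg : G.Adj w g)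
    (gp : G.Adj g p) : G.Adj g p' := by
  by_contra gp'
  have A := h.wheel5_of_cap c f
  obtain ⟨⟨hv, hw, ht, hw'⟩, ⟨vw, vt, vw'⟩, ⟨wt, tw'⟩, hne, hww⟩ := c
  obtain ⟨⟨lp, lp'⟩, ⟨tp, tp'⟩, ⟨wp, pp, pw⟩, ⟨d1, d2⟩⟩ := f
  have ne : g ≠ p' := by rintro rfl; exact d1 wg
  obtain _ | m := n
  · exact ne (h.eq_of_lev_eq_zero lg lp')
  rcases h.toHasDescent.exists_fan lp lg lp' gp.symm pp with ⟨k, hk⟩ | ⟨k, k', hk⟩ | ⟨k, s, k', hk⟩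
  · exact h.not_fan1 ⟨⟨ht, lg, lp, lp'⟩, ⟨tg, tp, tp'⟩, ⟨gp, pp⟩, ne, gp'⟩ k hk
  · obtain ⟨⟨lk, lk'⟩, ⟨rk, rk'⟩, ⟨qk, kk, kq⟩, ⟨d1, d2⟩⟩ := hk
    have B : Wheel5 G p g k k' p' t := by
      have e1 := h.not_adj (a := k) (b := t) (by omega)
      have e2 := h.not_adj (a := k') (b := t) (by omega)
      refine ⟨?_, ?_, ?_⟩ <;> grind [G.adj_comm]
    obtain ⟨y, y1, y2⟩ := h.dwheels.exists_near55 A B (.inr wg)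
    exact h.not_near y2.2.1 y1.2.1 (by omega)
  · obtain ⟨⟨lk, ls, lk'⟩, ⟨rk, rs, rk'⟩, ⟨qk, ks, sk, kq⟩, ⟨d1, d2, d3, d4, d5⟩, -⟩ := hk
    have B : Wheel6 G p g k s k' p' t := by
      have e1 := h.not_adj (a := k) (b := t) (by omega)
      have e2 := h.not_adj (a := k') (b := t) (by omega)
      have e3 := h.not_adj (a := s) (b := t) (by omega)
      refine ⟨?_, ?_, ?_⟩ <;> grind [G.adj_comm]
    obtain ⟨y, y1, y2⟩ := h.dwheels.exists_near56 A B (.inr wg)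
    exact h.not_near y2.2.1 y1.2.1 (by omega)

/-- If `t` and `u` are not adjacent, then `p` is the centre of a wheel of length 5, 6 or 7 through
`t, w, u` and `p'`. With the 5-wheel around `t` it forms a dwheel over four layers with common first
vertex `w`. -/
theorem adj_of_adj_lower {n : ℕ} {v w t w' p p' u : V} (c : IsCap G lev n v w t w')
    (f : Fan2 G lev n t w w' p p') (lu : lev u = n) (wu : G.Adj w u) (up : G.Adj u p) :
    G.Adj t u := by
  by_contra tu
  have A := h.wheel5_of_cap c f
  obtain ⟨⟨hv, hw, ht, hw'⟩, ⟨vw, vt, vw'⟩, ⟨wt, tw'⟩, hne, hww⟩ := c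
  obtain ⟨⟨lp, lp'⟩, ⟨tp, tp'⟩, ⟨wp, pp, pw⟩, ⟨d1, d2⟩⟩ := f
  have ne : u ≠ p' := by rintro rfl; exact tu tp'
  have up' : ¬ G.Adj u p' := fun e => d1 (h.noFourWheel up.symm wp.symm tp.symm pp wu.symm wt tp'
    e.symm (by rintro rfl; omega) (by rintro rfl; omega) fun e => tu e.symm)
  obtain _ | m := n
  · exact ne (h.eq_of_lev_eq_zero lu lp')
  have e0 := h.not_adj (a := u) (b := v) (by omega)
  rcases h.toHasDescent.exists_fan lp lu lp' up.symm pp with ⟨k, hk⟩ | ⟨k, k', hk⟩ | ⟨k, s, k', hk⟩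
  · obtain ⟨lk, pk, uk, kp⟩ := hk
    have B : Wheel5 G p w u k p' t := by
      have e1 := h.not_adj (a := k) (b := t) (by omega)
      have e2 := h.not_adj (a := k) (b := w) (by omega)
      refine ⟨?_, ?_, ?_⟩ <;> grind [G.adj_comm]
    obtain ⟨y, y1, y2⟩ := h.dwheels.exists_near55 A B (.inl rfl)
    exact h.not_near y2.2.2.1 y1.2.1 (by omega)
  · obtain ⟨⟨lk, lk'⟩, ⟨rk, rk'⟩, ⟨qk, kk, kq⟩, ⟨d1, d2⟩⟩ := hk
    have B : Wheel6 G p w u k k' p' t := by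
      have e1 := h.not_adj (a := k) (b := t) (by omega)
      have e2 := h.not_adj (a := k') (b := t) (by omega)
      have e3 := h.not_adj (a := k) (b := w) (by omega)
      have e4 := h.not_adj (a := k') (b := w) (by omega)
      refine ⟨?_, ?_, ?_⟩ <;> grind [G.adj_comm]
    obtain ⟨y, y1, y2⟩ := h.dwheels.exists_near56 A B (.inl rfl)
    exact h.not_near y2.2.2.1 y1.2.1 (by omega)
  · obtain ⟨⟨lk, ls, lk'⟩, ⟨rk, rs, rk'⟩, ⟨qk, ks, sk, kq⟩, ⟨d1, d2, d3, d4, d5⟩, -⟩ := hk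
    have B : Wheel7 G p w u k s k' p' t := by
      have e1 := h.not_adj (a := k) (b := t) (by omega)
      have e2 := h.not_adj (a := k') (b := t) (by omega)
      have e3 := h.not_adj (a := s) (b := t) (by omega)
      have e4 := h.not_adj (a := k) (b := w) (by omega)
      have e5 := h.not_adj (a := k') (b := w) (by omega)
      have e6 := h.not_adj (a := s) (b := w) (by omega)
      refine ⟨?_, ?_, ?_⟩ <;> grind [G.adj_comm]
    obtain ⟨y, y1, y2⟩ := h.dwheels.exists_near57 A B
    exact h.not_near y2.2.2.1 y1.2.1 (by omega)

/-- A vertex `g` linking `u` to `p` below `w` is adjacent to `t` and can replace `p` in the fan. As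
`u` is adjacent to `g`, the previous lemma then applies to `u`. -/
theorem adj_lower_of_cap {n : ℕ} {v w t w' u : V} (c : IsCap G lev n v w t w') (lu : lev u = n)
    (wu : G.Adj w u) : G.Adj t u := by
  by_contra tu
  obtain ⟨p, p', f⟩ := h.fan2_of_cap c
  have up : ¬ G.Adj u p := fun up => tu (h.adj_of_adj_lower c f lu wu up)
  have ne : u ≠ p := by rintro rfl; exact tu f.adj.1
  obtain ⟨g, lg, wg, ug, pg⟩ := h.below_vertex c.lev_eq.2.1 wu f.path.1 lu f.lev_eq.1 ne up
  have tg := h.adj_of_adj_lower c f lg wg pg.symm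
  have gp' := h.lower_nbr_adj c f lg tg wg pg.symm
  exact tu (h.adj_of_adj_lower c ⟨⟨lg, f.lev_eq.2⟩, ⟨tg, f.adj.2⟩, ⟨wg, gp', f.path.2.2⟩,
    f.chords.1, fun e => h.not_fan1 c g ⟨lg, tg, wg, e⟩⟩ lu wu ug)

/-- If `w` and `w'` are nonadjacent lower neighbours of `v`, then every lower neighbour of `w` is
adjacent to every lower neighbour of `w'`. -/
theorem adj_of_cap {n : ℕ} {v w t w' u u' : V} (c : IsCap G lev n v w t w') (lu : lev u = n)
    (wu : G.Adj w u) (lu' : lev u' = n) (wu' : G.Adj w' u') : G.Adj u u' := by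
  have tu := h.adj_lower_of_cap c lu wu
  have tu' := h.adj_lower_of_cap c.symm lu' wu'
  have ne : u ≠ u' := by rintro rfl; exact h.not_fan1 c u ⟨lu, tu, wu, wu'.symm⟩
  by_contra huu
  obtain ⟨s, ls, ts, us, us'⟩ := h.below_vertex c.lev_eq.2.2.1 tu tu' lu lu' ne huu
  have n1 : ¬ G.Adj w u' := fun e => h.not_fan1 c u' ⟨lu', tu', e, wu'.symm⟩
  have n2 : ¬ G.Adj u w' := fun e => h.not_fan1 c u ⟨lu, tu, wu, e⟩
  -- If `s` is adjacent to an end of the cap, it belongs to a fan of two vertices and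
  -- `lower_nbr_adj` joins `u` to `u'`; otherwise `u, s, u'` is a forbidden fan of three.
  by_cases ws : G.Adj w s
  · exact huu (h.lower_nbr_adj c ⟨⟨ls, lu'⟩, ⟨ts, tu'⟩, ⟨ws, us'.symm, wu'.symm⟩, n1,
      fun e => h.not_fan1 c s ⟨ls, ts, ws, e⟩⟩ lu tu wu us)
  by_cases ws' : G.Adj w' s
  · exact huu (h.lower_nbr_adj c.symm ⟨⟨ls, lu⟩, ⟨ts, tu⟩, ⟨ws', us.symm, wu.symm⟩,
      fun e => n2 e.symm, fun e => h.not_fan1 c s ⟨ls, ts, e.symm, ws'.symm⟩⟩ lu' tu' wu' us').symm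
  exact h.not_fan3 c u s u' ⟨⟨lu, ls, lu'⟩, ⟨tu, ts, tu'⟩, ⟨wu, us, us'.symm, wu'.symm⟩,
    ⟨ws, n1, huu, n2, fun e => ws' e.symm⟩, ne⟩

end IsLayered
end SimpleGraph

/-! ### Roofs: paths below an edge of a layer. -/

namespace SimpleGraph

variable {V : Type u} {G : SimpleGraph V} {lev : V → ℕ}

/-- `a, x, b` is a path in the layer `n + 1` below the edge `z, z'` of the layer `n + 2`, such that
`z, a, x, b, z'` bound three triangles with the common vertex `x`, and no two more of these
vertices except possibly `a, b` are adjacent. -/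
structure IsRoof (G : SimpleGraph V) (lev : V → ℕ) (n : ℕ) (z z' a x b : V) : Prop where
  lev_eq : lev z = n + 2 ∧ lev z' = n + 2 ∧ lev a = n + 1 ∧ lev x = n + 1 ∧ lev b = n + 1
  top : G.Adj z z' ∧ G.Adj z a ∧ G.Adj z x ∧ G.Adj z' x ∧ G.Adj z' b
  path : G.Adj a x ∧ G.Adj x b
  chords : ¬ G.Adj z' a ∧ ¬ G.Adj z b

theorem IsRoof.symm {n : ℕ} {z z' a x b : V} (r : IsRoof G lev n z z' a x b) :
    IsRoof G lev n z' z b x a := by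
  obtain ⟨⟨l1, l2, l3, l4, l5⟩, ⟨t1, t2, t3, t4, t5⟩, ⟨p1, p2⟩, c1, c2⟩ := r
  exact ⟨⟨l2, l1, l5, l4, l3⟩, ⟨t1.symm, t5, t4, t3, t2⟩, ⟨p2.symm, p1.symm⟩, c2, c1⟩

theorem Fan2.symm {n : ℕ} {x a b q q' : V} (f : Fan2 G lev n x a b q q') :
    Fan2 G lev n x b a q' q := by
  obtain ⟨⟨l1, l2⟩, ⟨a1, a2⟩, ⟨p1, p2, p3⟩, c1, c2⟩ := f
  exact ⟨⟨l2, l1⟩, ⟨a2, a1⟩, ⟨p3.symm, p2.symm, p1.symm⟩, fun e => c2 e.symm, fun e => c1 e.symm⟩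

namespace IsLayered

variable (h : G.IsLayered lev)
include h

/-- The fan would complete the roof to a 7-wheel around `x`. Being a cap below `x`, it also gives a
5-wheel around `s`, and this (5,7)-dwheel of boundary length 8 meets four layers. -/
theorem not_fan3_of_roof {n : ℕ} {z z' a x b : V} (r : IsRoof G lev n z z' a x b)
    (hab : ¬ G.Adj a b) (q s q' : V) : ¬ Fan3 G lev n x a b q s q' := by
  intro f
  obtain ⟨⟨lz, lz', la, lx, lb⟩, ⟨zz, za, zx, zx', zb⟩, ⟨ax, xb⟩, za', zb'⟩ := r
  obtain ⟨⟨lq, ls, lq'⟩, ⟨xq, xs, xq'⟩, ⟨aq, qs, sq', qb⟩, ⟨c1, c2, c3, c4, c5⟩, ne⟩ := f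
  obtain _ | m := n
  · exact ne (h.eq_of_lev_eq_zero lq lq')
  have c : IsCap G lev m x q s q' :=
    ⟨⟨lx, lq, ls, lq'⟩, ⟨xq, xs, xq'⟩, ⟨qs, sq'⟩, ne, c3⟩
  obtain ⟨k, k', f⟩ := h.fan2_of_cap c
  have A := h.wheel5_of_cap c f
  have B : Wheel7 G x q a z z' b q' s := by
    have e1 := h.not_adj (a := q) (b := z) (by omega)
    have e2 := h.not_adj (a := s) (b := z) (by omega)
    have e3 := h.not_adj (a := q') (b := z) (by omega)
    have e4 := h.not_adj (a := q) (b := z') (by omega)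
    have e5 := h.not_adj (a := s) (b := z') (by omega)
    have e6 := h.not_adj (a := q') (b := z') (by omega)
    refine ⟨?_, ?_, ?_⟩ <;> grind [G.adj_comm]
  have A' : Wheel5 G s q k k' q' x := by
    obtain ⟨a1, a2, a3⟩ := A
    refine ⟨?_, ?_, ?_⟩ <;> grind [G.adj_comm]
  obtain ⟨y, y1, y2⟩ := h.dwheels.exists_near57 A' B
  have := f.lev_eq.1
  exact h.not_near y1.2.1 y2.2.2.1 (by omega)

theorem fan_of_roof {n : ℕ} {z z' a x b : V} (r : IsRoof G lev n z z' a x b)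
    (hab : ¬ G.Adj a b) :
    (∃ q, Fan1 G lev n x a b q) ∨ ∃ q q', Fan2 G lev n x a b q q' := by
  rcases h.toHasDescent.exists_fan r.lev_eq.2.2.2.1 r.lev_eq.2.2.1 r.lev_eq.2.2.2.2 r.path.1.symm r.path.2 with
    h1 | h2 | ⟨q, s, q', h3⟩
  · exact .inl h1
  · exact .inr h2
  · exact absurd h3 (h.not_fan3_of_roof r hab q s q')

theorem wheel5_of_roof {n : ℕ} {z z' a x b q : V} (r : IsRoof G lev n z z' a x b)
    (hab : ¬ G.Adj a b) (f : Fan1 G lev n x a b q) : Wheel5 G x z' z a q b := by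
  obtain ⟨⟨lz, lz', la, lx, lb⟩, ⟨zz, za, zx, zx', zb⟩, ⟨ax, xb⟩, za', zb'⟩ := r
  obtain ⟨lq, xq, aq, qb⟩ := f
  have e1 := h.not_adj (a := q) (b := z) (by omega)
  have e2 := h.not_adj (a := q) (b := z') (by omega)
  refine ⟨?_, ?_, ?_⟩ <;> grind [G.adj_comm]

theorem wheel6_of_roof {n : ℕ} {z z' a x b q q' : V} (r : IsRoof G lev n z z' a x b)
    (hab : ¬ G.Adj a b) (f : Fan2 G lev n x a b q q') : Wheel6 G x z' z a q q' b := by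
  obtain ⟨⟨lz, lz', la, lx, lb⟩, ⟨zz, za, zx, zx', zb⟩, ⟨ax, xb⟩, za', zb'⟩ := r
  obtain ⟨⟨lq, lq'⟩, ⟨xq, xq'⟩, ⟨aq, qq, qb⟩, c1, c2⟩ := f
  have e1 := h.not_adj (a := q) (b := z) (by omega)
  have e2 := h.not_adj (a := q) (b := z') (by omega)
  have e3 := h.not_adj (a := q') (b := z) (by omega)
  have e4 := h.not_adj (a := q') (b := z') (by omega)
  refine ⟨?_, ?_, ?_⟩ <;> grind [G.adj_comm]

theorem IsRoof.not_adj_of_noFourWheel {n : ℕ} {z z' a x b : V}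
    (r : IsRoof G lev n z z' a x b) : ¬ G.Adj a b := by
  intro hab
  obtain ⟨⟨lz, lz', la, lx, lb⟩, ⟨zz, za, zx, zx', zb⟩, ⟨ax, xb⟩, za', zb'⟩ := r
  exact za' (h.noFourWheel xb ax.symm zx.symm zx'.symm hab.symm za.symm zz zb
    (by rintro rfl; omega) (by rintro rfl; omega) fun e => zb' e.symm).symm

/-- Here location produces a vertex. The wheel of the roof around `x` and the 5-wheel of the cap `x,
b, u` around `b` form a dwheel over three layers. The centre of its ball is near `z` and near the
vertex `k` two levels lower, hence it lies in the layer between them. -/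
theorem exists_near_of_roof {n : ℕ} {z z' a x b u : V} (r : IsRoof G lev n z z' a x b)
    (lu : lev u = n + 1) (zu : G.Adj z' u) (bu : G.Adj b u) (xu : ¬ G.Adj x u) (ne : x ≠ u) :
    ∃ y, lev y = n + 1 ∧ G.Adj z y ∧ G.Adj z' y ∧ G.Adj y a ∧ G.Near y u := by
  have hab := IsRoof.not_adj_of_noFourWheel h r
  obtain ⟨k, lk, uk⟩ := h.exists_below lu
  have c : IsCap G lev n z' x b u := ⟨⟨r.lev_eq.2.1, r.lev_eq.2.2.2.1, r.lev_eq.2.2.2.2, lu⟩,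
    ⟨r.top.2.2.2.1, r.top.2.2.2.2, zu⟩, ⟨r.path.2, bu⟩, ne, xu⟩
  have bk := h.adj_lower_of_cap c.symm lk uk
  have key : ∀ q, lev q = n → G.Adj x q → G.Adj q b → Wheel5 G b z' u k q x := by
    intro q lq xq qb
    have f : Fan2 G lev n b x u q k := ⟨⟨lq, lk⟩, ⟨qb.symm, bk⟩,
      ⟨xq, h.adj_of_cap c lq xq lk uk, uk.symm⟩,
      fun e => h.not_fan1 c k ⟨lk, bk, e, uk.symm⟩, fun e => h.not_fan1 c q ⟨lq, qb.symm, xq, e⟩⟩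
    obtain ⟨a1, a2, a3⟩ := h.wheel5_of_cap c f
    refine ⟨?_, ?_, ?_⟩ <;> grind [G.adj_comm]
  have fin : ∀ y, G.Near y z → G.Near y z' → G.Near y a → G.Near y u → G.Near y k →
      ∃ y, lev y = n + 1 ∧ G.Adj z y ∧ G.Adj z' y ∧ G.Adj y a ∧ G.Near y u := by
    intro y yz yz' ya yu yk
    have l1 := h.near_lev yz
    have l2 := h.near_lev yk
    have l3 := r.lev_eq
    have c1 := r.chords.1
    refine ⟨y, by omega, (yz.resolve_left ?_).symm, (yz'.resolve_left ?_).symm,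
      ya.resolve_left ?_, yu⟩
    · rintro rfl; omega
    · rintro rfl; omega
    · rintro rfl
      rcases yz' with e | e
      · rw [e] at l3; omega
      · exact c1 e.symm
  rcases h.fan_of_roof r hab with ⟨q, f⟩ | ⟨q, q', f⟩
  · obtain ⟨y, y1, y2⟩ := h.dwheels.exists_near55 (h.wheel5_of_roof r hab f)
      (key q f.lev_eq f.adj f.right) (.inl rfl)
    exact fin y y1.2.1 y1.1 y1.2.2.1 y2.2.1 y2.2.2.1
  · obtain ⟨y, y1, y2⟩ := h.dwheels.exists_near56 (key q' f.lev_eq.2 f.adj.2 f.path.2.2)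
      (h.wheel6_of_roof r hab f) (.inl rfl)
    exact fin y y2.2.1 y2.1 y2.2.2.1 y1.2.1 y1.2.2.1

/-- Lower neighbours `u`, `u'` of the ends of an edge `z, z'` of a layer are lower neighbours of the
same end, or they have a common neighbour below both ends. -/
theorem exists_adj_adj_below_edge {n : ℕ} {z z' u u' : V} (lz : lev z = n + 1)
    (lz' : lev z' = n + 1) (zz : G.Adj z z') (lu : lev u = n) (lu' : lev u' = n) (zu : G.Adj z u)
    (zu' : G.Adj z' u') (n1 : ¬ G.Adj z' u) (n2 : ¬ G.Adj z u') :
    ∃ v, lev v = n ∧ G.Adj z v ∧ G.Adj z' v ∧ G.Adj v u ∧ G.Adj v u' := by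
  obtain _ | n := n
  · exact absurd (h.eq_of_lev_eq_zero lu lu' ▸ zu) n2
  -- The case in which a common lower neighbour of `z` and `z'` is already adjacent to `u`.
  have half : ∀ {z z' u u' : V}, lev z = n + 2 → lev z' = n + 2 → G.Adj z z' → lev u = n + 1 →
      lev u' = n + 1 → G.Adj z u → G.Adj z' u' → ¬ G.Adj z' u → ¬ G.Adj z u' →
      ∀ v, lev v = n + 1 → G.Adj z v → G.Adj z' v → G.Adj v u →
      ∃ v, lev v = n + 1 ∧ G.Adj z v ∧ G.Adj z' v ∧ G.Adj v u ∧ G.Adj v u' := by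
    intro z z' u u' lz lz' zz lu lu' zu zu' n1 n2 v lv zv zv' vu
    by_cases vu' : G.Adj v u'
    · exact ⟨v, lv, zv, zv', vu, vu'⟩
    have ne : v ≠ u' := by rintro rfl; exact n2 zv
    obtain ⟨t, lt, zt, vt, ut⟩ := h.below_vertex lz' zv' zu' lv lu' ne vu'
    by_cases zt' : G.Adj z t
    · have ne' : u ≠ t := by rintro rfl; exact n1 zt
      by_cases ut' : G.Adj u t
      · exact ⟨t, lt, zt', zt, ut'.symm, ut.symm⟩
      -- The overlapping caps `u, v, t` and `v, t, u'` exclude each other: a lower neighbour `p` of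
      -- `u` is one of `v` and then of `t`, so `adj_of_cap` would make `p` adjacent to itself.
      have c1 : IsCap G lev n z u v t := ⟨⟨lz, lu, lv, lt⟩, ⟨zu, zv, zt'⟩, ⟨vu.symm, vt⟩, ne', ut'⟩
      have c2 : IsCap G lev n z' v t u' :=
        ⟨⟨lz', lv, lt, lu'⟩, ⟨zv', zt, zu'⟩, ⟨vt, ut.symm⟩, ne, vu'⟩
      obtain ⟨p, lp, up⟩ := h.exists_below lu
      have vp := h.adj_lower_of_cap c1 lp up
      have tp := h.adj_lower_of_cap c2 lp vp
      exact absurd (h.adj_of_cap c1 lp up lp tp) (G.irrefl)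
    · obtain ⟨y, ly, zy, zy', yu, yu'⟩ := h.exists_near_of_roof
        ⟨⟨lz, lz', lu, lv, lt⟩, ⟨zz, zu, zv, zv', zt⟩, ⟨vu.symm, vt⟩, n1, zt'⟩ lu' zu' ut.symm vu' ne
      refine ⟨y, ly, zy, zy', yu, yu'.resolve_left ?_⟩
      rintro rfl
      exact n2 zy
  obtain ⟨v, lv, zv, zv'⟩ := h.exists_below_edge zz lz lz'
  by_cases vu : G.Adj v u
  · exact half lz lz' zz lu lu' zu zu' n1 n2 v lv zv zv' vu
  by_cases vu' : G.Adj v u'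
  · obtain ⟨w, a1, a2, a3, a4, a5⟩ :=
      half lz' lz zz.symm lu' lu zu' zu n2 n1 v lv zv' zv vu'
    exact ⟨w, a1, a3, a2, a5, a4⟩
  have ne : v ≠ u := by rintro rfl; exact n1 zv'
  have ne' : v ≠ u' := by rintro rfl; exact n2 zv
  obtain ⟨s, ls, zs, vs, us⟩ := h.below_vertex lz zv zu lv lu ne vu
  obtain ⟨t, lt, zt, vt, ut⟩ := h.below_vertex lz' zv' zu' lv lu' ne' vu'
  by_cases zs' : G.Adj z' s
  · exact half lz lz' zz lu lu' zu zu' n1 n2 s ls zs zs' us.symm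
  by_cases zt' : G.Adj z t
  · obtain ⟨w, a1, a2, a3, a4, a5⟩ :=
      half lz' lz zz.symm lu' lu zu' zu n2 n1 t lt zt zt' ut.symm
    exact ⟨w, a1, a3, a2, a5, a4⟩
  -- The new vertex `y` is a common lower neighbour adjacent to `u'`, which reduces to `half` with
  -- the two ends exchanged.
  obtain ⟨y, ly, zy, zy', ys, yu'⟩ := h.exists_near_of_roof
    ⟨⟨lz, lz', ls, lv, lt⟩, ⟨zz, zs, zv, zv', zt⟩, ⟨vs.symm, vt⟩, zs', zt'⟩ lu' zu' ut.symm vu' ne'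
  have yu' := yu'.resolve_left (by rintro rfl; exact n2 zy)
  obtain ⟨w, a1, a2, a3, a4, a5⟩ :=
    half lz' lz zz.symm lu' lu zu' zu n2 n1 y ly zy' zy yu'
  exact ⟨w, a1, a3, a2, a5, a4⟩

end IsLayered
end SimpleGraph

/-! ### Shortening paths of three edges. -/

namespace SimpleGraph

variable {V : Type u} {G : SimpleGraph V} {lev : V → ℕ}

namespace IsLayered

/-- Otherwise `q, q', m` is a cap below `x`. Its 5-wheel around `q'` and the 6-wheel of the roof
form a dwheel over four layers with adjacent first vertices `m` and `b`. -/
theorem lower_nbr_adj_of_roof (h : G.IsLayered lev) {n : ℕ} {z z' a x b q q' m : V}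
    (r : IsRoof G lev n z z' a x b) (f : Fan2 G lev n x a b q q')
    (hab : ∀ k, lev k = n → G.Adj a k → ¬ G.Adj b k) (lm : lev m = n) (xm : G.Adj x m)
    (bm : G.Adj b m) (qm : G.Adj m q') : G.Adj m q := by
  by_contra hmq
  have ab := IsRoof.not_adj_of_noFourWheel h r
  have W := h.wheel6_of_roof r ab f
  obtain ⟨⟨lz, lz', la, lx, lb⟩, ⟨zz, za, zx, zx', zb⟩, ⟨ax, xb⟩, za', zb'⟩ := r
  obtain ⟨⟨lq, lq'⟩, ⟨xq, xq'⟩, ⟨aq, qq, qb⟩, c1, c2⟩ := f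
  have ne : q ≠ m := by rintro rfl; exact c2 bm.symm
  obtain _ | n := n
  · exact ne (h.eq_of_lev_eq_zero lq lm)
  have c : IsCap G lev n x q q' m :=
    ⟨⟨lx, lq, lq', lm⟩, ⟨xq, xq', xm⟩, ⟨qq, qm.symm⟩, ne, fun e => hmq e.symm⟩
  obtain ⟨k, k', f'⟩ := h.fan2_of_cap c
  have W5 : Wheel5 G q' m k' k q x := by
    obtain ⟨a1, a2, a3⟩ := h.wheel5_of_cap c f'
    refine ⟨?_, ?_, ?_⟩ <;> grind [G.adj_comm]
  have W6 : Wheel6 G x b z' z a q q' := by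
    obtain ⟨a1, a2, a3⟩ := W
    refine ⟨?_, ?_, ?_⟩ <;> grind [G.adj_comm]
  obtain ⟨y, y1, y2⟩ := h.dwheels.exists_near56 W5 W6 (.inr bm.symm)
  have := f'.lev_eq.1
  exact h.not_near y1.2.2.1 y2.2.2.1 (by omega)

/-- A path of length `3` in a layer below a path of length `2` of the next layer can be shortened,
or two of its vertices at distance `2` have a common lower neighbour. -/
theorem shorten_three (h : G.IsLayered lev) {n : ℕ} {x y z a b c d : V}
    (r : IsRoof G lev n x y a b c) (r' : IsRoof G lev n y z b c d) :
    (∃ m, lev m = n + 1 ∧ G.Near m a ∧ G.Near m d) ∨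
      (∃ k, lev k = n ∧ G.Adj a k ∧ G.Adj c k) ∨ ∃ k, lev k = n ∧ G.Adj b k ∧ G.Adj d k := by
  by_contra! hcon
  obtain ⟨h1, h2, h3⟩ := hcon
  have ac := IsRoof.not_adj_of_noFourWheel h r
  have bd := IsRoof.not_adj_of_noFourWheel h r'
  have h3' : ∀ k, lev k = n → G.Adj d k → ¬ G.Adj b k := fun k e1 e2 e3 => h3 k e1 e3 e2
  have bc := r.path.2
  obtain ⟨q, hq⟩ | ⟨p, q, f⟩ := h.fan_of_roof r ac
  · exact h2 q hq.lev_eq hq.left hq.right.symm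
  obtain ⟨q', hq⟩ | ⟨q', p', f'⟩ := h.fan_of_roof r' bd
  · exact h3 q' hq.lev_eq hq.left hq.right.symm
  -- If the fans at `b` and `c` share the vertex `m`, the two roofs give a (6,6)-dwheel. The centre
  -- of its ball is near `y` above and `m` below, so it lies in the layer of the path, and it is
  -- near both `a` and `d`.
  have key : ∀ m, Fan2 G lev n b a c p m → Fan2 G lev n c b d m p' → False := by
    intro m f f'
    have W := h.wheel6_of_roof r ac f
    have W' := h.wheel6_of_roof r'.symm (fun e => bd e.symm) f'.symm
    obtain ⟨t, y1, y2⟩ := h.dwheels.exists_near66 W W'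
    have l1 := h.near_lev y1.2.2.2.2.1
    have l2 := h.near_lev y1.1
    have l3 := h.near_lev y1.2.1
    have l4 := r.lev_eq
    have l5 := f.lev_eq
    refine h1 t ?_ y1.2.2.1 y2.2.2.1
    omega
  -- The inner vertex of either fan can slide to an adjacent common lower neighbour of `b` and `c`.
  -- This makes the fans share a vertex whether `q` and `q'` are equal, adjacent or linked by a
  -- third vertex.
  have move : ∀ m, lev m = n → G.Adj b m → G.Adj c m → G.Adj m q → Fan2 G lev n b a c p m :=
    fun m lm bm cm mq => ⟨⟨f.lev_eq.1, lm⟩, ⟨f.adj.1, bm⟩,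
      ⟨f.path.1, (h.lower_nbr_adj_of_roof r f h2 lm bm cm mq).symm, cm.symm⟩,
      fun e => h2 m lm e cm, f.chords.2⟩
  have move' : ∀ m, lev m = n → G.Adj b m → G.Adj c m → G.Adj m q' → Fan2 G lev n c b d m p' :=
    fun m lm bm cm mq => ⟨⟨lm, f'.lev_eq.2⟩, ⟨cm, f'.adj.2⟩,
      ⟨bm, h.lower_nbr_adj_of_roof r'.symm f'.symm h3' lm cm bm mq, f'.path.2.2⟩,
      f'.chords.1, fun e => h3 m lm bm e.symm⟩
  by_cases e : q = q'
  · subst e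
    exact key q f f'
  by_cases e' : G.Adj q q'
  · exact key q' (move q' f'.lev_eq.1 f'.path.1 f'.adj.1 e'.symm) f'
  obtain ⟨m, lm, bm, qm, qm'⟩ := h.below_vertex r.lev_eq.2.2.2.1 f.adj.2 f'.path.1 f.lev_eq.2
    f'.lev_eq.1 e e'
  have cm : G.Adj c m := h.noFourWheel f.adj.2 bc f'.path.1 bm f.path.2.2 f'.adj.1 qm' qm.symm e
    (by rintro rfl; have := r.lev_eq; omega) e'
  exact key m (move m lm bm cm qm.symm) (move' m lm bm cm qm'.symm)

end IsLayered

/-! ### Weighted chains and their contraction. -/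

/-- A chain in the layer `n` of weight `k`: its steps are edges, of weight `4`, pairs of nonadjacent
vertices with a common upper neighbour, of weight `6`, and pairs of vertices with a common lower
neighbour, of weight `7`. -/
inductive Chain (G : SimpleGraph V) (lev : V → ℕ) (n : ℕ) : V → V → ℕ → Prop
  | nil {x} : lev x = n → Chain G lev n x x 0
  | edge {x y z k} : lev x = n → G.Adj x y → Chain G lev n y z k → Chain G lev n x z (k + 4)
  | cap {x y z k v} : lev x = n → lev v = n + 1 → G.Adj v x → G.Adj v y → x ≠ y → ¬ G.Adj x y →
      Chain G lev n y z k → Chain G lev n x z (k + 6)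
  | valley {x y z k v} : lev x = n → lev v + 1 = n → G.Adj x v → G.Adj y v →
      Chain G lev n y z k → Chain G lev n x z (k + 7)

namespace Chain

variable {n : ℕ}

theorem lev_left {x y : V} {k : ℕ} (c : Chain G lev n x y k) : lev x = n := by
  cases c <;> assumption

theorem lev_right {x y : V} {k : ℕ} (c : Chain G lev n x y k) : lev y = n := by
  induction c <;> assumption

theorem trans {x y z : V} {k l : ℕ} (c : Chain G lev n x y k) (d : Chain G lev n y z l) :
    Chain G lev n x z (k + l) := by
  induction c with
  | nil => simpa using d
  | edge a b _ ih => rw [add_right_comm]; exact .edge a b (ih d)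
  | cap a b c d' e f _ ih => rw [add_right_comm]; exact .cap a b c d' e f (ih d)
  | valley a b c d' _ ih => rw [add_right_comm]; exact .valley a b c d' (ih d)

end Chain

/-- There is a chain of weight at most `k` from `x` to `y` in the layer `n`. -/
def Reach (G : SimpleGraph V) (lev : V → ℕ) (n : ℕ) (x y : V) (k : ℕ) : Prop :=
  ∃ l ≤ k, Chain G lev n x y l

namespace Reach

variable {n : ℕ}

theorem mono {x y : V} {k l : ℕ} (r : Reach G lev n x y k) (hkl : k ≤ l) : Reach G lev n x y l :=
  let ⟨m, hm, c⟩ := r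
  ⟨m, hm.trans hkl, c⟩

theorem trans {x y z : V} {k l : ℕ} (r : Reach G lev n x y k) (s : Reach G lev n y z l) :
    Reach G lev n x z (k + l) :=
  let ⟨m, hm, c⟩ := r
  let ⟨m', hm', c'⟩ := s
  ⟨m + m', by omega, c.trans c'⟩

theorem of_near {x y : V} (hx : lev x = n) (hy : lev y = n) (hxy : G.Near x y) :
    Reach G lev n x y 4 := by
  rcases hxy with rfl | hxy
  · exact ⟨0, by omega, .nil hx⟩
  · exact ⟨4, le_rfl, .edge hx hxy (.nil hy)⟩

theorem of_upper {x y v : V} (hx : lev x = n) (hy : lev y = n) (hv : lev v = n + 1)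
    (vx : G.Adj v x) (vy : G.Adj v y) : Reach G lev n x y 6 := by
  by_cases h1 : G.Near x y
  · exact (of_near hx hy h1).mono (by omega)
  · exact ⟨6, le_rfl, .cap hx hv vx vy (fun e => h1 (.inl e)) (fun e => h1 (.inr e)) (.nil hy)⟩

theorem of_lower {x y v : V} (hx : lev x = n) (hy : lev y = n) (hv : lev v + 1 = n)
    (vx : G.Adj x v) (vy : G.Adj y v) : Reach G lev n x y 7 :=
  ⟨7, le_rfl, .valley hx hv vx vy (.nil hy)⟩

end Reach

namespace IsLayered

variable (h : G.IsLayered lev)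
include h

theorem reach_below_edge {n : ℕ} {z z' u u' : V} (lz : lev z = n + 1)
    (lz' : lev z' = n + 1) (zz : G.Adj z z') (lu : lev u = n) (lu' : lev u' = n) (zu : G.Adj z u)
    (zu' : G.Adj z' u') : Reach G lev n u u' 8 := by
  by_cases n1 : G.Adj z' u
  · exact (Reach.of_upper lu lu' lz' n1 zu').mono (by omega)
  by_cases n2 : G.Adj z u'
  · exact (Reach.of_upper lu lu' lz zu n2).mono (by omega)
  obtain ⟨v, lv, -, -, vu, vu'⟩ := h.exists_adj_adj_below_edge lz lz' zz lu lu' zu zu' n1 n2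
  exact (Reach.of_near lu lv (.inr vu.symm)).trans (.of_near lv lu' (.inr vu'))

theorem adj_below_cap {n : ℕ} {v x y u u' : V} (lv : lev v = n + 2) (lx : lev x = n + 1)
    (ly : lev y = n + 1) (vx : G.Adj v x) (vy : G.Adj v y) (ne : x ≠ y) (xy : ¬ G.Adj x y)
    (lu : lev u = n) (lu' : lev u' = n) (xu : G.Adj x u) (yu : G.Adj y u') : G.Adj u u' := by
  obtain ⟨t, lt, vt, xt, yt⟩ := h.below_vertex lv vx vy lx ly ne xy
  exact h.adj_of_cap ⟨⟨lv, lx, lt, ly⟩, ⟨vx, vt, vy⟩, ⟨xt, yt.symm⟩, ne, xy⟩ lu xu lu' yu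

/-- Runs of edges are where the gain depends on `shorten_three`: two edges of weight 8 are replaced
by weight 6, or three of weight 12 by at most 11. The 11 is a valley and an edge; the shortcut costs
at most 8. -/
theorem reach_below_three {n : ℕ} {x y z w a : V} (lx : lev x = n + 2) (ly : lev y = n + 2)
    (lz : lev z = n + 2) (lw : lev w = n + 2) (xy : G.Adj x y) (yz : G.Adj y z) (zw : G.Adj z w)
    (la : lev a = n + 1) (xa : G.Adj x a) :
    (∃ c, lev c = n + 1 ∧ G.Adj z c ∧ Reach G lev (n + 1) a c 6) ∨
      ∃ d, lev d = n + 1 ∧ G.Adj w d ∧ Reach G lev (n + 1) a d 11 := by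
  by_contra! hcon
  obtain ⟨h1, h2⟩ := hcon
  obtain ⟨c', lc', yc', zc'⟩ := h.exists_below_edge yz ly lz
  have n1 : ¬ G.Adj y a := fun e => h1 c' lc' zc' (.of_upper la lc' ly e yc')
  have n2 : ∀ c, lev c = n + 1 → G.Adj z c → ¬ G.Adj x c := fun c lc zc e =>
    h1 c lc zc (.of_upper la lc lx xa e)
  obtain ⟨b, lb, xb, yb, ba, bc'⟩ :=
    h.exists_adj_adj_below_edge lx ly xy la lc' xa yc' n1 (n2 c' lc' zc')
  have zb : ¬ G.Adj z b := fun e => h1 b lb e ((Reach.of_near la lb (.inr ba.symm)).mono (by omega))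
  obtain ⟨d, ld, zd, wd⟩ := h.exists_below_edge zw lz lw
  have yd : ¬ G.Adj y d := by
    intro yd
    obtain ⟨e, le, -, -, ea, ed⟩ :=
      h.exists_adj_adj_below_edge lx ly xy la ld xa yd n1 (n2 d ld zd)
    exact h2 d ld wd (((Reach.of_near la le (.inr ea.symm)).trans
      (.of_near le ld (.inr ed))).mono (by omega))
  obtain ⟨c, lc, yc, zc, cb, cd⟩ := h.exists_adj_adj_below_edge ly lz yz lb ld yb zd zb yd
  have r : IsRoof G lev n x y a b c :=
    ⟨⟨lx, ly, la, lb, lc⟩, ⟨xy, xa, xb, yb, yc⟩, ⟨ba.symm, cb.symm⟩, n1, n2 c lc zc⟩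
  have r' : IsRoof G lev n y z b c d :=
    ⟨⟨ly, lz, lb, lc, ld⟩, ⟨yz, yb, yc, zc, zd⟩, ⟨cb.symm, cd⟩, zb, yd⟩
  rcases h.shorten_three r r' with ⟨m, lm, ma, md⟩ | ⟨k, lk, ak, ck⟩ | ⟨k, lk, bk, dk⟩
  · exact h2 d ld wd (((Reach.of_near la lm (ma.imp Eq.symm SimpleGraph.Adj.symm)).trans
      (.of_near lm ld md)).mono (by omega))
  · exact h2 d ld wd ((Reach.of_lower la lc (by omega) ak ck).trans (.of_near lc ld (.inr cd)))
  · exact h2 d ld wd (((Reach.of_near la lb (.inr ba.symm)).trans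
      (.of_lower lb ld (by omega) bk dk)))

/-- Passing to lower neighbours contracts long chains. -/
theorem reach_below {n k : ℕ} {x y u u' : V} (c : Chain G lev (n + 1) x y k) (lu : lev u = n)
    (lu' : lev u' = n) (xu : G.Adj x u) (yu : G.Adj y u') :
    Reach G lev n u u' ((14 * k + 160) / 15) := by
  obtain _ | n := n
  · exact h.eq_of_lev_eq_zero lu lu' ▸ ⟨0, by omega, .nil lu⟩
  induction k using Nat.strong_induction_on generalizing x u with
  | _ k ih =>
  -- An initial piece of weight `k - l` is exchanged for one of weight `m` below it with `15 * m ≤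
  -- 14 * (k - l)`. The ratio 14/15 is attained by edge, edge, valley: 14 in place of 15. The
  -- constant 160 pays for the last piece.
  have ih' : ∀ {w v l m} (_ : Chain G lev (n + 1 + 1) w y l) (_ : lev v = n + 1) (_ : G.Adj w v)
      (_ : Reach G lev (n + 1) u v m) (_ : 15 * m + 14 * l ≤ 14 * k) (_ : l < k),
      Reach G lev (n + 1) u u' ((14 * k + 160) / 15) := fun {w v l m} cw lv wv r hm hl =>
    (r.trans (by apply ih l hl (x := w) (u := v) <;> assumption)).mono (by omega)
  cases c with
  | nil lx => exact (Reach.of_upper lu lu' lx xu yu).mono (by omega)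
  | @cap _ x₁ _ l v lx lv vx vx₁ ne nadj c =>
    obtain ⟨w, lw, xw⟩ := h.exists_below c.lev_left
    exact ih' c lw xw (.of_near lu lw (.inr
      (h.adj_below_cap lv lx c.lev_left vx vx₁ ne nadj lu lw xu xw))) (by omega) (by omega)
  | @valley _ x₁ _ l v lx lv xv xv₁ c =>
    exact ih' c (by omega) xv₁ (.of_upper lu (by omega) lx xu xv) (by omega) (by omega)
  | @edge _ x₁ _ l lx xx₁ c =>
  have lx₁ := c.lev_left
  obtain ⟨u₁, lu₁, xu₁, xu₁'⟩ := h.exists_below_edge xx₁ lx lx₁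
  have r₁ : Reach G lev (n + 1) u u₁ 6 := .of_upper lu lu₁ lx xu xu₁
  cases c with
  | nil _ => exact (r₁.trans (.of_upper lu₁ lu' lx₁ xu₁' yu)).mono (by omega)
  | @valley _ x₂ _ l v _ lv xv xv₁ c =>
    exact ih' c (by omega) xv₁ (h.reach_below_edge lx lx₁ xx₁ lu (by omega) xu xv) (by omega)
      (by omega)
  | @cap _ x₂ _ l v _ lv vx vx₁ ne nadj c =>
    have lx₂ := c.lev_left
    have r₂ : ∀ w, lev w = n + 1 → G.Adj x₂ w → Reach G lev (n + 1) u w 10 := fun w lw xw =>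
      r₁.trans (.of_near lu₁ lw (.inr (h.adj_below_cap lv lx₁ lx₂ vx vx₁ ne nadj lu₁ lw xu₁' xw)))
    cases c with
    | nil _ => exact (r₂ u' lu' yu).mono (by omega)
    | @valley _ x₃ _ l v _ lv xv xv₁ c =>
      exact ih' c (by omega) xv₁ (r₂ v (by omega) xv) (by omega) (by omega)
    | @cap _ x₃ _ l v _ lv vx vx₁ ne nadj c =>
      obtain ⟨w, lw, xw⟩ := h.exists_below lx₂
      obtain ⟨w', lw', xw'⟩ := h.exists_below c.lev_left
      exact ih' c lw' xw' ((r₂ w lw xw).trans (.of_near lw lw' (.inr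
        (h.adj_below_cap lv lx₂ c.lev_left vx vx₁ ne nadj lw lw' xw xw')))) (by omega) (by omega)
    | @edge _ x₃ _ l _ xx₃ c =>
      obtain ⟨w, lw, xw, xw'⟩ := h.exists_below_edge xx₃ lx₂ c.lev_left
      exact ih' c lw xw' (r₂ w lw xw) (by omega) (by omega)
  | @edge _ x₂ _ l _ xx₂ c =>
    have lx₂ := c.lev_left
    obtain ⟨u₂, lu₂, xu₂, xu₂'⟩ := h.exists_below_edge xx₂ lx₁ lx₂
    have r₂ := h.reach_below_edge lx lx₁ xx₁ lu lu₂ xu xu₂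
    cases c with
    | nil _ => exact (r₂.trans (.of_upper lu₂ lu' lx₂ xu₂' yu)).mono (by omega)
    | @valley _ x₃ _ l v _ lv xv xv₁ c =>
      exact ih' c (by omega) xv₁ (r₂.trans (.of_upper lu₂ (by omega) lx₂ xu₂' xv)) (by omega)
        (by omega)
    | @cap _ x₃ _ l v _ lv vx vx₁ ne nadj c =>
      obtain ⟨w, lw, xw⟩ := h.exists_below c.lev_left
      exact ih' c lw xw (r₂.trans (.of_near lu₂ lw (.inr
        (h.adj_below_cap lv lx₂ c.lev_left vx vx₁ ne nadj lu₂ lw xu₂' xw)))) (by omega) (by omega)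
    | @edge _ x₃ _ l _ xx₃ c =>
      rcases h.reach_below_three lx lx₁ lx₂ c.lev_left xx₁ xx₂ xx₃ lu xu with
        ⟨w, lw, xw, r⟩ | ⟨w, lw, xw, r⟩
      · exact ih' (.edge lx₂ xx₃ c) lw xw r (by omega) (by omega)
      · exact ih' c lw xw r (by omega) (by omega)

end IsLayered
end SimpleGraph

/-! ### Descending paths and the four-point inequality. -/

namespace SimpleGraph

variable {V : Type u} {G : SimpleGraph V} {lev : V → ℕ}

/-- There is a path from `x` to `u` along which `lev` decreases by `1` at each step. -/
def Descends (G : SimpleGraph V) (lev : V → ℕ) : V → V → Prop :=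
  Relation.ReflTransGen fun x u => G.Adj x u ∧ lev x = lev u + 1

theorem Descends.lev_le {x u : V} (d : G.Descends lev x u) : lev u ≤ lev x := by
  induction d with
  | refl => exact le_rfl
  | tail _ hu ih => have := hu.2; omega

theorem Descends.eq_of_lev_eq {x u : V} (d : G.Descends lev x u) (e : lev u = lev x) : u = x := by
  rcases Relation.ReflTransGen.cases_tail d with rfl | ⟨v, hv, hu⟩
  · rfl
  · have := Descends.lev_le hv
    have := hu.2
    omega

theorem Descends.dist_add_lev_le (hG : G.Connected) {x u : V} (d : G.Descends lev x u) :
    G.dist x u + lev u ≤ lev x := by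
  induction d with
  | refl => simp
  | @tail v w _ hu ih =>
    have := hu.2
    have := hG.dist_triangle (u := x) (v := v) (w := w)
    rw [dist_eq_one_iff_adj.2 hu.1] at this
    omega

theorem Chain.dist_le (hG : G.Connected) {n k : ℕ} {x y : V} (c : Chain G lev n x y k) :
    G.dist x y ≤ k := by
  have two : ∀ {x y v}, G.Adj v x → G.Adj v y → G.dist x y ≤ 2 := fun {x y v} vx vy => by
    have := hG.dist_triangle (u := x) (v := v) (w := y)
    rw [dist_eq_one_iff_adj.2 vx.symm, dist_eq_one_iff_adj.2 vy] at this
    omega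
  induction c with
  | nil => simp
  | @edge x y z k _ xy _ ih =>
    have := hG.dist_triangle (u := x) (v := y) (w := z)
    rw [dist_eq_one_iff_adj.2 xy] at this
    omega
  | @cap x y z k v _ _ vx vy _ _ _ ih =>
    have := hG.dist_triangle (u := x) (v := y) (w := z)
    have := two vx vy
    omega
  | @valley x y z k v _ _ vx vy _ ih =>
    have := hG.dist_triangle (u := x) (v := y) (w := z)
    have := two vx.symm vy.symm
    omega

namespace IsLayered

variable (h : G.IsLayered lev)
include h

theorem exists_descends {n : ℕ} {x : V} (hx : n ≤ lev x) : ∃ u, lev u = n ∧ G.Descends lev x u := by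
  induction e : lev x - n generalizing x with
  | zero => exact ⟨x, by omega, .refl⟩
  | succ d ih =>
    obtain ⟨v, lv, xv⟩ := h.exists_below (n := n + d) (x := x) (by omega)
    obtain ⟨u, lu, vu⟩ := ih (x := v) (by omega) (by omega)
    exact ⟨u, lu, .head ⟨xv, by omega⟩ vu⟩

/-- The fixed point of `k ↦ (14 * k + 160) / 15` is `160`, so above it the bound survives every step
down. -/
theorem reach_of_descends {m n k : ℕ} {x y u u' : V} (hk : 160 ≤ k) (r : Reach G lev n x y k)
    (lu : lev u = m) (lu' : lev u' = m) (xu : G.Descends lev x u) (yu : G.Descends lev y u') :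
    Reach G lev m u u' k := by
  obtain ⟨l, hl, c⟩ := r
  have lx := c.lev_left
  have ly := c.lev_right
  have hmn := xu.lev_le
  obtain ⟨d, rfl⟩ : ∃ d, n = m + d := ⟨n - m, by omega⟩
  clear hmn
  induction d generalizing x y l with
  | zero =>
    obtain rfl := xu.eq_of_lev_eq (by omega)
    obtain rfl := yu.eq_of_lev_eq (by omega)
    exact ⟨l, hl, c⟩
  | succ d ih =>
    rcases Relation.ReflTransGen.cases_head xu with rfl | ⟨x', xx, xu'⟩
    · omega
    rcases Relation.ReflTransGen.cases_head yu with rfl | ⟨y', yy, yu'⟩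
    · omega
    obtain ⟨l', hl', c'⟩ := h.reach_below (n := m + d) c (by omega) (by omega) xx.1 yy.1
    exact ih xu' yu' l' (by omega) c' (by omega) (by omega)

theorem reach_of_adj {m : ℕ} {x y u u' : V} (xy : G.Adj x y) (lu : lev u = m) (lu' : lev u' = m)
    (xu : G.Descends lev x u) (yu : G.Descends lev y u') : Reach G lev m u u' 160 := by
  have h1 := h.lev_le xy
  have h2 := h.lev_le xy.symm
  rcases lt_trichotomy (lev x) (lev y) with e | e | e
  · exact h.reach_of_descends le_rfl ⟨0, by omega, .nil rfl⟩ lu lu'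
      (.head ⟨xy.symm, by omega⟩ xu) yu
  · exact h.reach_of_descends le_rfl ⟨4, by omega, .edge rfl xy (.nil e.symm)⟩ lu lu' xu yu
  · exact h.reach_of_descends le_rfl ⟨0, by omega, .nil rfl⟩ lu lu' xu
      (.head ⟨xy, by omega⟩ yu)

/-- Recursion from the far end of the path: stepping down a layer contracts the bound, and one more
edge of the path costs at most 160. The fixed point of `r ↦ (14 * r + 160) / 15 + 160` is `2560`,
independently of `M`. -/
theorem reach_of_ascending {n M : ℕ} (q : ℕ → V) (hq : ∀ j < M, G.Adj (q j) (q (j + 1)))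
    (hl : ∀ j ≤ M, n + j ≤ lev (q j)) {j : ℕ} (hj : j ≤ M) {a b : V} (la : lev a = n + j)
    (lb : lev b = n + j) (ha : G.Descends lev (q j) a) (hb : G.Descends lev (q M) b) :
    Reach G lev (n + j) a b 2560 := by
  induction e : M - j generalizing j a b with
  | zero =>
    obtain rfl : j = M := by omega
    exact h.reach_of_descends (by omega) ⟨0, by omega, .nil rfl⟩ la lb ha hb
  | succ d ih =>
    obtain ⟨a', la', ha'⟩ := h.exists_descends (hl (j + 1) (by omega))
    rcases Relation.ReflTransGen.cases_tail hb with rfl | ⟨b', hb', bb⟩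
    · have := hl M le_rfl
      omega
    obtain ⟨l, hl', c⟩ := ih (j := j + 1) (by omega) la' (by omega) ha' hb' (by omega)
    obtain ⟨a'', la'', aa⟩ := h.exists_below (n := n + j) (x := a') (by omega)
    exact ((h.reach_of_adj (hq j (by omega)) la la'' ha (ha'.tail ⟨aa, by omega⟩)).trans
      (h.reach_below c la'' lb aa bb.1)).mono (by omega)

/-- The hypothesis bounds `n` by the Gromov product of `x` and `y`. At distance `j` on either side
of its vertex number `lev x - n`, a geodesic from `x` to `y` has level at least `n + j`, so both
halves satisfy the ascending estimate. If the geodesic is too short to contain this vertex, all of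
it ascends, read from `y` to `x`. -/
theorem dist_le_of_descends (hG : G.Connected) {n : ℕ} {x y a b : V} (hx : n ≤ lev x)
    (hxy : 2 * n + G.dist x y ≤ lev x + lev y) (la : lev a = n) (lb : lev b = n)
    (xa : G.Descends lev x a) (yb : G.Descends lev y b) : G.dist a b ≤ 5120 := by
  obtain ⟨p, hp⟩ := hG.exists_walk_length_eq_dist x y
  set m := G.dist x y
  have hadj : ∀ j < m, G.Adj (p.getVert j) (p.getVert (j + 1)) :=
    fun j hj => p.adj_getVert_succ (by omega)
  have l1 : ∀ j ≤ m, lev x ≤ lev (p.getVert j) + j := by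
    intro j hj
    induction j with
    | zero => simp
    | succ j ih =>
      have := h.lev_le (hadj j hj)
      have := ih (by omega)
      omega
  have l2 : ∀ j ≤ m, lev y ≤ lev (p.getVert (m - j)) + j := by
    intro j hj
    induction j with
    | zero => simp [← hp]
    | succ j ih =>
      have h1 := h.lev_le (hadj (m - (j + 1)) (by omega)).symm
      have := ih (by omega)
      rw [show m - (j + 1) + 1 = m - j by omega] at h1
      omega
  have hdown : ∀ c ≤ m, ∀ j < c, G.Adj (p.getVert (c - j)) (p.getVert (c - (j + 1))) := by
    intro c hc j hj
    have := (hadj (c - (j + 1)) (by omega)).symm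
    rwa [show c - (j + 1) + 1 = c - j by omega] at this
  have e0 : p.getVert 0 = x := p.getVert_zero
  have em : p.getVert m = y := by rw [← hp]; exact p.getVert_length
  by_cases hm : m < lev x - n
  · obtain ⟨l, hl, c⟩ := h.reach_of_ascending (n := n) (M := m) (fun j => p.getVert (m - j))
      (hdown m le_rfl) (fun j hj => by have := l1 (m - j) (by omega); omega) (j := 0) (by omega)
      lb la (by simpa [em] using yb) (by simpa using xa)
    have := c.dist_le hG
    rw [dist_comm] at this
    omega
  · obtain ⟨c, lc, hc⟩ := h.exists_descends (n := n) (x := p.getVert (lev x - n))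
      (by have := l1 (lev x - n) (by omega); omega)
    obtain ⟨l, hl, c1⟩ := h.reach_of_ascending (n := n) (M := lev x - n)
      (fun j => p.getVert (lev x - n - j))
      (hdown _ (by omega)) (fun j hj => by have := l1 (lev x - n - j) (by omega); omega) (j := 0)
      (by omega) lc la (by simpa using hc) (by simpa using xa)
    obtain ⟨l', hl', c2⟩ := h.reach_of_ascending (n := n) (M := m - (lev x - n))
      (fun j => p.getVert (lev x - n + j))
      (fun j hj => hadj _ (by omega))
      (fun j hj => by
        have := l2 (m - (lev x - n + j)) (by omega)
        rw [show m - (m - (lev x - n + j)) = lev x - n + j by omega] at this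
        omega) (j := 0)
      (by omega) lc lb (by simpa using hc)
      (by simpa [show lev x - n + (m - (lev x - n)) = m by omega, em] using yb)
    have d1 := c1.dist_le hG
    have d2 := c2.dist_le hG
    have := hG.dist_triangle (u := a) (v := c) (w := b)
    rw [dist_comm] at d1
    omega

end IsLayered

/-- Descents to the layer `n`, half the smaller doubled Gromov product, are compared from `x` to `y`
and from `y` to `z`. Each comparison costs 5120, and rounding `n` down costs 1. -/
theorem four_point (hG : G.Connected) {o : V} (h : G.IsLayered (G.dist o)) (x y z : V) :
    min ((G.dist o x : ℤ) + G.dist o y - G.dist x y) (G.dist o y + G.dist o z - G.dist y z) ≤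
      G.dist o x + G.dist o z - G.dist x z + 10241 := by
  have t1 := hG.dist_triangle (u := o) (v := x) (w := y)
  have t2 := hG.dist_triangle (u := o) (v := y) (w := x)
  have t3 := hG.dist_triangle (u := o) (v := z) (w := y)
  have t4 := hG.dist_triangle (u := o) (v := y) (w := z)
  rw [G.dist_comm (u := y) (v := x)] at t2
  rw [G.dist_comm (u := z) (v := y)] at t3
  have t8 := hG.dist_triangle (u := x) (v := o) (w := y)
  have t9 := hG.dist_triangle (u := y) (v := o) (w := z)
  rw [G.dist_comm (u := x) (v := o)] at t8
  rw [G.dist_comm (u := y) (v := o)] at t9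
  obtain ⟨n, hn⟩ : ∃ n, n = min ((G.dist o x + G.dist o y - G.dist x y) / 2)
    ((G.dist o y + G.dist o z - G.dist y z) / 2) := ⟨_, rfl⟩
  have h1 : n ≤ (G.dist o x + G.dist o y - G.dist x y) / 2 := hn ▸ min_le_left _ _
  have h2 : n ≤ (G.dist o y + G.dist o z - G.dist y z) / 2 := hn ▸ min_le_right _ _
  obtain ⟨a, la, xa⟩ := h.exists_descends (n := n) (x := x) (by omega)
  obtain ⟨b, lb, yb⟩ := h.exists_descends (n := n) (x := y) (by omega)
  obtain ⟨c, lc, zc⟩ := h.exists_descends (n := n) (x := z) (by omega)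
  have d1 := h.dist_le_of_descends hG (by omega) (by omega) la lb xa yb
  have d2 := h.dist_le_of_descends hG (by omega) (by omega) lb lc yb zc
  have d3 := xa.dist_add_lev_le hG
  have d4 := zc.dist_add_lev_le hG
  have t5 := hG.dist_triangle (u := a) (v := b) (w := c)
  have t6 := hG.dist_triangle (u := x) (v := a) (w := c)
  have t7 := hG.dist_triangle (u := x) (v := c) (w := z)
  rw [G.dist_comm (u := c) (v := z)] at t7
  omega

end SimpleGraph

/-! ### The cover: gluing missing neighbours is transitive. -/

namespace SimpleGraph

variable {V : Type u}

/-- A set `B` of lists of vertices of `G` with a graph structure, such that `l ↦ l.headD o` is a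
locally injective map onto `G` and the length has the descent property. -/
structure IsPrecover (G : SimpleGraph V) (o : V) (B : Set (List V)) (A : SimpleGraph (List V)) :
    Prop extends HasDescent A List.length where
  nil_mem : [] ∈ B
  mem_of_adj : ∀ ⦃a b⦄, A.Adj a b → a ∈ B
  map_adj : ∀ ⦃a b⦄, A.Adj a b → G.Adj (a.headD o) (b.headD o)
  exists_below : ∀ ⦃n a⦄, a ∈ B → a.length = n + 1 → ∃ u, u.length = n ∧ A.Adj a u
  inj : ∀ ⦃w a b⦄, A.Adj w a → A.Adj w b → a.headD o = b.headD o → a = b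
  adj_of_adj : ∀ ⦃w a b⦄, A.Adj w a → A.Adj w b → G.Adj (a.headD o) (b.headD o) → A.Adj a b

/-- A ball of radius `n` in the cover of `G` that is being constructed. -/
structure IsCoverBall (G : SimpleGraph V) (o : V) (n : ℕ) (B : Set (List V))
    (A : SimpleGraph (List V)) : Prop extends IsPrecover G o B A where
  length_le : ∀ ⦃a⦄, a ∈ B → a.length ≤ n
  exists_lift : ∀ ⦃w z⦄, w ∈ B → w.length < n → G.Adj (w.headD o) z →
    ∃ a, A.Adj w a ∧ a.headD o = z

/-- The edge from the image of `w`, a point of the sphere of radius `n`, to `z` does not lift to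
the ball of radius `n`. -/
structure Missing (G : SimpleGraph V) (o : V) (n : ℕ) (B : Set (List V)) (A : SimpleGraph (List V))
    (z : V) (w : List V) : Prop where
  mem : w ∈ B
  length_eq : w.length = n
  adj : G.Adj (w.headD o) z
  ne : ∀ a, A.Adj w a → a.headD o ≠ z

/-- The missing neighbours over `z` of `w` and `w'` are to be identified. -/
def Glued (G : SimpleGraph V) (o : V) (n : ℕ) (B : Set (List V)) (A : SimpleGraph (List V))
    (z : V) (w w' : List V) : Prop :=
  w = w' ∨ A.Adj w w' ∨ ∃ c, Missing G o n B A z c ∧ A.Adj w c ∧ A.Adj c w'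

namespace IsCoverBall

variable {G : SimpleGraph V} {o : V} {n : ℕ} {B : Set (List V)} {A : SimpleGraph (List V)}
variable (S : IsCoverBall G o n B A)
include S

theorem adj_iff {w a b : List V} (ha : A.Adj w a) (hb : A.Adj w b) :
    G.Adj (a.headD o) (b.headD o) ↔ A.Adj a b :=
  ⟨fun h => S.adj_of_adj ha hb h, fun h => S.map_adj h⟩

/-- A lift over `z` adjacent to `a` would be adjacent to `w` as well, because triangles lift. Inside
the ball such a lift always exists, so `a` lies on the sphere. -/
theorem missing_of_adj {z : V} {w a : List V} (hw : Missing G o n B A z w) (wa : A.Adj w a)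
    (az : G.Adj (a.headD o) z) : Missing G o n B A z a := by
  have hB := S.mem_of_adj wa.symm
  have key : ∀ b, A.Adj a b → b.headD o ≠ z := by
    rintro b ab rfl
    exact hw.ne b (S.adj_of_adj wa.symm ab hw.adj) rfl
  refine ⟨hB, ?_, az, key⟩
  by_contra hl
  obtain ⟨b, ab, hb⟩ := S.exists_lift hB (by have := S.length_le hB; omega) az
  exact key b ab hb

/-- This replaces the level gap of the layered arguments: `z` behaves like a vertex above the sphere
although it has no lift at `w` yet. -/
theorem not_adj_of_lower {z : V} {w a : List V} (hw : Missing G o n B A z w) (wa : A.Adj w a)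
    (la : a.length ≠ n) : ¬ G.Adj z (a.headD o) := fun h =>
  la (S.missing_of_adj hw wa h.symm).length_eq

theorem not_fan1 (h4 : G.NoFourWheel) {m : ℕ} {z : V} {w a b q : List V} (hn : n = m + 1)
    (hw : Missing G o n B A z w) (ha : Missing G o n B A z a) (hb : Missing G o n B A z b)
    (wa : A.Adj w a) (wb : A.Adj w b) (ne : a ≠ b) (ab : ¬ A.Adj a b) :
    ¬ Fan1 A List.length m w a b q := by
  rintro ⟨lq, wq, aq, qb⟩
  have e1 := S.map_adj wa
  have e2 := S.map_adj wb
  have e3 := S.map_adj wq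
  have := h4 e1 hw.adj e2 e3 ha.adj hb.adj.symm (S.map_adj qb).symm (S.map_adj aq).symm
    (fun e => ne (S.inj wa wb e)) (fun e => hw.ne q wq e.symm) (fun e => ab (S.adj_of_adj wa wb e))
  exact S.not_adj_of_lower hw wq (by omega) this

theorem wheel5_of_fan2 {m : ℕ} {z : V} {w a b q q' : List V} (hn : n = m + 1)
    (hw : Missing G o n B A z w) (ha : Missing G o n B A z a) (hb : Missing G o n B A z b)
    (wa : A.Adj w a) (wb : A.Adj w b) (ab : ¬ A.Adj a b) (f : Fan2 A List.length m w a b q q') :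
    Wheel5 G (w.headD o) z (a.headD o) (q.headD o) (q'.headD o) (b.headD o) := by
  obtain ⟨⟨lq, lq'⟩, ⟨wq, wq'⟩, ⟨aq, qq, qb⟩, c1, c2⟩ := f
  exact ⟨⟨hw.adj, S.map_adj wa, S.map_adj wq, S.map_adj wq', S.map_adj wb⟩,
    ⟨ha.adj.symm, S.map_adj aq, S.map_adj qq, S.map_adj qb, hb.adj⟩,
    S.not_adj_of_lower hw wq (by omega), S.not_adj_of_lower hw wq' (by omega),
    (S.adj_iff wa wq').not.2 c1, (S.adj_iff wa wb).not.2 ab, (S.adj_iff wq wb).not.2 c2⟩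

theorem wheel6_of_fan3 {m : ℕ} {z : V} {w a b q r q' : List V} (hn : n = m + 1)
    (hw : Missing G o n B A z w) (ha : Missing G o n B A z a) (hb : Missing G o n B A z b)
    (wa : A.Adj w a) (wb : A.Adj w b) (ab : ¬ A.Adj a b) (f : Fan3 A List.length m w a b q r q') :
    Wheel6 G (w.headD o) z (a.headD o) (q.headD o) (r.headD o) (q'.headD o) (b.headD o) := by
  obtain ⟨⟨lq, lr, lq'⟩, ⟨wq, wr, wq'⟩, ⟨aq, qr, rq, qb⟩, ⟨c1, c2, c3, c4, c5⟩, -⟩ := f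
  exact ⟨⟨hw.adj, S.map_adj wa, S.map_adj wq, S.map_adj wr, S.map_adj wq', S.map_adj wb⟩,
    ⟨ha.adj.symm, S.map_adj aq, S.map_adj qr, S.map_adj rq, S.map_adj qb, hb.adj⟩,
    ⟨S.not_adj_of_lower hw wq (by omega), S.not_adj_of_lower hw wr (by omega),
      S.not_adj_of_lower hw wq' (by omega)⟩,
    ⟨(S.adj_iff wa wr).not.2 c1, (S.adj_iff wa wq').not.2 c2, (S.adj_iff wa wb).not.2 ab⟩,
    ⟨(S.adj_iff wq wq').not.2 c3, (S.adj_iff wq wb).not.2 c4⟩, (S.adj_iff wr wb).not.2 c5⟩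

/-- A vertex near `z`, near two adjacent points `w`, `w'` of the sphere and near a common lower
neighbour of them lifts to a point of the sphere with a missing neighbour over `z`. -/
theorem exists_missing_of_near {z y : V} {w r : List V} (hw : Missing G o n B A z w)
    (wr : A.Adj w r) (lr : r.length + 1 = n) (yz : G.Near y z) (yw : G.Adj y (w.headD o))
    (yr : G.Near y (r.headD o)) :
    ∃ a, Missing G o n B A z a ∧ A.Adj a w ∧ A.Adj r a ∧ a.headD o = y := by
  have zr := S.not_adj_of_lower hw wr (by omega)
  have yr' : G.Adj (r.headD o) y := by
    refine (yr.resolve_left ?_).symm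
    rintro rfl
    rcases yz with e | e
    · exact hw.ne r wr e
    · exact zr e.symm
  obtain ⟨a, ra, rfl⟩ := S.exists_lift (S.mem_of_adj wr.symm) (by omega) yr'
  have aw : A.Adj a w := S.adj_of_adj ra wr.symm yw
  have az : G.Adj (a.headD o) z := yz.resolve_left (hw.ne a aw.symm)
  exact ⟨a, S.missing_of_adj hw aw.symm az, aw, ra, rfl⟩

theorem near_lift {w a b : List V} (wa : A.Adj w a) (wb : A.Adj w b)
    (hab : G.Near (a.headD o) (b.headD o)) : a = b ∨ A.Adj a b :=
  hab.imp (S.inj wa wb) (S.adj_of_adj wa wb)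

end IsCoverBall

theorem Glued.symm {G : SimpleGraph V} {o : V} {n : ℕ} {B : Set (List V)} {A : SimpleGraph (List V)}
    {z : V} {w w' : List V} : Glued G o n B A z w w' → Glued G o n B A z w' w := by
  rintro (rfl | h | ⟨c, hc, h, h'⟩)
  · exact .inl rfl
  · exact .inr (.inl h.symm)
  · exact .inr (.inr ⟨c, hc, h'.symm, h.symm⟩)

/-- A path of points with missing neighbours over `z`, with ends that are not glued. -/
structure UngluedPath (G : SimpleGraph V) (o : V) (n : ℕ) (B : Set (List V))
    (A : SimpleGraph (List V)) (z : V) (w₁ w₂ w₃ w₄ : List V) : Prop where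
  h₁ : Missing G o n B A z w₁
  h₂ : Missing G o n B A z w₂
  h₃ : Missing G o n B A z w₃
  h₄ : Missing G o n B A z w₄
  a₁ : A.Adj w₁ w₂
  a₂ : A.Adj w₂ w₃
  a₃ : A.Adj w₃ w₄
  not_glued : ¬ Glued G o n B A z w₁ w₄

namespace UngluedPath

variable {G : SimpleGraph V} {o : V} {n m : ℕ} {B : Set (List V)} {A : SimpleGraph (List V)}
variable {z : V} {w₁ w₂ w₃ w₄ : List V}

theorem symm (P : UngluedPath G o n B A z w₁ w₂ w₃ w₄) : UngluedPath G o n B A z w₄ w₃ w₂ w₁ :=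
  ⟨P.h₄, P.h₃, P.h₂, P.h₁, P.a₃.symm, P.a₂.symm, P.a₁.symm, fun h => P.not_glued h.symm⟩

theorem ne (P : UngluedPath G o n B A z w₁ w₂ w₃ w₄) : w₁ ≠ w₃ := by
  rintro rfl
  exact P.not_glued (.inr (.inl P.a₃))

theorem not_adj (P : UngluedPath G o n B A z w₁ w₂ w₃ w₄) : ¬ A.Adj w₁ w₃ := fun e =>
  P.not_glued (.inr (.inr ⟨w₃, P.h₃, e, P.a₃⟩))

/-- The centre `y` of a 1-ball would lift through the interior point `r` to a point with a missing
neighbour over `z`, and this point would glue `w₁` to `w₄`. Hence dwheels around `w₂` and `w₃`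
cannot be located. -/
theorem not_near (P : UngluedPath G o n B A z w₁ w₂ w₃ w₄) (S : IsCoverBall G o n B A) {y : V}
    {r : List V} (r₂ : A.Adj w₂ r) (r₃ : A.Adj w₃ r) (lr : r.length + 1 = n) (yz : G.Near y z)
    (y₁ : G.Near y (w₁.headD o)) (y₂ : G.Near y (w₂.headD o)) (y₃ : G.Near y (w₃.headD o))
    (y₄ : G.Near y (w₄.headD o)) : ¬ G.Near y (r.headD o) := by
  intro yr
  have y₂' : G.Adj y (w₂.headD o) := by
    refine y₂.resolve_left ?_
    rintro rfl
    exact (S.near_lift P.a₂.symm P.a₃ y₄).elim P.symm.ne.symm fun e => P.symm.not_adj e.symm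
  have y₃' : G.Adj y (w₃.headD o) := by
    refine y₃.resolve_left ?_
    rintro rfl
    exact (S.near_lift P.a₂ P.a₁.symm y₁).elim P.ne.symm fun e => P.not_adj e.symm
  obtain ⟨a, ha, aw, ra, rfl⟩ := S.exists_missing_of_near P.h₂ r₂ lr yz y₂' yr
  have aw₃ : A.Adj a w₃ := S.adj_of_adj ra r₃.symm y₃'
  refine (S.near_lift aw.symm P.a₁.symm y₁).elim ?_ fun e₁ =>
    (S.near_lift aw₃.symm P.a₃ y₄).elim ?_ fun e₄ =>
      P.not_glued (.inr (.inr ⟨a, ha, e₁.symm, e₄⟩))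
  · rintro rfl; exact P.not_adj aw₃
  · rintro rfl; exact P.symm.not_adj aw.symm.symm

theorem not_adj_lower (P : UngluedPath G o (m + 1) B A z w₁ w₂ w₃ w₄)
    (S : IsCoverBall G o (m + 1) B A) (h4 : G.NoFourWheel) {q : List V} (lq : q.length = m)
    (q₂ : A.Adj w₂ q) (q₁ : A.Adj w₁ q) : ¬ A.Adj q w₃ := fun e =>
  S.not_fan1 h4 rfl P.h₂ P.h₁ P.h₃ P.a₁.symm P.a₂ P.ne P.not_adj ⟨lq, q₂, q₁, e⟩

theorem wheel5 (P : UngluedPath G o (m + 1) B A z w₁ w₂ w₃ w₄)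
    (S : IsCoverBall G o (m + 1) B A) (h4 : G.NoFourWheel) {q r : List V} (lq : q.length = m)
    (lr : r.length = m) (q₂ : A.Adj w₂ q) (r₂ : A.Adj w₂ r) (q₁ : A.Adj w₁ q) (qr : A.Adj q r)
    (r₃ : A.Adj w₃ r) :
    Wheel5 G (w₂.headD o) z (w₁.headD o) (q.headD o) (r.headD o) (w₃.headD o) :=
  S.wheel5_of_fan2 rfl P.h₂ P.h₁ P.h₃ P.a₁.symm P.a₂ P.not_adj
    ⟨⟨lq, lr⟩, ⟨q₂, r₂⟩, ⟨q₁, qr, r₃.symm⟩, fun e => P.not_adj_lower S h4 lr r₂ e r₃.symm,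
      P.not_adj_lower S h4 lq q₂ q₁⟩

theorem wheel6 (P : UngluedPath G o (m + 1) B A z w₁ w₂ w₃ w₄)
    (S : IsCoverBall G o (m + 1) B A) (h4 : G.NoFourWheel) {q t r : List V} (lq : q.length = m)
    (lt : t.length = m) (lr : r.length = m) (q₂ : A.Adj w₂ q) (t₂ : A.Adj w₂ t) (r₂ : A.Adj w₂ r)
    (q₁ : A.Adj w₁ q) (qt : A.Adj q t) (tr : A.Adj t r) (r₃ : A.Adj w₃ r) (t₁ : ¬ A.Adj w₁ t)
    (t₃ : ¬ A.Adj t w₃) (qr : ¬ A.Adj q r) (ne : q ≠ r) :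
    Wheel6 G (w₂.headD o) z (w₁.headD o) (q.headD o) (t.headD o) (r.headD o) (w₃.headD o) :=
  S.wheel6_of_fan3 rfl P.h₂ P.h₁ P.h₃ P.a₁.symm P.a₂ P.not_adj
    ⟨⟨lq, lt, lr⟩, ⟨q₂, t₂, r₂⟩, ⟨q₁, qt, tr, r₃.symm⟩,
      ⟨t₁, fun e => P.not_adj_lower S h4 lr r₂ e r₃.symm, qr, P.not_adj_lower S h4 lq q₂ q₁, t₃⟩, ne⟩

/-- Otherwise there is a 5-wheel around `w₂`. Lower neighbours of `w₃` give a 5- or 6-wheel around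
`w₃`, and the resulting dwheel contradicts `not_near`. -/
theorem not_linked (P : UngluedPath G o (m + 1) B A z w₁ w₂ w₃ w₄)
    (S : IsCoverBall G o (m + 1) B A) (h4 : G.NoFourWheel) (hd : G.HasSmallDwheels) {q r : List V}
    (lq : q.length = m) (lr : r.length = m) (q₂ : A.Adj w₂ q) (r₂ : A.Adj w₂ r) (q₁ : A.Adj w₁ q)
    (qr : A.Adj q r) : ¬ A.Adj w₃ r := by
  intro r₃
  have lr' : r.length + 1 = m + 1 := by omega
  obtain ⟨s, ls, s₃, s₄⟩ := S.exists_below_edge P.a₃ P.h₃.length_eq P.h₄.length_eq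
  have U := P.wheel5 S h4 lq lr q₂ r₂ q₁ qr r₃
  have ne : r ≠ s := by rintro rfl; exact P.symm.not_adj_lower S h4 lr r₃ s₄ r₂.symm
  have adj : ∀ s, s.length = m → A.Adj w₃ s → A.Adj w₄ s → ¬ A.Adj r s := by
    intro s ls s₃ s₄ rs
    have U' := P.symm.wheel5 S h4 ls lr s₃ r₃ s₄ rs.symm r₂
    obtain ⟨y, y1, y2⟩ := hd.exists_near55 U U' (.inl rfl)
    exact P.not_near S r₂ r₃ lr' y1.1 y1.2.1 y2.2.2.2.2 y1.2.2.2.2 y2.2.1 y1.2.2.2.1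
  have rs := adj s ls s₃ s₄
  obtain ⟨t, lt, t₃, rt, st⟩ := S.below_vertex P.h₃.length_eq r₃ s₃ lr ls ne rs
  have t₄ : ¬ A.Adj w₄ t := fun t₄ => adj t lt t₃ t₄ rt
  -- When `t` lies below `w₂` too, both wheels are read with `z` as the common end and with the
  -- adjacent first vertices `r` and `t`.
  by_cases t₂ : A.Adj w₂ t
  · have U' := P.symm.wheel5 S h4 ls lt s₃ t₃ s₄ st t₂
    have U₁ : Wheel5 G (w₂.headD o) (r.headD o) (q.headD o) (w₁.headD o) z (w₃.headD o) := by
      obtain ⟨a1, a2, a3⟩ := U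
      refine ⟨?_, ?_, ?_⟩ <;> grind [G.adj_comm]
    have U₂ : Wheel5 G (w₃.headD o) (t.headD o) (s.headD o) (w₄.headD o) z (w₂.headD o) := by
      obtain ⟨a1, a2, a3⟩ := U'
      refine ⟨?_, ?_, ?_⟩ <;> grind [G.adj_comm]
    obtain ⟨y, y1, y2⟩ := hd.exists_near55 U₁ U₂ (.inr (S.map_adj rt))
    exact P.not_near S r₂ r₃ lr' y1.2.2.2.1 y1.2.2.1 y2.2.2.2.2 y1.2.2.2.2 y2.2.2.1 y1.1
  · have U' := P.symm.wheel6 S h4 ls lt lr s₃ t₃ r₃ s₄ st rt.symm r₂ t₄ (fun e => t₂ e.symm)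
      (fun e => rs e.symm) ne.symm
    obtain ⟨y, y1, y2⟩ := hd.exists_near56 U U' (.inl rfl)
    exact P.not_near S r₂ r₃ lr' y1.1 y1.2.1 y2.2.2.2.2.2 y1.2.2.2.2 y2.2.1 y1.2.2.2.1

/-- By `not_linked`, the lower neighbours on both sides of `r` need three vertices, so there are
6-wheels around `w₂` and `w₃`. The (6,6)-dwheel has boundary length exactly 8. -/
theorem false (P : UngluedPath G o n B A z w₁ w₂ w₃ w₄)
    (S : IsCoverBall G o n B A) (h4 : G.NoFourWheel) (hd : G.HasSmallDwheels) : False := by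
  obtain _ | m := n
  · have e1 := P.h₁.length_eq
    have e2 := P.h₂.length_eq
    rw [List.length_eq_zero_iff] at e1 e2
    exact A.irrefl (e1 ▸ e2 ▸ P.a₁)
  obtain ⟨r, lr, r₂, r₃⟩ := S.exists_below_edge P.a₂ P.h₂.length_eq P.h₃.length_eq
  have exists_wheel : ∀ {w₁ w₂ w₃ w₄}, UngluedPath G o (m + 1) B A z w₁ w₂ w₃ w₄ → A.Adj w₂ r →
      A.Adj w₃ r → ∃ p t : List V, Wheel6 G (w₂.headD o) z (w₁.headD o) (p.headD o) (t.headD o)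
        (r.headD o) (w₃.headD o) := by
    clear! w₁ w₂ w₃ w₄
    intro w₁ w₂ w₃ w₄ P r₂ r₃
    obtain ⟨p, lp, p₂, p₁⟩ := S.exists_below_edge P.a₁.symm P.h₂.length_eq P.h₁.length_eq
    have hL := fun q r lq lr q₂ r₂ q₁ qr => P.not_linked S h4 hd (q := q) (r := r) lq lr q₂ r₂ q₁ qr
    have ne : r ≠ p := by rintro rfl; exact P.not_adj_lower S h4 lr r₂ p₁ r₃.symm
    have rp : ¬ A.Adj r p := fun e => hL p r lp lr p₂ r₂ p₁ e.symm r₃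
    obtain ⟨t, lt, t₂, rt, pt⟩ := S.below_vertex P.h₂.length_eq r₂ p₂ lr lp ne rp
    exact ⟨p, t, P.wheel6 S h4 lp lt lr p₂ t₂ r₂ p₁ pt rt.symm r₃
      (fun e => hL t r lt lr t₂ r₂ e rt.symm r₃) (fun e => hL p t lp lt p₂ t₂ p₁ pt e.symm)
      (fun e => rp e.symm) ne.symm⟩
  obtain ⟨p, t, U⟩ := exists_wheel P r₂ r₃
  obtain ⟨p', t', U'⟩ := exists_wheel P.symm r₃ r₂
  obtain ⟨y, y1, y2⟩ := hd.exists_near66 U U'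
  exact P.not_near S r₂ r₃ (by omega) y1.1 y1.2.1 y2.2.2.2.2.2 y1.2.2.2.2.2 y2.2.1 y1.2.2.2.2.1

end UngluedPath

namespace IsCoverBall

variable {G : SimpleGraph V} {o : V} {n : ℕ} {B : Set (List V)} {A : SimpleGraph (List V)}
variable (S : IsCoverBall G o n B A)
include S

/-- Two gluings make a path of points with missing neighbours over `z`, and any three consecutive
edges of such a path can be replaced by a gluing of its ends. -/
theorem glued_trans (h4 : G.NoFourWheel) (hd : G.HasSmallDwheels) {z : V} {w w' w'' : List V}
    (hw : Missing G o n B A z w) (hw' : Missing G o n B A z w') (hw'' : Missing G o n B A z w'')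
    (h : Glued G o n B A z w w') (h' : Glued G o n B A z w' w'') : Glued G o n B A z w w'' := by
  have key : ∀ {a b c d}, Missing G o n B A z a → Missing G o n B A z b → Missing G o n B A z c →
      Missing G o n B A z d → A.Adj a b → A.Adj b c → A.Adj c d → Glued G o n B A z a d := by
    intro a b c d ha hb hc hd' e1 e2 e3
    by_contra hcon
    exact UngluedPath.false ⟨ha, hb, hc, hd', e1, e2, e3, hcon⟩ S h4 hd
  have step : ∀ {a b c}, Missing G o n B A z a → Missing G o n B A z b → Missing G o n B A z c →
      Glued G o n B A z a b → A.Adj b c → Glued G o n B A z a c := by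
    rintro a b c ha hb hc (rfl | e | ⟨d, hd', e, e'⟩) bc
    · exact .inr (.inl bc)
    · exact .inr (.inr ⟨b, hb, e, bc⟩)
    · exact key ha hd' hb hc e e' bc
  rcases h' with rfl | e | ⟨d, hd', e, e'⟩
  · exact h
  · exact step hw hw' hw'' h e
  · exact step hw hd' hw'' (step hw hw' hd' h e) e'

end IsCoverBall
end SimpleGraph

/-! ### The cover: the next ball and the union of all balls. -/

namespace SimpleGraph

variable {V : Type u}

/-- A representative of the class of `w` under `Glued`. -/
noncomputable def gluedRep (G : SimpleGraph V) (o : V) (n : ℕ) (B : Set (List V))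
    (A : SimpleGraph (List V)) (z : V) (w : List V) : List V :=
  Classical.epsilon fun w' => Missing G o n B A z w' ∧ Glued G o n B A z w w'

/-- `a` is a new vertex of the ball of radius `n + 1` joined to the vertex `w` of the sphere of
radius `n`. -/
def Over (G : SimpleGraph V) (o : V) (n : ℕ) (B : Set (List V)) (A : SimpleGraph (List V))
    (a w : List V) : Prop :=
  ∃ z, Missing G o n B A z w ∧ a = z :: gluedRep G o n B A z w

/-- The vertices of the ball of radius `n + 1` in the cover. -/
def nextBall (G : SimpleGraph V) (o : V) (n : ℕ) (B : Set (List V)) (A : SimpleGraph (List V)) :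
    Set (List V) :=
  B ∪ {a | ∃ w, Over G o n B A a w}

/-- The adjacency relation of the ball of radius `n + 1` in the cover. -/
def NextAdj (G : SimpleGraph V) (o : V) (n : ℕ) (B : Set (List V)) (A : SimpleGraph (List V))
    (a b : List V) : Prop :=
  A.Adj a b ∨ Over G o n B A a b ∨ Over G o n B A b a ∨
    ∃ w, Over G o n B A a w ∧ Over G o n B A b w ∧ G.Adj (a.headD o) (b.headD o)

namespace Over

variable {G : SimpleGraph V} {o : V} {n : ℕ} {B : Set (List V)} {A : SimpleGraph (List V)}
variable {a b w w' : List V}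

theorem missing (h : Over G o n B A a w) : Missing G o n B A (a.headD o) w := by
  obtain ⟨z, hw, rfl⟩ := h
  exact hw

theorem eq_cons (h : Over G o n B A a w) : a = a.headD o :: gluedRep G o n B A (a.headD o) w := by
  obtain ⟨z, hw, rfl⟩ := h
  rfl

theorem rep (h : Over G o n B A a w) :
    Missing G o n B A (a.headD o) (gluedRep G o n B A (a.headD o) w) ∧
      Glued G o n B A (a.headD o) w (gluedRep G o n B A (a.headD o) w) :=
  Classical.epsilon_spec
    (p := fun w' => Missing G o n B A (a.headD o) w' ∧ Glued G o n B A (a.headD o) w w')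
    ⟨w, h.missing, .inl rfl⟩

theorem length_eq (h : Over G o n B A a w) : a.length = n + 1 := by
  rw [h.eq_cons, List.length_cons, h.rep.1.length_eq]

theorem length_right (h : Over G o n B A a w) : w.length = n := h.missing.length_eq

theorem eq_of_headD_eq (h : Over G o n B A a w) (h' : Over G o n B A b w)
    (hab : a.headD o = b.headD o) : a = b := by
  rw [h.eq_cons, h'.eq_cons, hab]

variable (S : IsCoverBall G o n B A) (h4 : G.NoFourWheel) (hd : G.HasSmallDwheels)
include S h4 hd

theorem glued (h : Over G o n B A a w) (h' : Over G o n B A a w') :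
    Glued G o n B A (a.headD o) w w' := by
  have e : gluedRep G o n B A (a.headD o) w = gluedRep G o n B A (a.headD o) w' :=
    (List.cons.inj (h.eq_cons.symm.trans h'.eq_cons)).2
  exact S.glued_trans h4 hd h.missing h.rep.1 h'.missing h.rep.2 (e ▸ h'.rep.2.symm)

/-- By transitivity, glued points define the same predicate and hence have the same chosen
representative. -/
theorem of_glued (h : Over G o n B A a w) (hw' : Missing G o n B A (a.headD o) w')
    (hg : Glued G o n B A (a.headD o) w w') : Over G o n B A a w' := by
  refine ⟨a.headD o, hw', h.eq_cons.trans ?_⟩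
  congr 1
  unfold gluedRep
  congr 1
  funext c
  refine propext (and_congr_right fun hc => ⟨fun e => ?_, fun e => ?_⟩)
  · exact S.glued_trans h4 hd hw' h.missing hc hg.symm e
  · exact S.glued_trans h4 hd h.missing hw' hc hg e

theorem of_adj (h : Over G o n B A a w) (ww' : A.Adj w w') (h' : G.Adj (a.headD o) (w'.headD o)) :
    Over G o n B A a w' :=
  h.of_glued S h4 hd (S.missing_of_adj h.missing ww' h'.symm) (.inr (.inl ww'))

/-- Adjacent new vertices have the same neighbours in the sphere among lifts of common
neighbours. -/
theorem of_common {v p q : List V} (vp : Over G o n B A v p) (vq : Over G o n B A v q)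
    (ap : Over G o n B A a p) (va : G.Adj (v.headD o) (a.headD o))
    (aq : G.Adj (a.headD o) (q.headD o)) : Over G o n B A a q := by
  by_cases pq : A.Adj p q
  · exact ap.of_adj S h4 hd pq aq
  rcases vp.glued S h4 hd vq with rfl | e | ⟨c, hc, pc, cq⟩
  · exact ap
  · exact absurd e pq
  by_cases hpq : p = q
  · exact hpq ▸ ap
  -- The cycle `p, c, q, a` around `v` lacks the diagonal between `p` and `q`, so it has the other
  -- one.
  have ca := h4 vp.missing.adj.symm hc.adj.symm vq.missing.adj.symm va (S.map_adj pc) (S.map_adj cq)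
    aq.symm ap.missing.adj.symm (fun e => hpq (S.inj pc.symm cq e)) (ap.missing.ne c pc)
    fun e => pq (S.adj_of_adj pc.symm cq e)
  exact (ap.of_adj S h4 hd pc ca.symm).of_adj S h4 hd cq aq

/-- New vertices with a common new neighbour, which are adjacent in `G`, have a common neighbour
in the sphere. -/
theorem exists_common {v p q : List V} (vp : Over G o n B A v p) (ap : Over G o n B A a p)
    (va : G.Adj (v.headD o) (a.headD o)) (vq : Over G o n B A v q) (bq : Over G o n B A b q)
    (vb : G.Adj (v.headD o) (b.headD o)) (ab : G.Adj (a.headD o) (b.headD o)) :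
    ∃ w, Over G o n B A a w ∧ Over G o n B A b w := by
  by_cases haq : G.Adj (a.headD o) (q.headD o)
  · exact ⟨q, vp.of_common S h4 hd vq ap va haq, bq⟩
  by_cases hbp : G.Adj (b.headD o) (p.headD o)
  · exact ⟨p, ap, vq.of_common S h4 hd vp bq vb hbp⟩
  have key : ∀ {p q}, Over G o n B A v p → Over G o n B A a p → Over G o n B A v q →
      Over G o n B A b q → A.Adj p q → ∃ w, Over G o n B A a w ∧ Over G o n B A b w := by
    intro p q vp ap vq bq pq
    by_cases haq : G.Adj (a.headD o) (q.headD o)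
    · exact ⟨q, vp.of_common S h4 hd vq ap va haq, bq⟩
    have hbp := h4 va vb vq.missing.adj.symm vp.missing.adj.symm ab bq.missing.adj.symm
      (S.map_adj pq).symm ap.missing.adj (ap.missing.ne q pq).symm (bq.missing.ne p pq.symm).symm haq
    exact ⟨p, ap, vq.of_common S h4 hd vp bq vb hbp⟩
  by_cases hpq : p = q
  · exact ⟨q, hpq ▸ ap, bq⟩
  by_cases pq : A.Adj p q
  · exact key vp ap vq bq pq
  rcases vp.glued S h4 hd vq with e | e | ⟨c, hc, pc, cq⟩
  · exact absurd e hpq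
  · exact absurd e pq
  have vc : Over G o n B A v c := vp.of_glued S h4 hd hc (.inr (.inl pc))
  by_cases hac : G.Adj (a.headD o) (c.headD o)
  · exact key vc (ap.of_adj S h4 hd pc hac) vq bq cq
  by_cases hbc : G.Adj (b.headD o) (c.headD o)
  · exact key vp ap vc (bq.of_adj S h4 hd cq.symm hbc) pc
  -- With all shorter connections excluded, `q, b, a, p, c` is a full cycle around `v`. A fan below
  -- `c` completes it to a dwheel with centres `v` and `c`.
  have U : Wheel5 G (v.headD o) (q.headD o) (b.headD o) (a.headD o) (p.headD o) (c.headD o) := by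
    refine ⟨⟨vq.missing.adj.symm, vb, va, vp.missing.adj.symm, hc.adj.symm⟩,
      ⟨bq.missing.adj, ab.symm, ap.missing.adj.symm, S.map_adj pc, S.map_adj cq⟩, ?_⟩
    have := (S.adj_iff pc.symm cq).not.2 pq
    grind [G.adj_comm]
  -- The centre of the 1-ball lifts to a point of the sphere below `v`, and `of_common` puts `a` and
  -- `b` over the same point.
  have fin : ∀ y r, A.Adj c r → r.length + 1 = n → G.Near y (v.headD o) → G.Near y (q.headD o) →
      G.Near y (b.headD o) → G.Near y (a.headD o) → G.Near y (p.headD o) → G.Near y (c.headD o) →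
      G.Near y (r.headD o) → ∃ w, Over G o n B A a w ∧ Over G o n B A b w := by
    intro y r cr lr yv yq yb ya yp yn yr
    have yc' : G.Adj y (c.headD o) := by
      refine yn.resolve_left ?_
      rintro rfl
      exact ya.elim (ap.missing.ne c pc) fun e => hac e.symm
    clear yn
    obtain ⟨y, hy, yc, -, rfl⟩ := S.exists_missing_of_near hc cr lr yv yc' yr
    have vy : Over G o n B A v y := vc.of_glued S h4 hd hy (.inr (.inl yc.symm))
    have aux : ∀ {a p}, Over G o n B A v p → Over G o n B A a p →
        G.Adj (v.headD o) (a.headD o) → A.Adj p c → G.Near (y.headD o) (p.headD o) →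
        G.Near (y.headD o) (a.headD o) → Over G o n B A a y := by
      intro a p vp ap va pc yp ya
      refine vp.of_common S h4 hd vy ap va (ya.resolve_left fun e => ?_).symm
      rcases S.near_lift yc.symm pc.symm yp with rfl | e'
      · exact (e ▸ ap.missing.adj).ne rfl
      · exact ap.missing.ne y e'.symm e
    exact ⟨y, aux vp ap va pc yp ya, aux vq bq vb cq.symm yq yb⟩
  obtain _ | m := n
  · have e1 := vp.missing.length_eq
    have e2 := vq.missing.length_eq
    rw [List.length_eq_zero_iff] at e1 e2
    exact absurd (e1.trans e2.symm) hpq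
  rcases S.exists_fan hc.length_eq vq.length_right vp.length_right cq pc.symm with
    ⟨k, f⟩ | ⟨k, k', f⟩ | ⟨k, r, k', f⟩
  · exact absurd f (S.not_fan1 h4 rfl hc vq.missing vp.missing cq pc.symm (Ne.symm hpq)
      fun e => pq e.symm)
  · have U' := (S.wheel5_of_fan2 rfl hc vq.missing vp.missing cq pc.symm (fun e => pq e.symm) f)
    have U'' : Wheel5 G (c.headD o) (q.headD o) (k.headD o) (k'.headD o) (p.headD o)
        (v.headD o) := by
      obtain ⟨a1, a2, a3⟩ := U'
      refine ⟨?_, ?_, ?_⟩ <;> grind [G.adj_comm]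
    obtain ⟨y, y1, y2⟩ := hd.exists_near55 U U'' (.inl rfl)
    exact fin y k f.adj.1 (by have := f.lev_eq.1; omega) y2.2.2.2.2 y1.1 y1.2.1 y1.2.2.1
      y1.2.2.2.1 y1.2.2.2.2 y2.2.1
  · have U' := (S.wheel6_of_fan3 rfl hc vq.missing vp.missing cq pc.symm (fun e => pq e.symm) f)
    have U'' : Wheel6 G (c.headD o) (q.headD o) (k.headD o) (r.headD o) (k'.headD o) (p.headD o)
        (v.headD o) := by
      obtain ⟨a1, a2, a3, a4, a5, a6⟩ := U'
      refine ⟨?_, ?_, ?_, ?_, ?_, ?_⟩ <;> grind [G.adj_comm]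
    obtain ⟨y, y1, y2⟩ := hd.exists_near56 U U'' (.inl rfl)
    exact fin y k f.adj.1 (by have := f.lev_eq.1; omega) y2.2.2.2.2.2 y1.1 y1.2.1 y1.2.2.1
      y1.2.2.2.1 y1.2.2.2.2 y2.2.1

end Over

variable {G : SimpleGraph V} {o : V} {n : ℕ} {B : Set (List V)} {A : SimpleGraph (List V)}

theorem NextAdj.symm {a b : List V} : NextAdj G o n B A a b → NextAdj G o n B A b a := by
  rintro (h | h | h | ⟨w, h, h', e⟩)
  · exact .inl h.symm
  · exact .inr (.inr (.inl h))
  · exact .inr (.inl h)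
  · exact .inr (.inr (.inr ⟨w, h', h, e.symm⟩))

theorem NextAdj.old {a b : List V} (h : NextAdj G o n B A a b) (ha : a.length ≤ n)
    (hb : b.length ≤ n) : A.Adj a b := by
  rcases h with h | h | h | ⟨w, h, -, -⟩
  · exact h
  all_goals exact absurd h.length_eq (by omega)

/-- The graph structure on the ball of radius `n + 1` in the cover. -/
def nextGraph (G : SimpleGraph V) (o : V) (n : ℕ) (B : Set (List V)) (A : SimpleGraph (List V)) :
    SimpleGraph (List V) where
  Adj := NextAdj G o n B A
  symm := ⟨fun _ _ h => h.symm⟩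
  loopless := ⟨by
    rintro a (h | h | h | ⟨w, -, -, h⟩)
    · exact h.ne rfl
    · exact absurd h.length_eq (by have := h.length_right; omega)
    · exact absurd h.length_eq (by have := h.length_right; omega)
    · exact h.ne rfl⟩

namespace IsCoverBall

variable (S : IsCoverBall G o n B A)
include S

theorem length_le_of_adj {a b : List V} (h : A.Adj a b) : a.length ≤ n :=
  S.length_le (S.mem_of_adj h)

theorem nextAdj_new_old {a b : List V} (h : NextAdj G o n B A a b) (ha : a.length = n + 1)
    (hb : b.length ≤ n) : Over G o n B A a b := by
  rcases h with h | h | h | ⟨w, -, h, -⟩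
  · exact absurd (S.length_le_of_adj h) (by omega)
  · exact h
  all_goals exact absurd h.length_eq (by omega)

theorem nextAdj_new_new {a b : List V} (h : NextAdj G o n B A a b) (ha : a.length = n + 1)
    (hb : b.length = n + 1) :
    ∃ w, Over G o n B A a w ∧ Over G o n B A b w ∧ G.Adj (a.headD o) (b.headD o) := by
  rcases h with h | h | h | h
  · exact absurd (S.length_le_of_adj h) (by omega)
  · exact absurd h.length_right (by omega)
  · exact absurd h.length_right (by omega)
  · exact h

theorem nextAdj_length {a b : List V} (h : NextAdj G o n B A a b) :
    a.length ≤ n ∨ a.length = n + 1 := by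
  rcases h with h | h | h | ⟨w, h, -, -⟩
  · exact .inl (S.length_le_of_adj h)
  · exact .inr h.length_eq
  · exact .inl h.length_right.le
  · exact .inr h.length_eq

theorem next_map_adj {a b : List V} (h : NextAdj G o n B A a b) :
    G.Adj (a.headD o) (b.headD o) := by
  rcases h with h | h | h | ⟨w, -, -, h⟩
  · exact S.map_adj h
  · exact h.missing.adj.symm
  · exact h.missing.adj
  · exact h

variable (h4 : G.NoFourWheel) (hd : G.HasSmallDwheels)
include h4 hd

/-- New points only lie over missing neighbours, so they never compete with old ones. Two new
neighbours of a new point with the same image lie over a common old point by `of_common`. -/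
theorem next_inj {w a b : List V} (wa : NextAdj G o n B A w a) (wb : NextAdj G o n B A w b)
    (hab : a.headD o = b.headD o) : a = b := by
  have old_new : ∀ {a b}, NextAdj G o n B A w a → NextAdj G o n B A w b → a.length ≤ n →
      b.length = n + 1 → a.headD o ≠ b.headD o := by
    intro a b wa wb la lb hab
    rcases S.nextAdj_length wa with lw | lw
    · exact (S.nextAdj_new_old wb.symm lb lw).missing.ne a (wa.old lw la) hab
    · have wa := S.nextAdj_new_old wa lw la
      obtain ⟨p, wp, bp, e⟩ := S.nextAdj_new_new wb lw lb
      rcases wa.glued S h4 hd wp with rfl | h | ⟨c, hc, ac, cp⟩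
      · exact bp.missing.adj.ne hab
      · exact bp.missing.ne a h.symm hab
      · refine (S.missing_of_adj bp.missing cp.symm ?_).ne a ac.symm hab
        exact hab ▸ (S.map_adj ac).symm
  rcases S.nextAdj_length wa.symm with la | la <;> rcases S.nextAdj_length wb.symm with lb | lb
  · rcases S.nextAdj_length wa with lw | lw
    · exact S.inj (wa.old lw la) (wb.old lw lb) hab
    · rcases (S.nextAdj_new_old wa lw la).glued S h4 hd (S.nextAdj_new_old wb lw lb) with
        h | h | ⟨c, -, h, h'⟩
      · exact h
      · exact absurd hab (S.map_adj h).ne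
      · exact S.inj h.symm h' hab
  · exact absurd hab (old_new wa wb la lb)
  · exact absurd hab.symm (old_new wb wa lb la)
  · rcases S.nextAdj_length wa with lw | lw
    · exact (S.nextAdj_new_old wa.symm la lw).eq_of_headD_eq (S.nextAdj_new_old wb.symm lb lw) hab
    · obtain ⟨p, wp, ap, e⟩ := S.nextAdj_new_new wa lw la
      obtain ⟨q, wq, bq, e'⟩ := S.nextAdj_new_new wb lw lb
      exact (wp.of_common S h4 hd wq ap e (hab ▸ bq.missing.adj.symm)).eq_of_headD_eq bq hab

theorem next_adj_of_adj {w a b : List V} (wa : NextAdj G o n B A w a) (wb : NextAdj G o n B A w b)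
    (hab : G.Adj (a.headD o) (b.headD o)) : NextAdj G o n B A a b := by
  have old_new : ∀ {a b}, NextAdj G o n B A w a → NextAdj G o n B A w b → a.length ≤ n →
      b.length = n + 1 → G.Adj (a.headD o) (b.headD o) → Over G o n B A b a := by
    intro a b wa wb la lb hab
    rcases S.nextAdj_length wa with lw | lw
    · exact (S.nextAdj_new_old wb.symm lb lw).of_adj S h4 hd (wa.old lw la) hab.symm
    · obtain ⟨p, wp, bp, e⟩ := S.nextAdj_new_new wb lw lb
      exact wp.of_common S h4 hd (S.nextAdj_new_old wa lw la) bp e hab.symm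
  rcases S.nextAdj_length wa.symm with la | la <;> rcases S.nextAdj_length wb.symm with lb | lb
  · rcases S.nextAdj_length wa with lw | lw
    · exact .inl (S.adj_of_adj (wa.old lw la) (wb.old lw lb) hab)
    · rcases (S.nextAdj_new_old wa lw la).glued S h4 hd (S.nextAdj_new_old wb lw lb) with
        rfl | h | ⟨c, -, h, h'⟩
      · exact absurd rfl hab.ne
      · exact .inl h
      · exact .inl (S.adj_of_adj h.symm h' hab)
  · exact .inr (.inr (.inl (old_new wa wb la lb hab)))
  · exact .inr (.inl (old_new wb wa lb la hab.symm))
  · rcases S.nextAdj_length wa with lw | lw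
    · exact .inr (.inr (.inr ⟨w, S.nextAdj_new_old wa.symm la lw, S.nextAdj_new_old wb.symm lb lw,
        hab⟩))
    · obtain ⟨p, wp, ap, e⟩ := S.nextAdj_new_new wa lw la
      obtain ⟨q, wq, bq, e'⟩ := S.nextAdj_new_new wb lw lb
      obtain ⟨c, ac, bc⟩ := wp.exists_common S h4 hd ap e wq bq e' hab
      exact .inr (.inr (.inr ⟨c, ac, bc, hab⟩))

/-- Descent in the new layer is built in: a new edge comes with a common point below it, and points
below the same new vertex are glued. -/
theorem next : IsCoverBall G o (n + 1) (nextBall G o n B A) (nextGraph G o n B A) where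
  lev_le := by
    rintro x y (h | h | h | ⟨w, h, h', -⟩)
    · exact S.lev_le h
    · exact h.length_eq.trans_le (by rw [h.length_right])
    · have := h.length_eq
      have := h.length_right
      omega
    · have := h.length_eq
      have := h'.length_eq
      omega
  exists_below_edge := by
    rintro k x y (h | h | h | ⟨w, h, h', -⟩) lx ly
    · obtain ⟨u, lu, xu, yu⟩ := S.exists_below_edge h lx ly
      exact ⟨u, lu, .inl xu, .inl yu⟩
    · exact absurd h.length_eq (by have := h.length_right; omega)
    · exact absurd h.length_eq (by have := h.length_right; omega)
    · exact ⟨w, by have := h.length_eq; have := h.length_right; omega, .inr (.inl h),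
        .inr (.inl h')⟩
  below_vertex := by
    rintro k x u w lx xu xw lu lw ne uw
    rcases S.nextAdj_length xu with h | h
    · obtain ⟨t, lt, h1, h2, h3⟩ := S.below_vertex lx (xu.old h (by omega))
        (xw.old h (by omega)) lu lw ne fun e => uw (.inl e)
      exact ⟨t, lt, .inl h1, .inl h2, .inl h3⟩
    · have xu := S.nextAdj_new_old xu h (by omega)
      have xw := S.nextAdj_new_old xw h (by omega)
      rcases xu.glued S h4 hd xw with e | e | ⟨c, hc, uc, cw⟩
      · exact absurd e ne
      · exact absurd (.inl e) uw
      · exact ⟨c, by have := hc.length_eq; omega,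
          .inr (.inl (xu.of_glued S h4 hd hc (.inr (.inl uc)))), .inl uc, .inl cw.symm⟩
  nil_mem := .inl S.nil_mem
  mem_of_adj := by
    rintro a b (h | h | h | ⟨w, h, -, -⟩)
    · exact .inl (S.mem_of_adj h)
    · exact .inr ⟨b, h⟩
    · exact .inl h.missing.mem
    · exact .inr ⟨w, h⟩
  map_adj := fun _ _ h => S.next_map_adj h
  exists_below := by
    rintro k a (ha | ⟨w, h⟩) la
    · obtain ⟨u, lu, au⟩ := S.exists_below ha la
      exact ⟨u, lu, .inl au⟩
    · exact ⟨w, by have := h.length_eq; have := h.length_right; omega, .inr (.inl h)⟩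
  inj := fun _ _ _ wa wb => S.next_inj h4 hd wa wb
  adj_of_adj := fun _ _ _ wa wb => S.next_adj_of_adj h4 hd wa wb
  length_le := by
    rintro a (ha | ⟨w, h⟩)
    · exact (S.length_le ha).trans n.le_succ
    · exact h.length_eq.le
  exists_lift := by
    rintro w z hw lw wz
    have hw : w ∈ B := hw.resolve_right fun ⟨p, h⟩ => by have := h.length_eq; omega
    by_cases hz : ∃ a, A.Adj w a ∧ a.headD o = z
    · obtain ⟨a, wa, rfl⟩ := hz
      exact ⟨a, .inl wa, rfl⟩
    have hm : Missing G o n B A z w := by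
      refine ⟨hw, ?_, wz, fun a wa e => hz ⟨a, wa, e⟩⟩
      by_contra hl
      exact hz (S.exists_lift hw (by omega) wz)
    exact ⟨_, .inr (.inr (.inl ⟨z, hm, rfl⟩)), rfl⟩

end IsCoverBall

/-- The balls of the cover. -/
noncomputable def coverBall (G : SimpleGraph V) (o : V) : ℕ → Set (List V) × SimpleGraph (List V)
  | 0 => ({[]}, ⊥)
  | n + 1 => (nextBall G o n (coverBall G o n).1 (coverBall G o n).2,
      nextGraph G o n (coverBall G o n).1 (coverBall G o n).2)

theorem isCoverBall_coverBall (h4 : G.NoFourWheel) (hd : G.HasSmallDwheels) (o : V) :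
    ∀ n, IsCoverBall G o n (coverBall G o n).1 (coverBall G o n).2
  | 0 => by
    refine ⟨⟨⟨?_, ?_, ?_⟩, ?_, ?_, ?_, ?_, ?_, ?_⟩, ?_, ?_⟩ <;> simp [coverBall]
  | n + 1 => (isCoverBall_coverBall h4 hd o n).next h4 hd

/-- The vertices of the cover. -/
def coverSet (G : SimpleGraph V) (o : V) : Set (List V) := {a | ∃ n, a ∈ (coverBall G o n).1}

/-- The graph structure of the cover. -/
noncomputable def coverGraph (G : SimpleGraph V) (o : V) : SimpleGraph (List V) :=
  ⨆ n, (coverBall G o n).2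

theorem coverGraph_adj {a b : List V} :
    (coverGraph G o).Adj a b ↔ ∃ n, (coverBall G o n).2.Adj a b := by
  simp [coverGraph]

theorem coverBall_mono (G : SimpleGraph V) (o : V) :
    Monotone fun n => (coverBall G o n).2 :=
  monotone_nat_of_le_succ fun _ _ _ h => .inl h

theorem mem_coverBall_length (h4 : G.NoFourWheel) (hd : G.HasSmallDwheels) {a : List V} {n : ℕ}
    (ha : a ∈ (coverBall G o n).1) : a ∈ (coverBall G o a.length).1 := by
  induction n with
  | zero =>
    have h : a = [] := ha
    exact h ▸ rfl
  | succ n ih =>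
    have hl := (isCoverBall_coverBall h4 hd o (n + 1)).length_le ha
    rcases ha with h | ⟨w, h⟩
    · exact ih h
    · exact h.length_eq ▸ .inr ⟨w, h⟩

theorem isPrecover_cover (h4 : G.NoFourWheel) (hd : G.HasSmallDwheels) (o : V) :
    IsPrecover G o (coverSet G o) (coverGraph G o) := by
  have S := isCoverBall_coverBall h4 hd o
  have two : ∀ {a b c d}, (coverGraph G o).Adj a b → (coverGraph G o).Adj c d →
      ∃ n, (coverBall G o n).2.Adj a b ∧ (coverBall G o n).2.Adj c d := by
    intro a b c d h h'
    obtain ⟨n, h⟩ := coverGraph_adj.1 h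
    obtain ⟨m, h'⟩ := coverGraph_adj.1 h'
    exact ⟨max n m, coverBall_mono G o (le_max_left n m) h,
      coverBall_mono G o (le_max_right n m) h'⟩
  refine ⟨⟨?_, ?_, ?_⟩, ⟨0, rfl⟩, ?_, ?_, ?_, ?_, ?_⟩
  · intro x y h
    obtain ⟨n, h⟩ := coverGraph_adj.1 h
    exact (S n).lev_le h
  · intro k x y h lx ly
    obtain ⟨n, h⟩ := coverGraph_adj.1 h
    obtain ⟨u, lu, xu, yu⟩ := (S n).exists_below_edge h lx ly
    exact ⟨u, lu, coverGraph_adj.2 ⟨n, xu⟩, coverGraph_adj.2 ⟨n, yu⟩⟩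
  · intro k x u w lx xu xw lu lw ne uw
    obtain ⟨n, xu, xw⟩ := two xu xw
    obtain ⟨t, lt, h1, h2, h3⟩ := (S n).below_vertex lx xu xw lu lw ne
      fun e => uw (coverGraph_adj.2 ⟨n, e⟩)
    exact ⟨t, lt, coverGraph_adj.2 ⟨n, h1⟩, coverGraph_adj.2 ⟨n, h2⟩, coverGraph_adj.2 ⟨n, h3⟩⟩
  · intro a b h
    obtain ⟨n, h⟩ := coverGraph_adj.1 h
    exact ⟨n, (S n).mem_of_adj h⟩
  · intro a b h
    obtain ⟨n, h⟩ := coverGraph_adj.1 h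
    exact (S n).map_adj h
  · rintro k a ⟨n, ha⟩ la
    obtain ⟨u, lu, au⟩ := (S n).exists_below ha la
    exact ⟨u, lu, coverGraph_adj.2 ⟨n, au⟩⟩
  · intro w a b wa wb e
    obtain ⟨n, wa, wb⟩ := two wa wb
    exact (S n).inj wa wb e
  · intro w a b wa wb e
    obtain ⟨n, wa, wb⟩ := two wa wb
    exact coverGraph_adj.2 ⟨n, (S n).adj_of_adj wa wb e⟩

theorem exists_lift_cover (h4 : G.NoFourWheel) (hd : G.HasSmallDwheels) {w : List V}
    (hw : w ∈ coverSet G o) {z : V} (wz : G.Adj (w.headD o) z) :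
    ∃ a, (coverGraph G o).Adj w a ∧ a.headD o = z := by
  obtain ⟨n, hw⟩ := hw
  -- In the ball of radius `w.length + 1` the point `w` is interior, so all its neighbours lift.
  obtain ⟨a, wa, e⟩ := (isCoverBall_coverBall h4 hd o (w.length + 1)).exists_lift
    (.inl (mem_coverBall_length h4 hd hw)) (by omega) wz
  exact ⟨a, coverGraph_adj.2 ⟨_, wa⟩, e⟩

end SimpleGraph

/-! ### Star covers and their fibres. -/

namespace SimpleGraph

variable {V : Type u} {W : Type*}

/-- The map `f` is bijective from each closed star of `A` onto a closed star of `G`, and induces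
isomorphisms of the induced subgraphs. -/
structure IsStarCover (G : SimpleGraph V) (A : SimpleGraph W) (f : W → V) : Prop where
  map_adj : ∀ ⦃a b⦄, A.Adj a b → G.Adj (f a) (f b)
  exists_lift : ∀ ⦃w z⦄, G.Adj (f w) z → ∃ a, A.Adj w a ∧ f a = z
  inj : ∀ ⦃w a b⦄, A.Adj w a → A.Adj w b → f a = f b → a = b
  adj_of_adj : ∀ ⦃w a b⦄, A.Adj w a → A.Adj w b → G.Adj (f a) (f b) → A.Adj a b

theorem near_refl (G : SimpleGraph V) (a : V) : G.Near a a := .inl rfl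

theorem Near.symm {G : SimpleGraph V} {a b : V} (h : G.Near a b) : G.Near b a :=
  h.imp Eq.symm SimpleGraph.Adj.symm

namespace IsStarCover

variable {G : SimpleGraph V} {A : SimpleGraph W} {f : W → V} (C : IsStarCover G A f)
include C

theorem exists_near {w : W} {z : V} (h : G.Near (f w) z) : ∃ a, A.Near w a ∧ f a = z := by
  rcases h with rfl | h
  · exact ⟨w, .inl rfl, rfl⟩
  · obtain ⟨a, wa, e⟩ := C.exists_lift h
    exact ⟨a, .inr wa, e⟩

theorem near_inj {w a b : W} (wa : A.Near w a) (wb : A.Near w b) (hab : f a = f b) : a = b := by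
  rcases wa with rfl | wa <;> rcases wb with rfl | wb
  · rfl
  · exact absurd hab (C.map_adj wb).ne
  · exact absurd hab.symm (C.map_adj wa).ne
  · exact C.inj wa wb hab

theorem near_of_near {w a b : W} (wa : A.Near w a) (wb : A.Near w b) (hab : G.Near (f a) (f b)) :
    A.Near a b := by
  rcases wa with rfl | wa
  · exact wb
  rcases wb with rfl | wb
  · exact .inr wa.symm
  exact hab.imp (C.inj wa wb) (C.adj_of_adj wa wb)

theorem nonempty_fiber_equiv (hG : G.Preconnected) (u v : V) :
    Nonempty ({a // f a = u} ≃ {a // f a = v}) := by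
  obtain ⟨p⟩ := hG u v
  induction p with
  | nil => exact ⟨.refl _⟩
  | @cons u v w huv p ih =>
    have lift : ∀ {u v}, G.Adj u v → ∀ a : {a // f a = u}, ∃ b : {b // f b = v}, A.Near a b := by
      rintro u v h ⟨a, rfl⟩
      obtain ⟨b, hb, rfl⟩ := C.exists_near (.inr h)
      exact ⟨⟨b, rfl⟩, hb⟩
    choose g hg using lift huv
    refine ih.map (Equiv.trans (.ofBijective g ⟨fun a b e => ?_, fun b => ?_⟩))
    · exact Subtype.ext (C.near_inj (hg a).symm (e ▸ (hg b).symm) (a.2.trans b.2.symm))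
    · obtain ⟨a, ha⟩ := lift huv.symm b
      exact ⟨a, Subtype.ext (C.near_inj (hg a) ha.symm ((g a).2.trans b.2.symm))⟩

end IsStarCover

/-- The transition function between charts of the fibres over two vertices. -/
noncomputable def fiberTransition {F : Type*} (A : SimpleGraph W) {f : W → V}
    (φ : ∀ v, F ≃ {a // f a = v}) (u v : V) (c : F) : F :=
  @Classical.epsilon F ⟨c⟩ fun c' => A.Near (φ u c).1 (φ v c').1

namespace IsStarCover

variable {G : SimpleGraph V} {A : SimpleGraph W} {f : W → V} (C : IsStarCover G A f)
variable {F : Type*} {φ : ∀ v, F ≃ {a // f a = v}} {u v : V}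
include C

theorem near_fiberTransition (huv : G.Near u v) (c : F) :
    A.Near (φ u c).1 (φ v (fiberTransition A φ u v c)).1 := by
  obtain ⟨a, ha, e⟩ := C.exists_near (w := (φ u c).1) (z := v) (by rwa [(φ u c).2])
  have : ∃ c', A.Near (φ u c).1 (φ v c').1 := ⟨(φ v).symm ⟨a, e⟩, by simpa using ha⟩
  exact @Classical.epsilon_spec_aux F ⟨c⟩ _ this

theorem eq_fiberTransition (huv : G.Near u v) {c c' : F} (h : A.Near (φ u c).1 (φ v c').1) :
    fiberTransition A φ u v c = c' :=
  (φ v).injective (Subtype.ext (C.near_inj (C.near_fiberTransition huv c) h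
    ((φ v _).2.trans (φ v _).2.symm)))

theorem fiberTransition_injective (huv : G.Near u v) :
    Function.Injective (fiberTransition A φ u v) := fun c c' h =>
  (φ u).injective (Subtype.ext (C.near_inj (C.near_fiberTransition huv c).symm
    (h ▸ (C.near_fiberTransition huv c').symm) ((φ u _).2.trans (φ u _).2.symm)))

end IsStarCover
end SimpleGraph

/-! ### Open stars and edges in the realization. -/

namespace PreAbstractSimplicialComplex.Realization

variable {V : Type u} {X : PreAbstractSimplicialComplex V}

theorem isOpen_openStar (v : V) : IsOpen {x : X.Realization | v ∈ x.1.support} := by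
  refine isOpen_iSup_iff.2 fun s => ?_
  rw [isOpen_coinduced, isOpen_induced_iff]
  refine ⟨{g | g v ≠ 0}, (isClosed_eq (continuous_apply v) continuous_const).isOpen_compl, ?_⟩
  ext x
  simp

theorem continuous_of_closedFace {Y : Type*} [TopologicalSpace Y] {s : Finset V} (hs : s ∈ X.faces)
    {g : Y → X.Realization} (hg : ∀ y, (g y).1.support ⊆ s)
    (hc : ∀ v, Continuous fun y => (g y).1 v) : Continuous g := by
  let _ : TopologicalSpace (closedFace X s) :=
    TopologicalSpace.induced (fun x v => x.1.1 v) Pi.topologicalSpace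
  have h1 : Continuous fun y => (⟨g y, hg y⟩ : closedFace X s) :=
    continuous_induced_rng.2 (continuous_pi hc)
  have h2 : Continuous fun x : closedFace X s => (x : X.Realization) :=
    continuous_iff_coinduced_le.2 (le_iSup (fun s : X.faces =>
      TopologicalSpace.coinduced (fun x : closedFace X s => (x : X.Realization))
        (TopologicalSpace.induced (fun x v => x.1.1 v : closedFace X s → V → ℝ)
          Pi.topologicalSpace)) ⟨s, hs⟩)
  exact h2.comp h1

theorem support_nonempty (x : X.Realization) : x.1.support.Nonempty :=
  (X.isRelLowerSet_faces x.2.2.2).1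

theorem near_of_mem {x : X.Realization} {u v : V} (hu : u ∈ x.1.support) (hv : v ∈ x.1.support) :
    X.skeletonGraph.Near u v := by
  classical
  by_cases h : u = v
  · exact .inl h
  refine .inr ⟨h, (X.isRelLowerSet_faces x.2.2.2).2 ?_ ⟨u, by simp⟩⟩
  intro w hw
  simp only [Finset.mem_insert, Finset.mem_singleton] at hw
  rcases hw with rfl | rfl
  · exact hu
  · exact hv

theorem mem_faces_of_near {u v : V} [DecidableEq V] (hu : {u} ∈ X.faces)
    (h : X.skeletonGraph.Near u v) : {u, v} ∈ X.faces := by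
  rcases h with rfl | h
  · simpa using hu
  · convert h.2

open Classical in
/-- The point with barycentric coordinates `1 - t` and `t` on the edge from `u` to `v`. -/
noncomputable def edgePoint {u v : V} (hu : {u} ∈ X.faces) (h : X.skeletonGraph.Near u v)
    (t : unitInterval) : X.Realization := by
  refine ⟨Finsupp.single u (1 - t : ℝ) + Finsupp.single v (t : ℝ), fun w => ?_, ?_, ?_⟩
  · have := t.2.1
    have := t.2.2
    have : (0 : ℝ) ≤ 1 - t := by linarith
    rw [Finsupp.add_apply, Finsupp.single_apply, Finsupp.single_apply]
    positivity
  · rw [Finsupp.sum_add_index' (fun _ => rfl) (fun _ _ _ => rfl), Finsupp.sum_single_index rfl,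
      Finsupp.sum_single_index rfl, sub_add_cancel]
  · refine (X.isRelLowerSet_faces (mem_faces_of_near hu h)).2 ?_ ?_
    · exact Finsupp.support_add.trans (Finset.union_subset_union Finsupp.support_single_subset
        Finsupp.support_single_subset)
    · rw [Finsupp.support_nonempty_iff]
      intro e
      have := congrArg (fun p : V →₀ ℝ => p.sum fun _ a => a) e
      simp only [Finsupp.sum_zero_index] at this
      rw [Finsupp.sum_add_index' (fun _ => rfl) (fun _ _ _ => rfl), Finsupp.sum_single_index rfl,
        Finsupp.sum_single_index rfl, sub_add_cancel] at this
      exact one_ne_zero this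

theorem edgePoint_apply [DecidableEq V] {u v : V} (hu : {u} ∈ X.faces)
    (h : X.skeletonGraph.Near u v) (t : unitInterval) (w : V) :
    (edgePoint hu h t).1 w = (if u = w then 1 - (t : ℝ) else 0) + if v = w then (t : ℝ) else 0 := by
  rw [← Finsupp.single_apply, ← Finsupp.single_apply, ← Finsupp.add_apply, edgePoint]

theorem support_edgePoint [DecidableEq V] {u v : V} (hu : {u} ∈ X.faces)
    (h : X.skeletonGraph.Near u v) (t : unitInterval) :
    (edgePoint hu h t).1.support ⊆ {u, v} := by
  intro w hw
  rw [Finsupp.mem_support_iff, edgePoint_apply] at hw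
  by_contra hcon
  simp only [Finset.mem_insert, Finset.mem_singleton, not_or] at hcon
  exact hw (by rw [if_neg (Ne.symm hcon.1), if_neg (Ne.symm hcon.2), add_zero])

theorem continuous_edgePoint {u v : V} (hu : {u} ∈ X.faces) (h : X.skeletonGraph.Near u v) :
    Continuous (edgePoint hu h) := by
  classical
  refine continuous_of_closedFace (mem_faces_of_near hu h) (support_edgePoint hu h) fun w => ?_
  simp only [edgePoint_apply]
  split_ifs <;> fun_prop

theorem left_mem_edgePoint {u v : V} (hu : {u} ∈ X.faces) (h : X.skeletonGraph.Near u v)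
    {t : unitInterval} (ht : (t : ℝ) < 1) : u ∈ (edgePoint hu h t).1.support := by
  classical
  rw [Finsupp.mem_support_iff, edgePoint_apply, if_pos rfl]
  have := t.2.1
  split_ifs <;> linarith

theorem right_mem_edgePoint {u v : V} (hu : {u} ∈ X.faces) (h : X.skeletonGraph.Near u v)
    {t : unitInterval} (ht : 0 < (t : ℝ)) : v ∈ (edgePoint hu h t).1.support := by
  classical
  rw [Finsupp.mem_support_iff, edgePoint_apply, if_pos rfl]
  have := t.2.2
  split_ifs <;> linarith

/-- For an edge, the midpoint lies in the open stars of both ends; flat sections of the bundle are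
compared there. -/
theorem edgePoint_half_symm {u v : V} (hu : {u} ∈ X.faces) (hv : {v} ∈ X.faces)
    (h : X.skeletonGraph.Near u v) : edgePoint hu h ⟨1 / 2, by norm_num, by norm_num⟩ =
      edgePoint hv h.symm ⟨1 / 2, by norm_num, by norm_num⟩ := by
  classical
  refine Subtype.ext (Finsupp.ext fun w => ?_)
  rw [edgePoint_apply, edgePoint_apply]
  norm_num [add_comm]

/-- A vertex, as a point of the realization. -/
noncomputable def vertex {v : V} (hv : {v} ∈ X.faces) : X.Realization :=
  edgePoint hv (SimpleGraph.near_refl _ v) 0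

theorem mem_vertex {v : V} (hv : {v} ∈ X.faces) : v ∈ (vertex hv).1.support :=
  left_mem_edgePoint hv _ (by simp)

theorem joinedIn_openStar {u v : V} (hu : {u} ∈ X.faces) (h : X.skeletonGraph.Near u v) :
    JoinedIn {x : X.Realization | u ∈ x.1.support} (vertex hu)
      (edgePoint hu h ⟨1 / 2, by norm_num, by norm_num⟩) := by
  classical
  have half : ∀ t : unitInterval, (t : ℝ) / 2 ∈ unitInterval := fun t => by
    have := t.2.1
    have := t.2.2
    constructor <;> linarith
  refine ⟨⟨⟨fun t => edgePoint hu h ⟨(t : ℝ) / 2, half t⟩, ?_⟩, ?_, ?_⟩, fun t => ?_⟩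
  · exact (continuous_edgePoint hu h).comp (by fun_prop)
  · refine Subtype.ext (Finsupp.ext fun w => ?_)
    rw [vertex, edgePoint_apply, edgePoint_apply]
    simp
  · simp
  · refine left_mem_edgePoint hu h ?_
    have := t.2.2
    simp only
    linarith

/-- The graph component of the vertices carrying a point is constant on open stars, hence a locally
constant function on the realization. -/
theorem preconnected_skeletonGraph (X : AbstractSimplicialComplex V)
    [PreconnectedSpace X.Realization] : X.skeletonGraph.Preconnected := by
  have comp_eq : ∀ {x : X.Realization} {u v}, u ∈ x.1.support → v ∈ x.1.support →
      X.skeletonGraph.connectedComponentMk u = X.skeletonGraph.connectedComponentMk v := by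
    intro x u v hu hv
    rcases near_of_mem hu hv with rfl | h
    · rfl
    · exact SimpleGraph.ConnectedComponent.sound h.reachable
  let c : X.Realization → X.skeletonGraph.ConnectedComponent := fun x =>
    X.skeletonGraph.connectedComponentMk (support_nonempty x).choose
  have hc : IsLocallyConstant c := by
    rw [IsLocallyConstant.iff_exists_open]
    intro x
    refine ⟨_, isOpen_openStar (support_nonempty x).choose, (support_nonempty x).choose_spec, ?_⟩
    exact fun y hy => comp_eq (support_nonempty y).choose_spec hy
  intro u v
  have h := hc.apply_eq_of_preconnectedSpace (vertex (X.singleton_mem u))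
    (vertex (X.singleton_mem v))
  refine SimpleGraph.ConnectedComponent.exact ?_
  rw [comp_eq (mem_vertex (X.singleton_mem u)) (support_nonempty _).choose_spec,
    comp_eq (mem_vertex (X.singleton_mem v)) (support_nonempty _).choose_spec]
  exact h

end PreAbstractSimplicialComplex.Realization

/-! ### The covering space of the realization and its monodromy. -/

namespace SimpleGraph.IsStarCover

open PreAbstractSimplicialComplex Realization

variable {V : Type u} {W : Type*} {X : PreAbstractSimplicialComplex V} {A : SimpleGraph W}
variable {f : W → V} {F : Type*} [TopologicalSpace F] [DiscreteTopology F]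

/-- The fibre bundle over the realization of `X` defined by a cover of its graph. -/
noncomputable def bundleCore (C : IsStarCover X.skeletonGraph A f) (φ : ∀ v, F ≃ {a // f a = v}) :
    FiberBundleCore V X.Realization F where
  baseSet v := {x | v ∈ x.1.support}
  isOpen_baseSet := isOpen_openStar
  indexAt x := (support_nonempty x).choose
  mem_baseSet_at x := (support_nonempty x).choose_spec
  coordChange u v _ := fiberTransition A φ u v
  coordChange_self _ _ _ _ := C.eq_fiberTransition (.inl rfl) (.inl rfl)
  continuousOn_coordChange _ _ :=
    ((continuous_of_discreteTopology (f := fiberTransition A φ _ _)).comp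
      continuous_snd).continuousOn
  -- The cocycle condition is the lifting of triangles, as `i, j, k` are vertices of one simplex.
  coordChange_comp i j k x hx c := by
    refine (C.eq_fiberTransition (near_of_mem hx.1.1 hx.2) ?_).symm
    refine C.near_of_near (C.near_fiberTransition (near_of_mem hx.1.1 hx.1.2) c).symm
      (C.near_fiberTransition (near_of_mem hx.1.2 hx.2) _) ?_
    rw [(φ i _).2, (φ k _).2]
    exact near_of_mem hx.1.1 hx.2

variable (C : IsStarCover X.skeletonGraph A f) (φ : ∀ v, F ≃ {a // f a = v})

/-- The flat section through `c` over the open star of `v`. -/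
noncomputable def flatSection (v : V) (c : F) (x : X.Realization) : (C.bundleCore φ).TotalSpace :=
  ((C.bundleCore φ).localTriv v).toOpenPartialHomeomorph.symm (x, c)

theorem continuousOn_flatSection (v : V) (c : F) :
    ContinuousOn (C.flatSection φ v c) {x | v ∈ x.1.support} := by
  refine ((C.bundleCore φ).localTriv v).toOpenPartialHomeomorph.continuousOn_symm.comp
    (continuous_id.prodMk continuous_const).continuousOn fun x hx => ?_
  exact (FiberBundleCore.mem_localTriv_target _ _ _).2 hx

theorem flatSection_eq {u v : V} {c c' : F} {x : X.Realization} (hu : u ∈ x.1.support)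
    (hv : v ∈ x.1.support) (h : A.Near (φ u c).1 (φ v c').1) :
    C.flatSection φ u c x = C.flatSection φ v c' x := by
  rw [← C.eq_fiberTransition (near_of_mem hu hv) h]
  unfold flatSection
  rw [FiberBundleCore.localTriv_symm_apply, FiberBundleCore.localTriv_symm_apply]
  congr 1
  exact ((C.bundleCore φ).coordChange_comp u v _ x
    ⟨⟨hu, hv⟩, (C.bundleCore φ).mem_baseSet_at x⟩ c).symm

theorem flatSection_injective {v : V} {c c' : F} {x : X.Realization} (hv : v ∈ x.1.support)
    (h : C.flatSection φ v c x = C.flatSection φ v c' x) : c = c' := by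
  unfold flatSection at h
  rw [FiberBundleCore.localTriv_symm_apply, FiberBundleCore.localTriv_symm_apply] at h
  have := Bundle.TotalSpace.mk_injective _ h
  exact C.fiberTransition_injective
    (near_of_mem hv ((C.bundleCore φ).mem_baseSet_at x)) this

/-- For an edge of `A`, the flat section over one open star leads to the midpoint, where it agrees
with the flat section over the other star. -/
theorem joined_flatSection (hX : ∀ v, {v} ∈ X.faces) {w w' : W} (h : A.Reachable w w') :
    Joined (C.flatSection φ (f w) ((φ (f w)).symm ⟨w, rfl⟩) (vertex (hX (f w))))
      (C.flatSection φ (f w') ((φ (f w')).symm ⟨w', rfl⟩) (vertex (hX (f w')))) := by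
  have step : ∀ {u v} (c : F) (huv : X.skeletonGraph.Near u v),
      Joined (C.flatSection φ u c (vertex (hX u)))
        (C.flatSection φ u c (edgePoint (hX u) huv ⟨1 / 2, by norm_num, by norm_num⟩)) := by
    intro u v c huv
    obtain ⟨p, hp⟩ := joinedIn_openStar (hX u) huv
    refine ⟨⟨⟨fun t => C.flatSection φ u c (p t), ?_⟩, ?_, ?_⟩⟩
    · exact (C.continuousOn_flatSection φ u c).comp_continuous p.continuous hp
    · simp
    · simp
  obtain ⟨q⟩ := h
  induction q with
  | nil => exact .refl _
  | @cons a b c hab q ih =>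
    refine Joined.trans ?_ ih
    have h := C.map_adj hab
    refine (step _ (.inr h)).trans (Joined.trans ?_ (step _ (.inr h.symm)).symm)
    rw [← edgePoint_half_symm (hX _) (hX _) (.inr h), C.flatSection_eq φ (u := f a) (v := f b)]
    · exact left_mem_edgePoint _ _ (by norm_num)
    · exact right_mem_edgePoint _ _ (by norm_num)
    · simpa using .inr hab

/-- Points `w, w'` of one fibre are joined by a path in the covering space. Its projection is a
null-homotopic loop, so its monodromy is trivial and the ends agree. -/
theorem injective_of_simplyConnectedSpace [SimplyConnectedSpace X.Realization]
    (C : IsStarCover X.skeletonGraph A f) (hX : ∀ v, {v} ∈ X.faces)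
    (hG : X.skeletonGraph.Preconnected) (hA : A.Preconnected) : Function.Injective f := by
  intro w w' hw
  let F := {a // f a = f w}
  let _ : TopologicalSpace F := ⊥
  have _ : DiscreteTopology F := ⟨rfl⟩
  let φ : ∀ v, F ≃ {a // f a = v} := fun v => (C.nonempty_fiber_equiv hG (f w) v).some
  obtain ⟨γ⟩ := C.joined_flatSection φ hX (hA w w')
  have cov : IsCoveringMap (C.bundleCore φ).proj :=
    FiberBundle.isCoveringMap (F := F) (E := (C.bundleCore φ).Fiber)
  -- With `v` and `v'` as variables the equation `f w = f w'` can be substituted, so that both end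
  -- points lie in literally the same fibre.
  have key : ∀ {v v'} (hv : f w = v) (hv' : f w' = v') (hvv' : v = v')
      (_ : _root_.Path (C.flatSection φ v ((φ v).symm ⟨w, hv⟩) (vertex (hX v)))
        (C.flatSection φ v' ((φ v').symm ⟨w', hv'⟩) (vertex (hX v')))), w = w' := by
    rintro v _ hv hv' rfl γ
    have e := cov.monodromy_eq_of_map_eq (x := vertex (hX v)) (y := vertex (hX v)) (γ := .refl _)
      (ex := ⟨C.flatSection φ v ((φ v).symm ⟨w, hv⟩) (vertex (hX v)), rfl⟩)
      (ey := ⟨C.flatSection φ v ((φ v).symm ⟨w', hv'⟩) (vertex (hX v)), rfl⟩)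
      (.mk γ) (Subsingleton.elim _ _)
    rw [cov.monodromy_refl] at e
    have := C.flatSection_injective φ (mem_vertex (hX v)) (congrArg Subtype.val e)
    simpa using this
  exact key rfl rfl hw γ

end SimpleGraph.IsStarCover

/-! ### Distance spheres have the descent property. -/

namespace SimpleGraph

variable {V : Type u} {G : SimpleGraph V} {o : V}

/-- If the cover is injective over `G` then the layers of the distance from `o` have the descent
property. -/
theorem isLayered_dist_of_injective (hG : G.Connected) (h4 : G.NoFourWheel)
    (hd : G.HasSmallDwheels)
    (hinj : ∀ a ∈ coverSet G o, ∀ b ∈ coverSet G o, a.headD o = b.headD o → a = b) :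
    G.IsLayered (G.dist o) := by
  have S := isPrecover_cover h4 hd o
  have surj : ∀ v, ∃ a ∈ coverSet G o, a.headD o = v := by
    have lift : ∀ {u v}, G.Walk u v → (∃ a ∈ coverSet G o, a.headD o = v) →
        ∃ a ∈ coverSet G o, a.headD o = u := by
      intro u v p h
      induction p with
      | nil => exact h
      | cons h p ih =>
      obtain ⟨a, ha, rfl⟩ := ih ‹_›
      obtain ⟨b, hb, e⟩ := exists_lift_cover h4 hd ha h.symm
      exact ⟨b, S.mem_of_adj hb.symm, e⟩
    intro v
    obtain ⟨p⟩ := hG.preconnected v o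
    exact lift p ⟨[], S.nil_mem, rfl⟩
  -- The section `s` inverts the cover. Through it, list length becomes distance from `o`.
  choose s hs hsv using surj
  have s_eq : ∀ {a}, a ∈ coverSet G o → s (a.headD o) = a := fun ha =>
    hinj _ (hs _) _ ha (hsv _)
  have adj : ∀ {u v}, G.Adj u v → (coverGraph G o).Adj (s u) (s v) := by
    intro u v h
    obtain ⟨a, ha, rfl⟩ := exists_lift_cover h4 hd (hs u) (by rwa [hsv])
    rwa [s_eq (S.mem_of_adj ha.symm)]
  have adj' : ∀ {v a}, (coverGraph G o).Adj (s v) a → G.Adj v (a.headD o) := by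
    intro v a h
    have := S.map_adj h
    rwa [hsv] at this
  have so : s o = [] := s_eq S.nil_mem
  have dist_le : ∀ n a, a ∈ coverSet G o → a.length = n → G.dist o (a.headD o) ≤ n := by
    intro n
    induction n with
    | zero =>
      intro a _ h
      obtain rfl := List.length_eq_zero_iff.1 h
      simp
    | succ n ih =>
      intro a ha h
      obtain ⟨u, lu, au⟩ := S.exists_below ha h
      have h1 := ih u (S.mem_of_adj au.symm) lu
      have h2 := hG.dist_triangle (u := o) (v := u.headD o) (w := a.headD o)
      rw [dist_eq_one_iff_adj.2 (S.map_adj au.symm)] at h2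
      omega
  have le_dist : ∀ {u v} (p : G.Walk u v), (s v).length ≤ (s u).length + p.length := by
    intro u v p
    induction p with
    | nil => simp
    | cons h p ih =>
      have := S.lev_le (adj h).symm
      rw [Walk.length_cons]
      omega
  have dist_eq : ∀ v, G.dist o v = (s v).length := by
    intro v
    refine le_antisymm (hsv v ▸ dist_le _ _ (hs v) (by rw [hsv])) ?_
    obtain ⟨p, hp⟩ := hG.exists_walk_length_eq_dist o v
    have := le_dist p
    rwa [so, hp, List.length_nil, zero_add] at this
  have dist_headD : ∀ {a}, a ∈ coverSet G o → G.dist o (a.headD o) = a.length := fun ha => by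
    rw [dist_eq, s_eq ha]
  refine ⟨⟨fun x y h => ?_, fun n x y h lx ly => ?_, fun n x u w lx xu xw lu lw ne uw => ?_⟩, h4,
    hd, fun x y hx hy => ?_, fun n x hx => ?_⟩
  · rw [dist_eq, dist_eq]
    exact S.lev_le (adj h)
  · rw [dist_eq] at lx ly
    obtain ⟨u, lu, xu, yu⟩ := S.exists_below_edge (adj h) lx ly
    exact ⟨u.headD o, (dist_headD (S.mem_of_adj xu.symm)).trans lu, adj' xu, adj' yu⟩
  · rw [dist_eq] at lx lu lw
    obtain ⟨t, lt, xt, ut, wt⟩ := S.below_vertex lx (adj xu) (adj xw) lu lw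
      (fun e => ne (by rw [← hsv u, e, hsv])) fun e => uw (hsv w ▸ adj' e)
    exact ⟨t.headD o, (dist_headD (S.mem_of_adj xt.symm)).trans lt, adj' xt, adj' ut, adj' wt⟩
  · rw [hG.dist_eq_zero_iff] at hx hy
    exact hx.symm.trans hy
  · rw [dist_eq] at hx
    obtain ⟨u, lu, xu⟩ := S.exists_below (hs x) hx
    exact ⟨u.headD o, (dist_headD (S.mem_of_adj xu.symm)).trans lu, adj' xu⟩

end SimpleGraph

namespace AbstractSimplicialComplex

variable {V : Type u} {X : AbstractSimplicialComplex V}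

open SimpleGraph

theorem connected_skeletonGraph [PathConnectedSpace X.Realization] : X.skeletonGraph.Connected where
  preconnected := PreAbstractSimplicialComplex.Realization.preconnected_skeletonGraph X
  nonempty := by
    obtain ⟨x⟩ := (inferInstance : Nonempty X.Realization)
    exact ⟨(PreAbstractSimplicialComplex.Realization.support_nonempty x).choose⟩

theorem isLayered_dist [SimplyConnectedSpace X.Realization] (h8 : X.IsLocated 8)
    (h5 : X.IsLocallyLarge 5) (o : V) : X.skeletonGraph.IsLayered (X.skeletonGraph.dist o) := by
  have h4 := X.noFourWheel h8.1 h5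
  have hd := X.hasSmallDwheels h8
  have hG : X.skeletonGraph.Connected := connected_skeletonGraph
  refine isLayered_dist_of_injective hG h4 hd fun a ha b hb hab => ?_
  have S := isPrecover_cover h4 hd o
  let A := (coverGraph X.skeletonGraph o).comap (Subtype.val : coverSet X.skeletonGraph o → List V)
  have C : IsStarCover X.skeletonGraph A fun a => a.1.headD o := by
    refine ⟨fun a b h => S.map_adj h, fun w z h => ?_, fun w a b h h' e => ?_,
      fun w a b h h' e => S.adj_of_adj h h' e⟩
    · obtain ⟨a, wa, e⟩ := exists_lift_cover h4 hd w.2 h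
      exact ⟨⟨a, S.mem_of_adj wa.symm⟩, wa, e⟩
    · exact Subtype.ext (S.inj h h' e)
  have reach : ∀ n a (ha : a ∈ coverSet X.skeletonGraph o), a.length = n →
      A.Reachable ⟨a, ha⟩ ⟨[], S.nil_mem⟩ := by
    intro n
    induction n with
    | zero =>
      intro a _ h
      obtain rfl := List.length_eq_zero_iff.1 h
      exact .refl _
    | succ n ih =>
      intro a ha h
      obtain ⟨u, lu, au⟩ := S.exists_below ha h
      have hau : A.Adj ⟨a, ha⟩ ⟨u, S.mem_of_adj au.symm⟩ := au
      exact hau.reachable.trans (ih u _ lu)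
  have hA : A.Preconnected := fun a b =>
    (reach _ a.1 a.2 rfl).trans (reach _ b.1 b.2 rfl).symm
  have := C.injective_of_simplyConnectedSpace X.singleton_mem hG.preconnected hA
  exact congrArg Subtype.val (this (a₁ := ⟨a, ha⟩) (a₂ := ⟨b, hb⟩) hab)

end AbstractSimplicialComplex

/-! ### Path metric and graph distance. -/

namespace AbstractSimplicialComplex

open PreAbstractSimplicialComplex Realization OneSkeleton

variable {V : Type u} {X : AbstractSimplicialComplex V}

theorem edgeDist_nonneg (x y : X.OneSkeleton) : 0 ≤ edgeDist x y :=
  div_nonneg (Finset.sum_nonneg fun _ _ => abs_nonneg _) zero_le_two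

theorem edgeDist_eq {x y : X.OneSkeleton} {s : Finset V} (hx : x.1.1.support ⊆ s)
    (hy : y.1.1.support ⊆ s) : edgeDist x y = (∑ v ∈ s, |x.1.1 v - y.1.1 v|) / 2 := by
  classical
  unfold edgeDist
  rw [Finsupp.sum_of_support_subset _ (s := s) _ _ fun _ _ => abs_zero]
  · rfl
  · exact Finsupp.support_sub.trans (Finset.union_subset hx hy)

theorem sum_apply_eq_one {x : X.Realization} {s : Finset V} (hx : x.1.support ⊆ s) :
    ∑ v ∈ s, x.1 v = 1 := by
  refine Eq.trans ?_ x.2.2.1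
  rw [Finsupp.sum_of_support_subset _ hx _ fun _ _ => rfl]

theorem edgeDist_le_one {x y : X.OneSkeleton} (h : OnCommonEdge x y) : edgeDist x y ≤ 1 := by
  obtain ⟨s, -, -, hx, hy⟩ := h
  rw [edgeDist_eq hx hy, div_le_one two_pos]
  calc ∑ v ∈ s, |x.1.1 v - y.1.1 v| ≤ ∑ v ∈ s, (x.1.1 v + y.1.1 v) := by
        refine Finset.sum_le_sum fun v _ => abs_le.2 ?_
        have := x.1.2.1 v
        have := y.1.2.1 v
        constructor <;> linarith
    _ = 2 := by
        rw [Finset.sum_add_distrib, sum_apply_eq_one hx, sum_apply_eq_one hy]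
        norm_num

/-- The affine extension to the realization of a function on the vertices. -/
noncomputable def affineExtension (f : V → ℝ) (x : X.Realization) : ℝ := x.1.sum fun v a => a * f v

theorem affineExtension_eq {f : V → ℝ} {x : X.Realization} {s : Finset V} (hx : x.1.support ⊆ s) :
    affineExtension f x = ∑ v ∈ s, x.1 v * f v :=
  Finsupp.sum_of_support_subset _ hx _ fun _ _ => zero_mul _

theorem affineExtension_sub_const {f : V → ℝ} {x : X.Realization} {s : Finset V}
    (hx : x.1.support ⊆ s) (c : ℝ) :
    affineExtension f x - c = ∑ v ∈ s, x.1 v * (f v - c) := by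
  simp_rw [mul_sub, Finset.sum_sub_distrib, ← Finset.sum_mul, sum_apply_eq_one hx, one_mul,
    affineExtension_eq hx]

theorem abs_affineExtension_sub_le {f : V → ℝ}
    (hf : ∀ u v, X.skeletonGraph.Adj u v → |f u - f v| ≤ 1) {x : X.Realization} {u : V}
    (hu : u ∈ x.1.support) : |affineExtension f x - f u| ≤ 1 := by
  rw [affineExtension_sub_const subset_rfl]
  refine (Finset.abs_sum_le_sum_abs _ _).trans
    (le_trans ?_ (sum_apply_eq_one (subset_refl x.1.support)).le)
  refine Finset.sum_le_sum fun v hv => ?_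
  rw [abs_mul, abs_of_nonneg (x.2.1 v)]
  refine mul_le_of_le_one_right (x.2.1 v) ?_
  rcases near_of_mem hv hu with rfl | h
  · simp
  · exact hf v u h

/-- The values on a simplex lie in an interval of length 1, and `c` is the midpoint of such an
interval. -/
theorem exists_forall_abs_sub_le (d : V → ℕ)
    (hd : ∀ u v, X.skeletonGraph.Adj u v → d u ≤ d v + 1) {s : Finset V} (hs : s ∈ X.faces) :
    ∃ c : ℝ, ∀ v ∈ s, |(d v : ℝ) - c| ≤ 1 / 2 := by
  classical
  obtain ⟨u, hu, hmin⟩ := s.exists_min_image d (X.isRelLowerSet_faces hs).1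
  refine ⟨d u + 1 / 2, fun v hv => ?_⟩
  have h1 : (d u : ℝ) ≤ d v := mod_cast hmin v hv
  have h2 : (d v : ℝ) ≤ d u + 1 := by
    by_cases h : v = u
    · subst h
      linarith
    · refine mod_cast hd v u ⟨h, (X.isRelLowerSet_faces hs).2 ?_ ⟨u, by simp⟩⟩
      intro w hw
      simp only [Finset.mem_insert, Finset.mem_singleton] at hw
      rcases hw with rfl | rfl <;> assumption
  rw [abs_le]
  constructor <;> linarith

/-- Coordinates sum to 1, so `c` may be subtracted from `d`. The remaining bound 1/2 matches the
factor 1/2 in `edgeDist`. -/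
theorem affineExtension_sub_le_edgeDist (d : V → ℕ)
    (hd : ∀ u v, X.skeletonGraph.Adj u v → d u ≤ d v + 1) {x y : X.OneSkeleton}
    (h : OnCommonEdge x y) :
    affineExtension (fun v => (d v : ℝ)) y.1 - affineExtension (fun v => (d v : ℝ)) x.1 ≤
      edgeDist x y := by
  obtain ⟨s, hs, -, hx, hy⟩ := h
  obtain ⟨c, hc⟩ := exists_forall_abs_sub_le d hd hs
  rw [edgeDist_eq hx hy, ← sub_sub_sub_cancel_right _ _ c, affineExtension_sub_const hx,
    affineExtension_sub_const hy, ← Finset.sum_sub_distrib, Finset.sum_div]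
  refine Finset.sum_le_sum fun v hv => ?_
  rw [← sub_mul]
  calc (y.1.1 v - x.1.1 v) * ((d v : ℝ) - c)
      ≤ |y.1.1 v - x.1.1 v| * |(d v : ℝ) - c| := (le_abs_self _).trans (abs_mul _ _).le
    _ ≤ |y.1.1 v - x.1.1 v| * (1 / 2) := mul_le_mul_of_nonneg_left (hc v hv) (abs_nonneg _)
    _ = |x.1.1 v - y.1.1 v| / 2 := by rw [abs_sub_comm]; ring

/-- There is a piecewise linear path of length `L` from `x` to `y` in the `1`-skeleton. -/
def HasPathOfLength (x y : X.OneSkeleton) (L : ℝ) : Prop :=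
  ∃ (n : ℕ) (p : ℕ → X.OneSkeleton), p 0 = x ∧ p n = y ∧
    (∀ i < n, OnCommonEdge (p i) (p (i + 1))) ∧
    L = ∑ i ∈ Finset.range n, edgeDist (p i) (p (i + 1))

theorem hasPathOfLength_zero (x : X.OneSkeleton) : HasPathOfLength x x 0 :=
  ⟨0, fun _ => x, rfl, rfl, by simp, by simp⟩

theorem HasPathOfLength.cons {x y z : X.OneSkeleton} {L : ℝ} (h : OnCommonEdge x y)
    (p : HasPathOfLength y z L) : HasPathOfLength x z (L + edgeDist x y) := by
  obtain ⟨n, p, rfl, rfl, hp, rfl⟩ := p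
  refine ⟨n + 1, fun i => i.casesOn x p, rfl, rfl, fun i hi => ?_, ?_⟩
  · cases i with
    | zero => exact h
    | succ i => exact hp i (by omega)
  · rw [Finset.sum_range_succ']
    rfl

theorem bddBelow_length (x y : X.OneSkeleton) : BddBelow {L | HasPathOfLength x y L} := by
  refine ⟨0, ?_⟩
  rintro _ ⟨n, p, -, -, -, rfl⟩
  exact Finset.sum_nonneg fun _ _ => edgeDist_nonneg _ _

/-- The affine extension of the distance from `u` grows at most by the length of the path, and each
end point contributes an error of at most 1. -/
theorem HasPathOfLength.dist_le {x y : X.OneSkeleton} {u v : V} (hG : X.skeletonGraph.Connected)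
    (hu : u ∈ x.1.1.support) (hv : v ∈ y.1.1.support) {L : ℝ} (h : HasPathOfLength x y L) :
    (X.skeletonGraph.dist u v : ℝ) ≤ L + 2 := by
  obtain ⟨n, p, rfl, rfl, hp, rfl⟩ := h
  have hd : ∀ a b, X.skeletonGraph.Adj a b →
      X.skeletonGraph.dist u a ≤ X.skeletonGraph.dist u b + 1 := by
    intro a b h
    have := hG.dist_triangle (u := u) (v := b) (w := a)
    rwa [SimpleGraph.dist_eq_one_iff_adj.2 h.symm] at this
  have hd' : ∀ a b, X.skeletonGraph.Adj a b →
      |(X.skeletonGraph.dist u a : ℝ) - X.skeletonGraph.dist u b| ≤ 1 := by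
    intro a b h
    have h1 : (X.skeletonGraph.dist u a : ℝ) ≤ X.skeletonGraph.dist u b + 1 := mod_cast hd a b h
    have h2 : (X.skeletonGraph.dist u b : ℝ) ≤ X.skeletonGraph.dist u a + 1 :=
      mod_cast hd b a h.symm
    rw [abs_le]
    constructor <;> linarith
  have key : ∑ i ∈ Finset.range n,
      (affineExtension (fun v => (X.skeletonGraph.dist u v : ℝ)) (p (i + 1)).1 -
        affineExtension (fun v => (X.skeletonGraph.dist u v : ℝ)) (p i).1) ≤
      ∑ i ∈ Finset.range n, edgeDist (p i) (p (i + 1)) :=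
    Finset.sum_le_sum fun i hi =>
      affineExtension_sub_le_edgeDist _ hd (hp i (Finset.mem_range.1 hi))
  rw [Finset.sum_range_sub
    (fun i => affineExtension (fun v => (X.skeletonGraph.dist u v : ℝ)) (p i).1)] at key
  have h1 := abs_le.1 (abs_affineExtension_sub_le hd' hu)
  have h2 := abs_le.1 (abs_affineExtension_sub_le hd' hv)
  simp only [SimpleGraph.dist_self, Nat.cast_zero, sub_zero] at h1
  linarith [h1.1, h1.2, h2.1, h2.2]

/-- A vertex, as a point of the `1`-skeleton. -/
noncomputable def skeletonVertex (X : AbstractSimplicialComplex V) (v : V) : X.OneSkeleton := by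
  classical
  refine ⟨vertex (X.singleton_mem v), ?_⟩
  have := support_edgePoint (X.singleton_mem v) (X.skeletonGraph.near_refl v) 0
  exact (Finset.card_le_card this).trans (Finset.card_le_two)

theorem support_skeletonVertex (v : V) : (skeletonVertex X v).1.1.support ⊆ {v} := by
  classical
  have := support_edgePoint (X.singleton_mem v) (X.skeletonGraph.near_refl v) 0
  rwa [Finset.pair_eq_singleton] at this

theorem onCommonEdge_skeletonVertex {x : X.OneSkeleton} {v : V} (hv : v ∈ x.1.1.support) :
    OnCommonEdge x (skeletonVertex X v) :=
  ⟨x.1.1.support, x.1.2.2.2, x.2, subset_rfl,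
    (support_skeletonVertex v).trans (Finset.singleton_subset_iff.2 hv)⟩

theorem exists_hasPathOfLength {x y : X.OneSkeleton} {u v : V} (hG : X.skeletonGraph.Connected)
    (hu : u ∈ x.1.1.support) (hv : v ∈ y.1.1.support) :
    ∃ L ≤ (X.skeletonGraph.dist u v : ℝ) + 2, HasPathOfLength x y L := by
  have walk : ∀ {u v} (p : X.skeletonGraph.Walk u v), v ∈ y.1.1.support →
      ∃ L ≤ (p.length : ℝ) + 1, HasPathOfLength (skeletonVertex X u) y L := by
    intro u v p hv
    induction p with
    | @nil u =>
      have h : OnCommonEdge (skeletonVertex X u) y := by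
        obtain ⟨s, hs, hc, h1, h2⟩ := onCommonEdge_skeletonVertex hv
        exact ⟨s, hs, hc, h2, h1⟩
      exact ⟨_, by simpa using edgeDist_le_one h, (hasPathOfLength_zero y).cons h⟩
    | @cons a b c h p ih =>
      classical
      obtain ⟨L, hL, q⟩ := ih hv
      have e : OnCommonEdge (skeletonVertex X a) (skeletonVertex X b) :=
        ⟨{a, b}, mem_faces_of_near (X.singleton_mem a) (.inr h), Finset.card_le_two,
          (support_skeletonVertex a).trans (by simp), (support_skeletonVertex b).trans (by simp)⟩
      refine ⟨_, ?_, q.cons e⟩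
      have := edgeDist_le_one e
      rw [SimpleGraph.Walk.length_cons]
      push_cast
      linarith
  obtain ⟨p, hp⟩ := hG.exists_walk_length_eq_dist u v
  obtain ⟨L, hL, q⟩ := walk p hv
  have e := onCommonEdge_skeletonVertex hu
  refine ⟨_, ?_, q.cons e⟩
  have := edgeDist_le_one e
  rw [hp] at hL
  linarith

theorem abs_pathDist_sub_dist_le {x y : X.OneSkeleton} {u v : V} (hG : X.skeletonGraph.Connected)
    (hu : u ∈ x.1.1.support) (hv : v ∈ y.1.1.support) :
    |pathDist x y - X.skeletonGraph.dist u v| ≤ 2 := by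
  obtain ⟨L, hL, hp⟩ := exists_hasPathOfLength hG hu hv
  have h1 : pathDist x y ≤ L := csInf_le (bddBelow_length x y) hp
  have h2 : (X.skeletonGraph.dist u v : ℝ) - 2 ≤ pathDist x y :=
    le_csInf ⟨L, hp⟩ fun L' h' => by linarith [HasPathOfLength.dist_le hG hu hv h']
  rw [abs_le]
  constructor <;> linarith

end AbstractSimplicialComplex

theorem theoremA :
    ∃ δ : ℝ, 0 ≤ δ ∧
      ∀ (V : Type u) (X : AbstractSimplicialComplex V),
        SimplyConnectedSpace X.Realization → X.IsLocated 8 → X.IsLocallyLarge 5 →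
          IsGromovHyperbolic
            (PreAbstractSimplicialComplex.OneSkeleton.pathDist
              (X := X.toPreAbstractSimplicialComplex)) δ := by
  -- The constant is `10241 + 12`, halved for the Gromov product: each of the six distances in the
  -- doubled inequality is replaced by a graph distance with error at most 2.
  refine ⟨10253 / 2, by norm_num, fun V X hX h8 h5 o x y z => ?_⟩
  have hG : X.skeletonGraph.Connected := X.connected_skeletonGraph
  have rep := fun p : X.OneSkeleton =>
    PreAbstractSimplicialComplex.Realization.support_nonempty p.1
  choose r hr using rep
  have approx := fun p q => abs_le.1 (X.abs_pathDist_sub_dist_le hG (hr p) (hr q))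
  have key := SimpleGraph.four_point hG (X.isLayered_dist h8 h5 (r o)) (r x) (r y) (r z)
  rw [min_le_iff] at key
  simp only [X.skeletonGraph.dist_comm (u := r o)] at key
  unfold gromovProduct
  rw [sub_le_iff_le_add, min_le_iff]
  refine key.imp (fun h => ?_) fun h => ?_
  · have h' : (X.skeletonGraph.dist (r x) (r o) : ℝ) + X.skeletonGraph.dist (r y) (r o) -
        X.skeletonGraph.dist (r x) (r y) ≤ X.skeletonGraph.dist (r x) (r o) +
        X.skeletonGraph.dist (r z) (r o) - X.skeletonGraph.dist (r x) (r z) + 10241 := by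
      exact_mod_cast h
    linarith [approx x o, approx y o, approx x y, approx z o, approx x z, (approx x o).1,
      (approx x o).2, (approx y o).1, (approx y o).2, (approx z o).1, (approx z o).2,
      (approx x y).1, (approx x y).2, (approx x z).1, (approx x z).2]
  · have h' : (X.skeletonGraph.dist (r y) (r o) : ℝ) + X.skeletonGraph.dist (r z) (r o) -
        X.skeletonGraph.dist (r y) (r z) ≤ X.skeletonGraph.dist (r x) (r o) +
        X.skeletonGraph.dist (r z) (r o) - X.skeletonGraph.dist (r x) (r z) + 10241 := by
      exact_mod_cast h
    linarith [(approx x o).1,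
      (approx x o).2, (approx y o).1, (approx y o).2, (approx z o).1, (approx z o).2,
      (approx y z).1, (approx y z).2, (approx x z).1, (approx x z).2]
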